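/- **Conventions.** Let $d\ge 1$. On $\mathbb{R}^m$ write $\widehat f(\xi)=(2\pi)^{-m/2}\int f(x)e^{-i\xi\cdot x}\,dx$, and let $\|\cdot\|$ be the Euclidean norm. For $m\in\mathbb{N}_0$ let $\mathcal S_{2m}(\mathbb{R})$ be the set of Schwartz functions $h$ with $h(\xi)=O(|\xi|^{2m})$ as $\xi\to0$. A measurable function $\widehat\phi\in L^2_{\rm loc}(\mathbb{R}\setminus\{0\})$ is a generalised Fourier transform of order $m$ of a continuous function $\phi:\mathbb{R}\to\mathbb{R}$ of at most polynomial growth if, for all $h\in\mathcal S_{2m}(\mathbb{R})$, $\widehat\phi\,h$ is integrable and $\int\widehat\phi\,h=\int\phi\,\widehat h$. **Assumptions.** 1. (Activation) $\phi:\mathbb{R}\to\mathbb{R}$ is bounded and Lipschitz, $\psi:\mathbb{R}\to\mathbb{R}$ is a Schwartz function, and $\phi$ has a generalised Fourier transform $\widehat\phi$ of some order $m$ such that $\widehat\psi\in\mathcal S_{2m}(\mathbb{R})$, $$(2\pi)^{d/2}\int_{\mathbb{R}}|\xi|^{-d}\,\overline{\widehat\psi(\xi)}\,\widehat\phi(\xi)\,d\xi=1,\qquad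 \int_{\mathbb{R}}|\xi|^{-d-2}\,\bigl|\overline{\widehat\psi(\xi)}\,\widehat\phi(\xi)\bigr|\,d\xi<\infty .$$ 2. (Finite bandwidth) $p_w:\mathbb{R}^d\to[0,\infty)$ and $p_b:\mathbb{R}\to[0,\infty)$ are probability density functions. Each is symmetric about the origin and bounded, has a finite second moment, and has an everywhere positive and integrable Fourier transform. Moreover $\int\|\xi\|^2\,\widehat{p_w}(\xi)\,d\xi<\infty$, and $p_b$ is differentiable with bounded derivative. 3. (Domain) $S>0$, $\mathcal X\subset\mathbb{R}^d$ is compact and contained in the interior of $[-S,S]^d$, and $\mathbb 1\in C^\infty(\mathbb{R}^d)$ takes values in $[0,1]$, equals $1$ on $\mathcal X$ and equals $0$ outside $[-S,S]^d$. 4. (Discretisation) For bandwidths $\sigma_w,\sigma_b>0$ put $$Z=\frac{(2\pi)^{1/2}\,\sigma_w^d\,\sigma_b}{\|\widehat{p_w}\|_{L^1}\,\|\widehat{p_b}\|_{L^1}} .$$ For $n\ge1$ and $D=n^d$, let $x_1,\dots,x_D$ be the nodes of the $d$-fold Cartesian product of the $n$-point left endpoint rule on $[-S,S]$, that is, the points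 whose coordinates lie in $\{-S+2Sk/n:\ 0\le k\le n-1\}$. For $N\ge1$, let $(w_i,b_i)$, $1\le i\le N$, be independent random vectors with density $\sigma_w^{-d}p_w(w/\sigma_w)\,\sigma_b^{-1}p_b(b/\sigma_b)$ on $\mathbb{R}^d\times\mathbb{R}$. Define $$I_{\sigma,D,N}f(x)=\sum_{i=1}^N\frac ZN\left(\sum_{j=1}^D\frac{(2S)^d}{D}\,\mathbb 1(x_j)\,f(x_j)\,\psi(w_i\cdot x_j+b_i)\right)\phi(w_i\cdot x+b_i).$$ For $f\in C^1(\mathbb{R}^d)$ let $M_1^*(f)=\max_{|\alpha|\le1}\sup_{x\in[-S,S]^d}|\partial^\alpha f(x)|$. **Theorem.** Under these assumptions there is a constant $C>0$, which may depend on $d$, $S$, $\mathcal X$, $\mathbb 1$, $\phi$, $\psi$, $p_w$ and $p_b$, but not on $f$, $\sigma_w$, $\sigma_b$, $D$, $N$ or $\delta$, such that for every $f\in C^1(\mathbb{R}^d)$ with $M_1^*(f)<\infty$, all $\sigma_w,\sigma_b>0$, all $D=n^d$ and $N$ as above, and every $\delta\in(0,1)$, with probability at least $1-\delta$, $$\sup_{x\in\mathcal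 X}\bigl|f(x)-I_{\sigma,D,N}f(x)\bigr|\le C\,M_1^*(f)\left\{\frac1{\sigma_w}+\frac{\sigma_w^d(\sigma_w+1)}{\sigma_b}+\frac{\sigma_b\sigma_w^d(\sigma_w+1)}{D^{1/d}}+\frac{\sigma_b\sigma_w^d\bigl(\sigma_w+\sqrt{\log\delta^{-1}}\bigr)}{\sqrt N}\right\}.$$ -/

import Mathlib

open MeasureTheory ProbabilityTheory Filter Topology Asymptotics
open scoped SchwartzMap ENNReal NNReal

noncomputable section

namespace Ridgelet

/-- Fourier transform in the unitary, angular-frequency normalisation,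
`f̂(ξ) = (2π)^{-m/2} ∫ f(x) exp(-i ξ·x) dx`, on an `m`-dimensional Euclidean space. -/
def fourierU {V : Type*} [NormedAddCommGroup V] [InnerProductSpace ℝ V] [MeasurableSpace V]
    [BorelSpace V] [FiniteDimensional ℝ V] (f : V → ℂ) (ξ : V) : ℂ :=
  (((2 * Real.pi) ^ (-((Module.finrank ℝ V : ℝ) / 2)) : ℝ) : ℂ) *
    ∫ x, f x * Complex.exp (-Complex.I * ((inner ℝ ξ x : ℝ) : ℂ))

/-- Fourier transform of a real-valued function. -/
def fourierReal {V : Type*} [NormedAddCommGroup V] [InnerProductSpace ℝ V] [MeasurableSpace V]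
    [BorelSpace V] [FiniteDimensional ℝ V] (f : V → ℝ) : V → ℂ :=
  fourierU fun x => ((f x : ℝ) : ℂ)

/-- `h(ξ) = O(|ξ|^{2m})` as `ξ → 0`; for a Schwartz function `h` this says `h ∈ 𝓢_{2m}(ℝ)`. -/
def VanishesToOrder (m : ℕ) (h : ℝ → ℂ) : Prop :=
  h =O[𝓝 0] fun ξ : ℝ => |ξ| ^ (2 * m)

/-- `t` is continuous and of at most polynomial growth of order `k`. -/
def PolyGrowth (k : ℕ) (t : ℝ → ℝ) : Prop :=
  Continuous t ∧ ∃ B : ℝ, ∀ x, |t x| ≤ B * (1 + |x| ^ k)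

/-- The measurable function `that ∈ L²_loc(ℝ ∖ {0})` is a generalised Fourier transform of `t`,
with test functions in `𝓢_{2m}(ℝ)`. -/
structure IsGenFourier (m : ℕ) (t : ℝ → ℝ) (that : ℝ → ℂ) : Prop where
  measurable : Measurable that
  memL2_loc : ∀ K : Set ℝ, IsCompact K → K ⊆ {0}ᶜ → MemLp that 2 (volume.restrict K)
  integrable : ∀ f : 𝓢(ℝ, ℂ), VanishesToOrder m f → Integrable fun ξ => that ξ * f ξ
  integral_eq : ∀ f : 𝓢(ℝ, ℂ), VanishesToOrder m f →
    ∫ ξ, that ξ * f ξ = ∫ x, (t x : ℂ) * fourierU f x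

/-- Assumptions on the activation function `φ`, with generalised Fourier transform `φhat`, and on
the Schwartz function `ψ` that defines the ridgelet transform in dimension `d`. -/
structure ActivationPair (d : ℕ) (φ : ℝ → ℝ) (φhat : ℝ → ℂ) (ψ : 𝓢(ℝ, ℝ)) : Prop where
  growth : PolyGrowth 0 φ
  /-- `φhat` is a generalised Fourier transform of `φ`, and `ψ̂` lies in the space `𝓢_{2m}(ℝ)` of
  test functions for which it represents `φ`. -/
  genFourier : ∃ m : ℕ, IsGenFourier m φ φhat ∧ VanishesToOrder m (fourierReal ψ)
  admissible : (((2 * Real.pi) ^ ((d : ℝ) / 2) : ℝ) : ℂ) *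
    ∫ ξ : ℝ, (((|ξ| ^ d)⁻¹ : ℝ) : ℂ) * (starRingEnd ℂ (fourierReal ψ ξ) * φhat ξ) = 1
  integrable : Integrable fun ξ : ℝ =>
    (|ξ| ^ (d + 2))⁻¹ * ‖starRingEnd ℂ (fourierReal ψ ξ) * φhat ξ‖

/-- A probability density function with the properties (i) symmetry, (ii) boundedness,
(iii) finite second moment, (iv) positive and (v) integrable Fourier transform. -/
structure RegularDensity {V : Type*} [NormedAddCommGroup V] [InnerProductSpace ℝ V]
    [MeasurableSpace V] [BorelSpace V] [FiniteDimensional ℝ V] (p : V → ℝ) : Prop where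
  measurable : Measurable p
  nonneg : ∀ x, 0 ≤ p x
  integrable : Integrable p
  integral_eq_one : ∫ x, p x = 1
  symm : ∀ x, p x = p (-x)
  bounded : eLpNorm p ⊤ volume < ⊤
  second_moment : Integrable fun x => ‖x‖ ^ 2 * p x
  fourier_pos : ∀ ξ, 0 < (fourierReal p ξ).re ∧ (fourierReal p ξ).im = 0
  fourier_integrable : Integrable (fourierReal p)

/-- `ℝ^d` with the Euclidean norm. -/
abbrev E (d : ℕ) := EuclideanSpace ℝ (Fin d)

/-- Assumptions on the densities `p_w` on `ℝ^d` and `p_b` on `ℝ`. -/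
structure FiniteBandwidth {d : ℕ} (pw : E d → ℝ) (pb : ℝ → ℝ) : Prop where
  regular_w : RegularDensity pw
  regular_b : RegularDensity pb
  fourier_second_moment : Integrable fun ξ => ‖ξ‖ ^ 2 * (fourierReal pw ξ).re
  differentiable_b : Differentiable ℝ pb
  deriv_bounded : ∃ B : ℝ, ∀ b, |deriv pb b| ≤ B

/-- The law with density `σ_w^{-d} p_w(w / σ_w) · σ_b^{-1} p_b(b / σ_b)` on `ℝ^d × ℝ`. -/
def nodeLaw {d : ℕ} (pw : E d → ℝ) (pb : ℝ → ℝ) (σw σb : ℝ) : Measure (E d × ℝ) :=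
  ((volume : Measure (E d)).withDensity
      fun w => ENNReal.ofReal ((σw ^ d)⁻¹ * pw (σw⁻¹ • w))).prod
    ((volume : Measure ℝ).withDensity fun b => ENNReal.ofReal (σb⁻¹ * pb (σb⁻¹ * b)))

/-- The total mass `Z = (2π)^{1/2} σ_w^d σ_b / (‖p̂_w‖_{L¹} ‖p̂_b‖_{L¹})`. -/
def totalMass {d : ℕ} (pw : E d → ℝ) (pb : ℝ → ℝ) (σw σb : ℝ) : ℝ :=
  Real.sqrt (2 * Real.pi) * σw ^ d * σb /
    ((∫ ξ, ‖fourierReal pw ξ‖) * ∫ ξ, ‖fourierReal pb ξ‖)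

/-- The hyper-cube `[-S, S]^d`. -/
def cube (d : ℕ) (S : ℝ) : Set (E d) := {x | ∀ i, x i ∈ Set.Icc (-S) S}

/-- A smooth cut-off function, equal to `1` on `X` and to `0` off `[-S, S]^d`. -/
structure IsMollifier {d : ℕ} (S : ℝ) (X : Set (E d)) (χ : E d → ℝ) : Prop where
  smooth : ContDiff ℝ (⊤ : ℕ∞) χ
  mem_Icc : ∀ x, χ x ∈ Set.Icc (0 : ℝ) 1
  eq_one : ∀ x ∈ X, χ x = 1
  eq_zero : ∀ x, x ∉ cube d S → χ x = 0

/-- Nodes of the `d`-fold Cartesian product of the `n`-point left endpoint rule on `[-S, S]`. -/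
def gridNode {d n : ℕ} (S : ℝ) (j : Fin d → Fin n) : E d :=
  WithLp.toLp 2 fun i => -S + 2 * S * ((j i : ℕ) : ℝ) / n

/-- The discretised operator with nodes `x_j`, `(w_i, b_i)` and weights `u_j`, `v_i`:
`I[f](x) = ∑ᵢ vᵢ (∑ⱼ uⱼ f(xⱼ) ψ(wᵢ·xⱼ + bᵢ)) φ(wᵢ·x + bᵢ)`. -/
def discreteOp {d : ℕ} {ι κ : Type*} [Fintype ι] [Fintype κ] (φ ψ : ℝ → ℝ)
    (node : κ → E d) (u : κ → ℝ) (θ : ι → E d × ℝ) (v : ι → ℝ) (f : E d → ℝ) (x : E d) : ℝ :=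
  ∑ i, v i * (∑ j, u j * f (node j) * ψ (inner ℝ (θ i).1 (node j) + (θ i).2)) *
    φ (inner ℝ (θ i).1 x + (θ i).2)

/-- `I_{σ,D,N}` with `D = n^d`: grid cubature with weights `(2S)^d D⁻¹ χ(x_j)` and Monte Carlo
nodes `θ_i = (w_i, b_i)` with weights `Z / N`. -/
def ridgeletOp {d : ℕ} (φ ψ : ℝ → ℝ) (pw : E d → ℝ) (pb : ℝ → ℝ) (S : ℝ) (χ : E d → ℝ)
    (σw σb : ℝ) (n N : ℕ) (θ : Fin N → E d × ℝ) : (E d → ℝ) → E d → ℝ :=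
  discreteOp φ ψ (gridNode S : (Fin d → Fin n) → E d)
    (fun j => (2 * S) ^ d * ((n : ℝ) ^ d)⁻¹ * χ (gridNode S j))
    θ (fun _ => totalMass pw pb σw σb * (N : ℝ)⁻¹)

/-- `M₁*(f) = max_{|α| ≤ 1} sup_{x ∈ [-S,S]^d} |∂^α f(x)|`. -/
def M1star {d : ℕ} (S : ℝ) (f : E d → ℝ) : ℝ≥0∞ :=
  (⨆ x ∈ cube d S, ‖f x‖ₑ) ⊔
    ⨆ i : Fin d, ⨆ x ∈ cube d S, ‖fderiv ℝ f x (EuclideanSpace.single i 1)‖ₑ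

end Ridgelet

end

/-! Write g = χ f. It is supported in the cube, Lipschitz with constant of order M₁*(f), and equal
to f on X. The error splits into a deterministic bias, where the random operator is replaced by its
mean, and a uniform fluctuation about that mean.

The bias is handled by three replacements (`exists_bias_bound`). Suppose first that the coefficient
∫ g(y) ψ(w·y + b) dy is exact and b is integrated against Lebesgue measure. The b-integral is then
the correlation of ψ and φ at w·(x - y), which is the Fourier integral of κ = conj ψ̂ · φ̂
(`correlation_eq_integral`). Averaging over w turns the phase into a multiple of p̂_w(σ_w ξ (y -
x)), and rescaling y yields |ξ|^{-d} times the mean of g(x + z / (σ_w ξ)) under the probability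
density p̂_w / ‖p̂_w‖₁. Admissibility makes the total weight one, so the Lipschitz bound on g leaves
an error O(1/σ_w) (`abs_reconstruction_sub_le`). Second, the true density of b is compared with its
value at the origin. Fourier inversion for p_b shows that Z is exactly the right normalisation.
Since ψ confines b to |b| ≲ 1 + ‖w‖ on average, the Lipschitz bound on p_b gives σ_w^d (σ_w + 1)/σ_b
(`abs_mean_sub_reconstruction_le`). Third, the grid rule is applied to an integrand whose Lipschitz
constant is of order 1 + ‖w‖.

The fluctuation is the supremum over x of a centred empirical process. McDiarmid's inequality
concentrates it about its mean and produces the √(log δ⁻¹) term. For the mean, increments in x of a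
summand are bounded by a multiple of |w·(x - y)|, because φ is Lipschitz and b cancels. As w is
symmetric, symmetrisation and contraction compare the process with the linear one x ↦ ∑ w_i·x, and
Cauchy-Schwarz bounds its supremum by R ‖∑ w_i‖, of mean order σ_w √N. No covering numbers enter.

There remains the standard deviation at one fixed point, which need not be O(σ_w) when σ_w is small.
The coefficients have second moment O(min(1, 1/σ_b)), because a spread-out bias rarely meets the
bulk of ψ. This is just enough for that term to be absorbed by 1/σ_w together with the stated Monte
Carlo rate (`exists_std_bound`). -/

namespace Ridgelet

/-! ### Concentration and second moments for independent variables -/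

section ProductMeasure

variable {Θ : Type*} [MeasurableSpace Θ] (μ : Measure Θ) [IsProbabilityMeasure μ]

lemma measurable_fin_cons {N : ℕ} :
    Measurable fun p : Θ × (Fin N → Θ) => (Fin.cons p.1 p.2 : Fin (N + 1) → Θ) := by
  refine measurable_pi_lambda _ fun i => ?_
  refine Fin.cases ?_ (fun j => ?_) i
  · simpa using measurable_fst
  · simpa using! (measurable_pi_apply j).comp measurable_snd

lemma measurePreserving_fin_cons (N : ℕ) :
    MeasurePreserving (fun p : Θ × (Fin N → Θ) => (Fin.cons p.1 p.2 : Fin (N + 1) → Θ))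
      (μ.prod (Measure.pi fun _ : Fin N => μ)) (Measure.pi fun _ : Fin (N + 1) => μ) := by
  have h := (measurePreserving_piFinSuccAbove (fun _ : Fin (N + 1) => μ) 0).symm
  convert h using 1
  ext p i
  simp [MeasurableEquiv.piFinSuccAbove, Fin.insertNthEquiv]

lemma integral_pi_fin_succ {N : ℕ} {F : (Fin (N + 1) → Θ) → ℝ}
    (hF : AEStronglyMeasurable F (Measure.pi fun _ : Fin (N + 1) => μ)) :
    ∫ θ, F θ ∂(Measure.pi fun _ : Fin (N + 1) => μ) =
      ∫ p : Θ × (Fin N → Θ), F (Fin.cons p.1 p.2) ∂(μ.prod (Measure.pi fun _ : Fin N => μ)) := by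
  have h := measurePreserving_fin_cons μ N
  rw [← h.map_eq] at hF ⊢
  exact integral_map h.measurable.aemeasurable hF

/-- **McDiarmid's inequality** for the moment generating function: a bounded measurable function of
`N` independent variables which varies by at most `c` in each variable is sub-Gaussian. -/
lemma integral_exp_le_of_boundedDifferences {N : ℕ} {F : (Fin N → Θ) → ℝ} (hF : Measurable F)
    {B c : ℝ} (hB : ∀ θ, |F θ| ≤ B)
    (hc : ∀ θ i t, |F θ - F (Function.update θ i t)| ≤ c) (r : ℝ) :
    ∫ θ, Real.exp (r * (F θ - ∫ θ', F θ' ∂(Measure.pi fun _ : Fin N => μ)))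
        ∂(Measure.pi fun _ : Fin N => μ) ≤ Real.exp (N * (c ^ 2 * r ^ 2 / 2)) := by
  induction N with
  | zero =>
    rw [Measure.pi_of_empty (fun _ : Fin 0 => μ) (fun i => i.elim0)]
    simp
  | succ N ih =>
    set π := Measure.pi fun _ : Fin N => μ
    let H : Θ × (Fin N → Θ) → ℝ := fun p => F (Fin.cons p.1 p.2)
    have hH : Measurable H := hF.comp measurable_fin_cons
    have hHB : ∀ p, |H p| ≤ B := fun p => hB _
    have hHi : Integrable H (μ.prod π) :=
      Integrable.of_bound hH.aestronglyMeasurable B (ae_of_all _ hHB)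
    have hHt : ∀ ρ, Integrable (fun t => H (t, ρ)) μ := fun ρ =>
      Integrable.of_bound (hH.comp measurable_prodMk_right).aestronglyMeasurable B
        (ae_of_all _ fun t => hHB _)
    -- Averaging out the first coordinate preserves the bound and the bounded differences, so the
    -- induction hypothesis applies to `G`. The remainder `H - G` is centred in the first coordinate
    -- and falls under Hoeffding's lemma.
    let G : (Fin N → Θ) → ℝ := fun ρ => ∫ t, H (t, ρ) ∂μ
    have hG : Measurable G := (hH.stronglyMeasurable.integral_prod_left').measurable
    have hGB : ∀ ρ, |G ρ| ≤ B := fun ρ => by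
      have := norm_integral_le_of_norm_le_const (μ := μ) (f := fun t => H (t, ρ)) (C := B)
        (ae_of_all _ fun t => hHB _)
      simpa using this
    have hGc : ∀ ρ i t, |G ρ - G (Function.update ρ i t)| ≤ c := by
      intro ρ i t
      have h1 : G ρ - G (Function.update ρ i t) =
          ∫ s, (H (s, ρ) - H (s, Function.update ρ i t)) ∂μ := (integral_sub (hHt _) (hHt _)).symm
      rw [h1]
      have := norm_integral_le_of_norm_le_const (μ := μ)
        (f := fun s => H (s, ρ) - H (s, Function.update ρ i t)) (C := c)
        (ae_of_all _ fun s => by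
          have := hc (Fin.cons s ρ) i.succ t
          simpa [H, Fin.cons_update] using this)
      simpa using this
    have hmean : ∫ θ, F θ ∂(Measure.pi fun _ : Fin (N + 1) => μ) = ∫ ρ, G ρ ∂π := by
      rw [integral_pi_fin_succ μ hF.aestronglyMeasurable]
      exact integral_prod_symm _ hHi
    rw [hmean]
    set m := ∫ ρ, G ρ ∂π
    have hinner : ∀ ρ, ∫ t, Real.exp (r * (H (t, ρ) - m)) ∂μ ≤
        Real.exp (c ^ 2 * r ^ 2 / 2) * Real.exp (r * (G ρ - m)) := by
      intro ρ
      -- `G ρ` averages values that all lie within `c` of `H (t, ρ)`. The symmetric interval of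
      -- length `2 * c` costs a factor four against the sharp variance proxy `c ^ 2 / 4`, which only
      -- affects constants.
      have hI : ∀ t, H (t, ρ) - G ρ ∈ Set.Icc (-c) c := by
        intro t
        rw [Set.mem_Icc, ← abs_le]
        have h1 : H (t, ρ) - G ρ = ∫ s, (H (t, ρ) - H (s, ρ)) ∂μ := by
          rw [integral_sub (integrable_const _) (hHt _)]; simp [G]
        rw [h1]
        have := norm_integral_le_of_norm_le_const (μ := μ)
          (f := fun s => H (t, ρ) - H (s, ρ)) (C := c)
          (ae_of_all _ fun s => by
            have := hc (Fin.cons t ρ) 0 s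
            simpa [H, Fin.update_cons_zero] using this)
        simpa using this
      have hsub := hasSubgaussianMGF_of_mem_Icc_of_integral_eq_zero (μ := μ)
        (X := fun t => H (t, ρ) - G ρ) (a := -c) (b := c)
        ((hH.comp measurable_prodMk_right).sub_const _).aemeasurable (ae_of_all _ hI)
        (by rw [integral_sub (hHt _) (integrable_const _)]; simp [G])
      have h2 := hsub.mgf_le r
      have h3 : ((((‖c - -c‖₊ / 2) ^ 2 : ℝ≥0)) : ℝ) = c ^ 2 := by
        push_cast
        rw [div_pow, Real.norm_eq_abs, sq_abs]; ring
      rw [h3] at h2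
      calc ∫ t, Real.exp (r * (H (t, ρ) - m)) ∂μ
          = ∫ t, Real.exp (r * (H (t, ρ) - G ρ)) * Real.exp (r * (G ρ - m)) ∂μ := by
            congr 1; ext t; rw [← Real.exp_add]; ring_nf
        _ = mgf (fun t => H (t, ρ) - G ρ) μ r * Real.exp (r * (G ρ - m)) := by
            rw [integral_mul_const]; rfl
        _ ≤ _ := by gcongr
    have hexpI : ∀ {α : Type _} [MeasurableSpace α] (ν : Measure α) [IsProbabilityMeasure ν]
        (K : α → ℝ), Measurable K → (∀ a, |K a| ≤ B) →
        Integrable (fun a => Real.exp (r * (K a - m))) ν := by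
      intro α _ ν _ K hK hKB
      refine Integrable.of_bound (by fun_prop) (Real.exp (|r| * (B + |m|))) (ae_of_all _ fun a => ?_)
      rw [Real.norm_eq_abs, Real.abs_exp, Real.exp_le_exp]
      calc r * (K a - m) ≤ |r * (K a - m)| := le_abs_self _
        _ = |r| * |K a - m| := abs_mul _ _
        _ ≤ |r| * (B + |m|) := by
          gcongr
          exact (abs_sub _ _).trans (by gcongr; exact hKB a)
    rw [integral_pi_fin_succ μ (by fun_prop)]
    have hexp := hexpI (μ.prod π) H hH hHB
    calc ∫ p : Θ × (Fin N → Θ), Real.exp (r * (H p - m)) ∂(μ.prod π)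
        = ∫ ρ, ∫ t, Real.exp (r * (H (t, ρ) - m)) ∂μ ∂π := integral_prod_symm _ hexp
      _ ≤ ∫ ρ, Real.exp (c ^ 2 * r ^ 2 / 2) * Real.exp (r * (G ρ - m)) ∂π :=
          integral_mono hexp.integral_prod_right ((hexpI π G hG hGB).const_mul _) hinner
      _ = Real.exp (c ^ 2 * r ^ 2 / 2) * ∫ ρ, Real.exp (r * (G ρ - m)) ∂π := integral_const_mul _ _
      _ ≤ Real.exp (c ^ 2 * r ^ 2 / 2) * Real.exp (N * (c ^ 2 * r ^ 2 / 2)) := by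
          gcongr; exact ih hG hGB hGc
      _ = _ := by rw [← Real.exp_add]; push_cast; ring_nf

/-- **McDiarmid's inequality**, upper tail. -/
lemma one_sub_le_measure_boundedDifferences {N : ℕ} {F : (Fin N → Θ) → ℝ} (hF : Measurable F)
    {B c : ℝ} (hB : ∀ θ, |F θ| ≤ B) (hc0 : 0 < c) (hN : 1 ≤ N)
    (hc : ∀ θ i t, |F θ - F (Function.update θ i t)| ≤ c) {δ : ℝ} (hδ : 0 < δ) (hδ1 : δ < 1) :
    ENNReal.ofReal (1 - δ) ≤ (Measure.pi fun _ : Fin N => μ)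
      {θ | F θ ≤ ∫ θ', F θ' ∂(Measure.pi fun _ : Fin N => μ) +
        c * Real.sqrt (2 * N) * Real.sqrt (Real.log δ⁻¹)} := by
  set π := Measure.pi fun _ : Fin N => μ
  set m := ∫ θ', F θ' ∂π
  have hsub : HasSubgaussianMGF (fun θ => F θ - m) (Real.toNNReal (N * c ^ 2)) π := by
    refine ⟨fun r => ?_, fun r => ?_⟩
    · refine Integrable.of_bound (by fun_prop) (Real.exp (|r| * (B + |m|)))
        (ae_of_all _ fun a => ?_)
      rw [Real.norm_eq_abs, Real.abs_exp, Real.exp_le_exp]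
      calc r * (F a - m) ≤ |r * (F a - m)| := le_abs_self _
        _ = |r| * |F a - m| := abs_mul _ _
        _ ≤ |r| * (B + |m|) := by
          gcongr
          exact (abs_sub _ _).trans (by gcongr; exact hB a)
    · refine (integral_exp_le_of_boundedDifferences μ hF hB hc r).trans_eq ?_
      rw [Real.coe_toNNReal _ (by positivity)]
      ring_nf
  have hlog : 0 < Real.log δ⁻¹ := Real.log_pos ((one_lt_inv₀ hδ).2 hδ1)
  -- Chosen so that ε² / (2 N c²) = log δ⁻¹, which makes the sub-Gaussian tail equal to δ.
  set ε := c * Real.sqrt (2 * N) * Real.sqrt (Real.log δ⁻¹)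
  have hN' : (0 : ℝ) < N := by exact_mod_cast hN
  have htail := hsub.measure_ge_le (ε := ε) (by positivity)
  have hε : ε ^ 2 = 2 * (N * c ^ 2) * Real.log δ⁻¹ := by
    simp only [ε, mul_pow]
    rw [Real.sq_sqrt (by positivity), Real.sq_sqrt hlog.le]; ring
  rw [Real.coe_toNNReal _ (by positivity), hε, neg_div,
    mul_div_cancel_left₀ _ (by positivity), Real.exp_neg, Real.exp_log (by positivity),
    inv_inv] at htail
  have hms : MeasurableSet {θ | ε ≤ F θ - m} := measurableSet_le (by fun_prop) (by fun_prop)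
  have hcompl : π.real {θ | ε ≤ F θ - m}ᶜ = 1 - π.real {θ | ε ≤ F θ - m} :=
    probReal_compl_eq_one_sub hms
  have : 1 - δ ≤ π.real {θ | ε ≤ F θ - m}ᶜ := by rw [hcompl]; linarith
  calc ENNReal.ofReal (1 - δ) ≤ ENNReal.ofReal (π.real {θ | ε ≤ F θ - m}ᶜ) :=
        ENNReal.ofReal_le_ofReal this
    _ = π {θ | ε ≤ F θ - m}ᶜ := by simp [Measure.real]
    _ ≤ _ := by
      refine measure_mono fun θ hθ => ?_
      simp only [Set.mem_compl_iff, Set.mem_ofPred_eq, not_le] at hθ ⊢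
      linarith

/-- The second moment of a sum of independent centred vectors. -/
lemma integral_norm_sq_sum {H : Type*} [NormedAddCommGroup H] [InnerProductSpace ℝ H]
    [CompleteSpace H] [MeasurableSpace H] [BorelSpace H] [SecondCountableTopology H]
    {h : Θ → H} (hm : Measurable h) (hsq : Integrable (fun t => ‖h t‖ ^ 2) μ)
    (h0 : ∫ t, h t ∂μ = 0) (N : ℕ) (a : H) :
    Integrable (fun θ => ‖a + ∑ i, h (θ i)‖ ^ 2) (Measure.pi fun _ : Fin N => μ) ∧
    ∫ θ, ‖a + ∑ i, h (θ i)‖ ^ 2 ∂(Measure.pi fun _ : Fin N => μ) =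
      ‖a‖ ^ 2 + N * ∫ t, ‖h t‖ ^ 2 ∂μ := by
  have hInt : Integrable h μ := by
    refine ((integrable_const (1 : ℝ)).add hsq).mono' hm.aestronglyMeasurable
      (ae_of_all _ fun t => ?_)
    simp only [Pi.add_apply]
    nlinarith [sq_nonneg (‖h t‖ - 1), norm_nonneg (h t)]
  -- The shift `a` absorbs the vector that is peeled off; the cross term 2⟨a, h⟩ integrates to zero
  -- by `h0`.
  induction N generalizing a with
  | zero =>
    rw [Measure.pi_of_empty (fun _ : Fin 0 => μ) (fun i => i.elim0)]
    refine ⟨?_, by simp⟩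
    exact integrable_dirac (by simp)
  | succ N ih =>
    have hmeas : Measurable fun θ : Fin (N + 1) → Θ => ‖a + ∑ i, h (θ i)‖ ^ 2 := by fun_prop
    have hin : Integrable (fun t => 2 * inner ℝ a (h t)) μ := (hInt.const_inner a).const_mul 2
    have hin' : Integrable (fun t => ‖a‖ ^ 2 + 2 * inner ℝ a (h t)) μ :=
      (integrable_const _).add hin
    have hsqa : Integrable (fun t => ‖a + h t‖ ^ 2) μ := by
      simp_rw [norm_add_sq_real]
      exact hin'.add hsq
    have hval : ∫ t, ‖a + h t‖ ^ 2 ∂μ = ‖a‖ ^ 2 + ∫ t, ‖h t‖ ^ 2 ∂μ := by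
      simp_rw [norm_add_sq_real]
      rw [integral_add hin' hsq, integral_add (integrable_const _) hin, integral_const_mul, integral_inner hInt, h0]
      simp
    have hcons : ∀ p : Θ × (Fin N → Θ),
        ‖a + ∑ i, h ((Fin.cons p.1 p.2 : Fin (N + 1) → Θ) i)‖ ^ 2 =
          ‖(a + h p.1) + ∑ i, h (p.2 i)‖ ^ 2 := by
      intro p; simp [Fin.sum_univ_succ, add_assoc]
    have hI : Integrable (fun p : Θ × (Fin N → Θ) => ‖(a + h p.1) + ∑ i, h (p.2 i)‖ ^ 2)
        (μ.prod (Measure.pi fun _ : Fin N => μ)) := by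
      have hmeas' : Measurable fun p : Θ × (Fin N → Θ) => ‖(a + h p.1) + ∑ i, h (p.2 i)‖ ^ 2 := by
        simp_rw [← hcons]
        exact hmeas.comp measurable_fin_cons
      rw [integrable_prod_iff hmeas'.aestronglyMeasurable]
      refine ⟨ae_of_all _ fun t => (ih (a + h t)).1, ?_⟩
      have : ∀ t, ∫ y : Fin N → Θ, ‖‖(a + h t) + ∑ i, h (y i)‖ ^ 2‖
          ∂(Measure.pi fun _ : Fin N => μ) = ‖a + h t‖ ^ 2 + N * ∫ t, ‖h t‖ ^ 2 ∂μ := by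
        intro t
        simp_rw [norm_pow, norm_norm]
        exact (ih (a + h t)).2
      simp_rw [this]
      exact hsqa.add (integrable_const _)
    refine ⟨?_, ?_⟩
    · rw [← (measurePreserving_fin_cons μ N).integrable_comp hmeas.aestronglyMeasurable]
      exact hI.congr (ae_of_all _ fun p => (hcons p).symm)
    · rw [integral_pi_fin_succ μ hmeas.aestronglyMeasurable]
      simp_rw [hcons]
      rw [integral_prod _ hI]
      have : ∀ t, ∫ y : Fin N → Θ, ‖(a + h t) + ∑ i, h (y i)‖ ^ 2
          ∂(Measure.pi fun _ : Fin N => μ) = ‖a + h t‖ ^ 2 + N * ∫ t, ‖h t‖ ^ 2 ∂μ :=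
        fun t => (ih (a + h t)).2
      simp_rw [this]
      rw [integral_add hsqa (integrable_const _), hval]
      simp; ring

/-- The mean norm of a sum of independent centred vectors. -/
lemma integral_norm_sum_le {H : Type*} [NormedAddCommGroup H] [InnerProductSpace ℝ H]
    [CompleteSpace H] [MeasurableSpace H] [BorelSpace H] [SecondCountableTopology H]
    {h : Θ → H} (hm : Measurable h) (hsq : Integrable (fun t => ‖h t‖ ^ 2) μ)
    (h0 : ∫ t, h t ∂μ = 0) (N : ℕ) {s : ℝ} (hs : 0 ≤ s) (hs2 : ∫ t, ‖h t‖ ^ 2 ∂μ ≤ s ^ 2) :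
    Integrable (fun θ => ‖∑ i, h (θ i)‖) (Measure.pi fun _ : Fin N => μ) ∧
    ∫ θ, ‖∑ i, h (θ i)‖ ∂(Measure.pi fun _ : Fin N => μ) ≤ Real.sqrt N * s := by
  obtain ⟨hI, hE⟩ := integral_norm_sq_sum μ hm hsq h0 N 0
  simp only [zero_add, norm_zero] at hI hE
  set π := Measure.pi fun _ : Fin N => μ
  have hmeas : Measurable fun θ : Fin N → Θ => ‖∑ i, h (θ i)‖ := by fun_prop
  have hInt : Integrable (fun θ : Fin N → Θ => ‖∑ i, h (θ i)‖) π := by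
    refine ((integrable_const (1 : ℝ)).add hI).mono' hmeas.aestronglyMeasurable
      (ae_of_all _ fun t => ?_)
    simp only [Pi.add_apply, norm_norm]
    nlinarith [sq_nonneg (‖∑ i, h (t i)‖ - 1), norm_nonneg (∑ i, h (t i))]
  refine ⟨hInt, ?_⟩
  set m := ∫ θ : Fin N → Θ, ‖∑ i, h (θ i)‖ ∂π
  -- Nonnegativity of the variance: the squared mean norm is at most the second moment.
  have hvar : 0 ≤ ∫ θ : Fin N → Θ, (‖∑ i, h (θ i)‖ ^ 2 - (2 * m) * ‖∑ i, h (θ i)‖ + m ^ 2) ∂π :=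
    integral_nonneg fun θ => by
      change 0 ≤ ‖∑ i, h (θ i)‖ ^ 2 - (2 * m) * ‖∑ i, h (θ i)‖ + m ^ 2
      nlinarith [sq_nonneg (‖∑ i, h (θ i)‖ - m)]
  have hInt2 : Integrable (fun θ : Fin N → Θ => (2 * m) * ‖∑ i, h (θ i)‖) π := hInt.const_mul _
  have hint3 : Integrable
      (fun θ : Fin N → Θ => ‖∑ i, h (θ i)‖ ^ 2 - (2 * m) * ‖∑ i, h (θ i)‖) π := hI.sub hInt2
  rw [integral_add hint3 (integrable_const _), integral_sub hI hInt2, integral_const_mul,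
    hE] at hvar
  simp only [integral_const, probReal_univ, one_smul] at hvar
  have h1 : m ^ 2 ≤ N * s ^ 2 := by
    have : (N : ℝ) * ∫ t, ‖h t‖ ^ 2 ∂μ ≤ N * s ^ 2 := by gcongr
    have hm' : ∫ θ : Fin N → Θ, ‖∑ i, h (θ i)‖ ∂π = m := rfl
    rw [hm'] at hvar
    nlinarith
  refine abs_le_of_sq_le_sq' ?_ (by positivity) |>.2
  rw [mul_pow, Real.sq_sqrt (by positivity)]; exact h1

end ProductMeasure

end Ridgelet

namespace Ridgelet

/-! ### Symmetrisation, contraction and uniform deviation -/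

section ExpectedSupremum

lemma measurable_finset_sup'_apply {α V : Type*} [MeasurableSpace α] {T : Finset V}
    (hT : T.Nonempty) {u : α → V → ℝ} (hu : ∀ x ∈ T, Measurable fun a => u a x) :
    Measurable fun a => T.sup' hT (u a) := by
  have := Finset.measurable_sup' hT (f := fun x a => u a x) hu
  convert this using 2 with a
  simp

lemma integrable_finset_sup' {α V : Type*} [MeasurableSpace α] {μ : Measure α} {T : Finset V}
    (hT : T.Nonempty) {u : α → V → ℝ} (hu : ∀ x ∈ T, Integrable (fun a => u a x) μ) :
    Integrable (fun a => T.sup' hT (u a)) μ := by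
  classical
  induction hT using Finset.Nonempty.cons_induction with
  | singleton x => simpa using hu x (by simp)
  | cons x T hx hT ih =>
    simp_rw [Finset.sup'_cons hT]
    exact (hu x (by simp)).sup (ih fun y hy => hu y (by simp [hy]))

/-- The comparison step of the contraction principle. -/
lemma sup'_add_sup'_sub_le {V : Type*} {T : Finset V} (hT : T.Nonempty) (A : V → ℝ) {u h : V → ℝ}
    (huh : ∀ x y, |u x - u y| ≤ |h x - h y|) :
    T.sup' hT (fun x => A x + u x) + T.sup' hT (fun x => A x - u x) ≤
      T.sup' hT (fun x => A x + h x) + T.sup' hT (fun x => A x - h x) := by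
  -- At the two maximisers the left side is A x + A y + (u x - u y), at most A x + A y + |h x - h
  -- y|. According to the sign of h x - h y, testing the right side at (x, y) or at (y, x) attains
  -- this value.
  obtain ⟨x, hx, hxe⟩ := T.exists_mem_eq_sup' hT (fun x => A x + u x)
  obtain ⟨y, hy, hye⟩ := T.exists_mem_eq_sup' hT (fun x => A x - u x)
  rw [hxe, hye]
  have h1 := T.le_sup' (fun x => A x + h x) hx
  have h2 := T.le_sup' (fun x => A x + h x) hy
  have h3 := T.le_sup' (fun x => A x - h x) hx
  have h4 := T.le_sup' (fun x => A x - h x) hy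
  have h5 := (le_abs_self _).trans (huh x y)
  rcases abs_cases (h x - h y) with ⟨h6, -⟩ | ⟨h6, -⟩ <;> linarith

variable {Θ : Type*} [MeasurableSpace Θ] (μ : Measure Θ) [IsProbabilityMeasure μ]
  {V : Type*} [NormedAddCommGroup V] [InnerProductSpace ℝ V] [MeasurableSpace V] [BorelSpace V]

/-- Symmetrisation and contraction of one summand, for a symmetric vector `W`. -/
lemma integral_sup'_centred_le {T : Finset V} (hT : T.Nonempty) (A : V → ℝ) {Y : Θ → V → ℝ}
    (hY : ∀ x, Integrable (fun t => Y t x) μ) {W : Θ → V} (hW : Measurable W)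
    (hWi : Integrable W μ) (hsymm : μ.map W = μ.map fun t => -W t) {c : ℝ} (hc : 0 ≤ c)
    (hYW : ∀ t x y, |Y t x - Y t y| ≤ c * |inner ℝ (W t) (x - y)|) :
    ∫ t, T.sup' hT (fun x => A x + (Y t x - ∫ s, Y s x ∂μ)) ∂μ ≤
      ∫ t, T.sup' hT (fun x => A x + 2 * c * inner ℝ (W t) x) ∂μ := by
  have hA : ∀ x : V, Integrable (fun _ : Θ => A x) μ := fun x => integrable_const _
  have hin : ∀ x : V, Integrable (fun t => 2 * c * inner ℝ (W t) x) μ := fun x =>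
    (hWi.inner_const x).const_mul _
  have iYp : Integrable (fun t => T.sup' hT (fun x => A x + 2 * Y t x)) μ :=
    integrable_finset_sup' hT fun x _ => (hA x).add ((hY x).const_mul 2)
  have iYm : Integrable (fun t => T.sup' hT (fun x => A x - 2 * Y t x)) μ :=
    integrable_finset_sup' hT fun x _ => (hA x).sub ((hY x).const_mul 2)
  have iWp : Integrable (fun t => T.sup' hT (fun x => A x + 2 * c * inner ℝ (W t) x)) μ :=
    integrable_finset_sup' hT fun x _ => (hA x).add (hin x)
  have iWm : Integrable (fun t => T.sup' hT (fun x => A x - 2 * c * inner ℝ (W t) x)) μ :=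
    integrable_finset_sup' hT fun x _ => (hA x).sub (hin x)
  have iL : Integrable (fun t => T.sup' hT (fun x => A x + (Y t x - ∫ s, Y s x ∂μ))) μ :=
    integrable_finset_sup' hT fun x _ => (hA x).add ((hY x).sub (integrable_const _))
  set m := ∫ s, T.sup' hT (fun x => A x - 2 * Y s x) ∂μ
  -- A + (Y - EY) is the average of A + 2Y and A - 2EY, and the supremum of the latter is at most
  -- the mean of the supremum of A - 2Y. Doubling `Y` is what leaves the factor 2 in front of `c`.
  have h1 : ∀ t, T.sup' hT (fun x => A x + (Y t x - ∫ s, Y s x ∂μ)) ≤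
      (1 / 2) * T.sup' hT (fun x => A x + 2 * Y t x) + (1 / 2) * m := by
    intro t
    refine Finset.sup'_le _ _ fun x hx => ?_
    have h2 : A x - 2 * ∫ s, Y s x ∂μ ≤ m := by
      have : A x - 2 * ∫ s, Y s x ∂μ = ∫ s, (A x - 2 * Y s x) ∂μ := by
        rw [integral_sub (hA x) ((hY x).const_mul 2), integral_const_mul]; simp
      rw [this]
      exact integral_mono ((hA x).sub ((hY x).const_mul 2)) iYm fun s =>
        T.le_sup' (fun x => A x - 2 * Y s x) hx
    have h3 := T.le_sup' (fun x => A x + 2 * Y t x) hx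
    linarith
  have h4 : ∀ t, T.sup' hT (fun x => A x + 2 * Y t x) + T.sup' hT (fun x => A x - 2 * Y t x) ≤
      T.sup' hT (fun x => A x + 2 * c * inner ℝ (W t) x) +
        T.sup' hT (fun x => A x - 2 * c * inner ℝ (W t) x) := by
    intro t
    refine sup'_add_sup'_sub_le hT A fun x y => ?_
    have h5 := hYW t x y
    rw [inner_sub_right] at h5
    rw [← mul_sub, ← mul_sub, abs_mul, abs_mul, abs_mul, abs_of_nonneg hc, abs_two]
    linarith
  -- The symmetry of `W` plays the part of random signs: both halves produced by the contraction
  -- have the same mean.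
  have h6 : ∫ t, T.sup' hT (fun x => A x - 2 * c * inner ℝ (W t) x) ∂μ =
      ∫ t, T.sup' hT (fun x => A x + 2 * c * inner ℝ (W t) x) ∂μ := by
    have hm : Measurable fun w : V => T.sup' hT (fun x => A x + 2 * c * inner ℝ w x) := by
      refine Continuous.measurable ?_
      exact Continuous.finset_sup'_apply hT fun x _ => by fun_prop
    have h7 := integral_map (μ := μ) hW.aemeasurable hm.aestronglyMeasurable
    have h8 := integral_map (μ := μ) (φ := fun t => -W t) hW.neg.aemeasurable hm.aestronglyMeasurable
    rw [← h7, hsymm, h8]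
    simp [inner_neg_left, sub_eq_add_neg]
  calc ∫ t, T.sup' hT (fun x => A x + (Y t x - ∫ s, Y s x ∂μ)) ∂μ
      ≤ ∫ t, ((1 / 2) * T.sup' hT (fun x => A x + 2 * Y t x) + (1 / 2) * m) ∂μ :=
        integral_mono iL ((iYp.const_mul _).add (integrable_const _)) h1
    _ = (1 / 2) * ∫ t, (T.sup' hT (fun x => A x + 2 * Y t x) +
          T.sup' hT (fun x => A x - 2 * Y t x)) ∂μ := by
        rw [integral_add (iYp.const_mul _) (integrable_const _), integral_const_mul,
          integral_add iYp iYm]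
        simp only [integral_const, probReal_univ, one_smul, m]; ring
    _ ≤ (1 / 2) * ∫ t, (T.sup' hT (fun x => A x + 2 * c * inner ℝ (W t) x) +
          T.sup' hT (fun x => A x - 2 * c * inner ℝ (W t) x)) ∂μ := by
        exact mul_le_mul_of_nonneg_left (integral_mono (iYp.add iYm) (iWp.add iWm) h4)
          (by norm_num)
    _ = _ := by rw [integral_add iWp iWm, h6]; ring

variable [SecondCountableTopology V]

lemma integrable_pi_eval {N : ℕ} {F : Type*} [NormedAddCommGroup F] {u : Θ → F}
    (hu : Integrable u μ) (i : Fin N) :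
    Integrable (fun θ : Fin N → Θ => u (θ i)) (Measure.pi fun _ : Fin N => μ) :=
  (measurePreserving_eval (fun _ : Fin N => μ) i).integrable_comp_of_integrable hu

/-- Symmetrisation and contraction for an empirical process indexed by a finite set. -/
lemma integral_sup'_sum_centred_le {T : Finset V} (hT : T.Nonempty) {Y : Θ → V → ℝ}
    (hYm : ∀ x, Measurable fun t => Y t x)
    (hY : ∀ x, Integrable (fun t => Y t x) μ) {W : Θ → V} (hW : Measurable W)
    (hWi : Integrable W μ) (hsymm : μ.map W = μ.map fun t => -W t) {c : ℝ} (hc : 0 ≤ c)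
    (hYW : ∀ t x y, |Y t x - Y t y| ≤ c * |inner ℝ (W t) (x - y)|) (N : ℕ) (A : V → ℝ) :
    ∫ θ, T.sup' hT (fun x => A x + ∑ i, (Y (θ i) x - ∫ s, Y s x ∂μ))
        ∂(Measure.pi fun _ : Fin N => μ) ≤
      ∫ θ, T.sup' hT (fun x => A x + ∑ i, 2 * c * inner ℝ (W (θ i)) x)
        ∂(Measure.pi fun _ : Fin N => μ) := by
  -- With `A` arbitrary, summands are exchanged one at a time: the untouched ones are frozen and
  -- counted in `A`. The tail is replaced first by induction, then the head after swapping the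
  -- integrals.
  induction N generalizing A with
  | zero => simp
  | succ N ih =>
    set π := Measure.pi fun _ : Fin N => μ
    have hA : ∀ x : V, Integrable (fun _ : Θ × (Fin N → Θ) => A x) (μ.prod π) :=
      fun x => integrable_const _
    have hYc : ∀ x, Integrable (fun t => Y t x - ∫ s, Y s x ∂μ) μ := fun x =>
      (hY x).sub (integrable_const _)
    have hin : ∀ x : V, Integrable (fun t => 2 * c * inner ℝ (W t) x) μ := fun x =>
      (hWi.inner_const x).const_mul _
    have hsumY : ∀ x, Integrable (fun ρ : Fin N → Θ => ∑ i, (Y (ρ i) x - ∫ s, Y s x ∂μ)) π :=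
      fun x => integrable_finsetSum _ fun i _ => integrable_pi_eval μ (hYc x) i
    have hsumW : ∀ x, Integrable (fun ρ : Fin N → Θ => ∑ i, 2 * c * inner ℝ (W (ρ i)) x) π :=
      fun x => integrable_finsetSum _ fun i _ => integrable_pi_eval μ (hin x) i
    have iYY : Integrable (fun p : Θ × (Fin N → Θ) => T.sup' hT (fun x =>
        (A x + (Y p.1 x - ∫ s, Y s x ∂μ)) + ∑ i, (Y (p.2 i) x - ∫ s, Y s x ∂μ))) (μ.prod π) :=
      integrable_finset_sup' hT fun x _ =>
        ((hA x).add ((hYc x).comp_fst π)).add ((hsumY x).comp_snd μ)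
    have iYW : Integrable (fun p : Θ × (Fin N → Θ) => T.sup' hT (fun x =>
        (A x + (Y p.1 x - ∫ s, Y s x ∂μ)) + ∑ i, 2 * c * inner ℝ (W (p.2 i)) x)) (μ.prod π) :=
      integrable_finset_sup' hT fun x _ =>
        ((hA x).add ((hYc x).comp_fst π)).add ((hsumW x).comp_snd μ)
    have iWW : Integrable (fun p : Θ × (Fin N → Θ) => T.sup' hT (fun x =>
        (A x + ∑ i, 2 * c * inner ℝ (W (p.2 i)) x) + 2 * c * inner ℝ (W p.1) x)) (μ.prod π) :=
      integrable_finset_sup' hT fun x _ =>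
        ((hA x).add ((hsumW x).comp_snd μ)).add ((hin x).comp_fst π)
    have mY : Measurable fun θ : Fin (N + 1) → Θ =>
        T.sup' hT (fun x => A x + ∑ i, (Y (θ i) x - ∫ s, Y s x ∂μ)) := by
      refine measurable_finset_sup'_apply hT fun x _ => ?_
      have := hYm x
      fun_prop
    have mW : Measurable fun θ : Fin (N + 1) → Θ =>
        T.sup' hT (fun x => A x + ∑ i, 2 * c * inner ℝ (W (θ i)) x) := by
      refine measurable_finset_sup'_apply hT fun x _ => ?_
      fun_prop
    rw [integral_pi_fin_succ μ mY.aestronglyMeasurable,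
      integral_pi_fin_succ μ mW.aestronglyMeasurable]
    simp only [Fin.sum_univ_succ, Fin.cons_zero, Fin.cons_succ]
    calc ∫ p : Θ × (Fin N → Θ), T.sup' hT (fun x => A x + ((Y p.1 x - ∫ s, Y s x ∂μ) +
            ∑ i, (Y (p.2 i) x - ∫ s, Y s x ∂μ))) ∂(μ.prod π)
        = ∫ t, ∫ ρ, T.sup' hT (fun x => (A x + (Y t x - ∫ s, Y s x ∂μ)) +
            ∑ i, (Y (ρ i) x - ∫ s, Y s x ∂μ)) ∂π ∂μ := by
          rw [← integral_prod _ iYY]; simp only [add_assoc]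
      _ ≤ ∫ t, ∫ ρ, T.sup' hT (fun x => (A x + (Y t x - ∫ s, Y s x ∂μ)) +
            ∑ i, 2 * c * inner ℝ (W (ρ i)) x) ∂π ∂μ :=
          integral_mono iYY.integral_prod_left iYW.integral_prod_left fun t => ih _
      _ = ∫ ρ, ∫ t, T.sup' hT (fun x => (A x + ∑ i, 2 * c * inner ℝ (W (ρ i)) x) +
            (Y t x - ∫ s, Y s x ∂μ)) ∂μ ∂π := by
          rw [integral_integral_swap iYW]; simp only [add_right_comm]
      _ ≤ ∫ ρ, ∫ t, T.sup' hT (fun x => (A x + ∑ i, 2 * c * inner ℝ (W (ρ i)) x) +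
            2 * c * inner ℝ (W t) x) ∂μ ∂π := by
          refine integral_mono ?_ iWW.integral_prod_right fun ρ =>
            integral_sup'_centred_le μ hT _ hY hW hWi hsymm hc hYW
          have := iYW.integral_prod_right
          simpa only [add_right_comm] using this
      _ = _ := by
          rw [← integral_prod_symm _ iWW]
          simp only [add_assoc, add_comm (∑ i, 2 * c * inner ℝ (W _) _)]
          rfl

variable [CompleteSpace V]

/-- The expected supremum of an empirical process with Lipschitz increments. -/
lemma integral_sup'_sum_centred_le_sqrt {T : Finset V} (hT : T.Nonempty) {R : ℝ} (hR : 0 ≤ R)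
    (hTR : ∀ x ∈ T, ‖x‖ ≤ R) {Y : Θ → V → ℝ} (hYm : ∀ x, Measurable fun t => Y t x)
    (hY : ∀ x, Integrable (fun t => Y t x) μ) {W : Θ → V} (hW : Measurable W)
    (hWsq : Integrable (fun t => ‖W t‖ ^ 2) μ) (hsymm : μ.map W = μ.map fun t => -W t)
    {s : ℝ} (hs : 0 ≤ s) (hs2 : ∫ t, ‖W t‖ ^ 2 ∂μ ≤ s ^ 2) {c : ℝ} (hc : 0 ≤ c)
    (hYW : ∀ t x y, |Y t x - Y t y| ≤ c * |inner ℝ (W t) (x - y)|) (N : ℕ) :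
    ∫ θ, T.sup' hT (fun x => ∑ i, (Y (θ i) x - ∫ s, Y s x ∂μ))
        ∂(Measure.pi fun _ : Fin N => μ) ≤ Real.sqrt N * (2 * c * R * s) := by
  have hWi : Integrable W μ := by
    refine ((integrable_const (1 : ℝ)).add hWsq).mono' hW.aestronglyMeasurable
      (ae_of_all _ fun t => ?_)
    simp only [Pi.add_apply]
    nlinarith [sq_nonneg (‖W t‖ - 1), norm_nonneg (W t)]
  have hW0 : ∫ t, W t ∂μ = 0 := by
    have h1 := integral_map (μ := μ) hW.aemeasurable
      (measurable_id (α := V)).stronglyMeasurable.aestronglyMeasurable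
    have h2 := integral_map (μ := μ) (φ := fun t => -W t) hW.neg.aemeasurable
      (measurable_id (α := V)).stronglyMeasurable.aestronglyMeasurable
    have h3 : ∫ t, W t ∂μ = -∫ t, W t ∂μ := by
      rw [← integral_neg]
      simp only [id] at h1 h2
      rw [← h1, hsymm, h2]
    have h4 : (2 : ℝ) • ∫ t, W t ∂μ = 0 := by
      rw [two_smul]; nth_rewrite 1 [h3]; simp
    simpa using h4
  obtain ⟨hi, hle⟩ := integral_norm_sum_le μ hW hWsq hW0 N hs hs2
  have h1 := integral_sup'_sum_centred_le μ hT hYm hY hW hWi hsymm hc hYW N 0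
  simp only [Pi.zero_apply, zero_add] at h1
  refine h1.trans ?_
  -- The comparison process is linear in `x`, so Cauchy-Schwarz bounds its supremum over a set of
  -- radius `R` by the norm of one random sum.
  calc ∫ θ, T.sup' hT (fun x => ∑ i, 2 * c * inner ℝ (W (θ i)) x) ∂(Measure.pi fun _ : Fin N => μ)
      ≤ ∫ θ, (2 * c * R) * ‖∑ i, W (θ i)‖ ∂(Measure.pi fun _ : Fin N => μ) := by
        refine integral_mono ?_ (hi.const_mul _) fun θ => ?_
        · exact integrable_finset_sup' hT fun x _ => integrable_finsetSum _ fun i _ =>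
            integrable_pi_eval μ ((hWi.inner_const x).const_mul (2 * c)) i
        · refine Finset.sup'_le _ _ fun x hx => ?_
          rw [← Finset.mul_sum, ← sum_inner, mul_assoc (2 * c), mul_comm R]
          gcongr
          exact (real_inner_le_norm _ _).trans (by gcongr; exact hTR x hx)
    _ = (2 * c * R) * ∫ θ, ‖∑ i, W (θ i)‖ ∂(Measure.pi fun _ : Fin N => μ) :=
        integral_const_mul _ _
    _ ≤ (2 * c * R) * (Real.sqrt N * s) := by gcongr
    _ = _ := by ring

/-- Uniform deviation of an empirical process over a finite index set. -/
lemma one_sub_le_measure_forall_mem_finset {T : Finset V} {x₀ : V} (hx₀ : x₀ ∈ T) {R : ℝ}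
    (hTR : ∀ x ∈ T, ‖x‖ ≤ R) {Y : Θ → V → ℝ} (hYm : ∀ x, Measurable fun t => Y t x)
    {K : ℝ} (hK : 0 < K) (hYK : ∀ t x, |Y t x| ≤ K) {W : Θ → V} (hW : Measurable W)
    (hWsq : Integrable (fun t => ‖W t‖ ^ 2) μ) (hsymm : μ.map W = μ.map fun t => -W t)
    {s : ℝ} (hs : 0 ≤ s) (hs2 : ∫ t, ‖W t‖ ^ 2 ∂μ ≤ s ^ 2) {c : ℝ} (hc : 0 ≤ c)
    (hYW : ∀ t x y, |Y t x - Y t y| ≤ c * |inner ℝ (W t) (x - y)|)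
    {v : ℝ} (hv : 0 ≤ v) (hv2 : ∫ t, Y t x₀ ^ 2 ∂μ ≤ v ^ 2) {N : ℕ} (hN : 1 ≤ N)
    {δ : ℝ} (hδ : 0 < δ) (hδ1 : δ < 1) :
    ENNReal.ofReal (1 - δ) ≤ (Measure.pi fun _ : Fin N => μ)
      {θ | ∀ x ∈ T, |∑ i, (Y (θ i) x - ∫ s, Y s x ∂μ)| ≤
        Real.sqrt N * (v + 4 * c * R * s + 3 * K * Real.sqrt (Real.log δ⁻¹))} := by
  have hT : T.Nonempty := ⟨x₀, hx₀⟩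
  have hR : 0 ≤ R := (norm_nonneg _).trans (hTR x₀ hx₀)
  set π := Measure.pi fun _ : Fin N => μ
  have hY : ∀ x, Integrable (fun t => Y t x) μ := fun x =>
    Integrable.of_bound (hYm x).aestronglyMeasurable K (ae_of_all _ fun t => hYK t x)
  let Z : (Fin N → Θ) → V → ℝ := fun θ x => ∑ i, (Y (θ i) x - ∫ s, Y s x ∂μ)
  have hZm : ∀ x, Measurable fun θ => Z θ x := fun x => by
    have := hYm x
    fun_prop
  have hZi : ∀ x, Integrable (fun θ => Z θ x) π := fun x =>
    integrable_finsetSum _ fun i _ => integrable_pi_eval μ ((hY x).sub (integrable_const _)) i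
  have hmean : ∀ x, |∫ s, Y s x ∂μ| ≤ K := fun x => by
    have := norm_integral_le_of_norm_le_const (μ := μ) (f := fun t => Y t x) (C := K)
      (ae_of_all _ fun t => hYK t x)
    simpa using this
  let F : (Fin N → Θ) → ℝ := fun θ => T.sup' hT fun x => |Z θ x|
  have hF : Measurable F := measurable_finset_sup'_apply hT fun x _ => (hZm x).abs
  have hFB : ∀ θ, |F θ| ≤ N * (2 * K) := by
    intro θ
    have h0 : 0 ≤ F θ := (abs_nonneg (Z θ x₀)).trans (T.le_sup' (fun x => |Z θ x|) hx₀)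
    rw [abs_of_nonneg h0]
    refine Finset.sup'_le _ _ fun x _ => (Finset.abs_sum_le_sum_abs _ _).trans ?_
    calc ∑ i, |Y (θ i) x - ∫ s, Y s x ∂μ| ≤ ∑ _i : Fin N, 2 * K := by
          refine Finset.sum_le_sum fun i _ => (abs_sub _ _).trans ?_
          have := hYK (θ i) x
          have := hmean x
          linarith
      _ = N * (2 * K) := by simp
  have hFc : ∀ θ i t, |F θ - F (Function.update θ i t)| ≤ 2 * K := by
    have key : ∀ θ i t x, |Z θ x - Z (Function.update θ i t) x| ≤ 2 * K := by
      intro θ i t x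
      have : Z θ x - Z (Function.update θ i t) x = Y (θ i) x - Y t x := by
        simp only [Z]
        rw [← Finset.sum_sub_distrib, Finset.sum_eq_single i]
        · simp
        · intro j _ hj; simp [Function.update_of_ne hj]
        · simp
      rw [this]
      refine (abs_sub _ _).trans ?_
      have := hYK (θ i) x
      have := hYK t x
      linarith
    have half : ∀ a b : Fin N → Θ, (∀ x, |Z a x - Z b x| ≤ 2 * K) → F a - F b ≤ 2 * K := by
      intro a b hab
      rw [sub_le_iff_le_add]
      refine Finset.sup'_le _ _ fun x hx => ?_
      have h1 := T.le_sup' (fun x => |Z b x|) hx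
      have h2 := abs_sub_abs_le_abs_sub (Z a x) (Z b x)
      have h3 := hab x
      simp only [F] at h1 ⊢
      linarith
    intro θ i t
    rw [abs_le]
    have h1 := half _ _ (key θ i t)
    have h2 := half (Function.update θ i t) θ fun x => by rw [abs_sub_comm]; exact key θ i t x
    constructor <;> linarith
  have hEF : ∫ θ, F θ ∂π ≤ Real.sqrt N * (v + 4 * c * R * s) := by
    have i1 : Integrable (fun θ => |Z θ x₀|) π := (hZi x₀).abs
    have i2 : Integrable (fun θ => T.sup' hT (Z θ)) π :=
      integrable_finset_sup' hT fun x _ => hZi x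
    have i3 : Integrable (fun θ => T.sup' hT fun x => -Z θ x) π :=
      integrable_finset_sup' hT fun x _ => (hZi x).neg
    have iF : Integrable F π := integrable_finset_sup' hT fun x _ => (hZi x).abs
    have e1 : ∫ θ, |Z θ x₀| ∂π ≤ Real.sqrt N * v := by
      have hYx : Measurable fun t => Y t x₀ := hYm x₀
      have isq : Integrable (fun t => Y t x₀ ^ 2) μ := by
        refine Integrable.of_bound (hYx.pow_const 2).aestronglyMeasurable (K ^ 2)
          (ae_of_all _ fun t => ?_)
        rw [norm_pow, Real.norm_eq_abs]
        gcongr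
        exact hYK t x₀
      set m := ∫ s, Y s x₀ ∂μ with hm
      have ilin : Integrable (fun t => (2 * m) * Y t x₀) μ := (hY x₀).const_mul _
      have idif : Integrable (fun t => Y t x₀ ^ 2 - (2 * m) * Y t x₀) μ := isq.sub ilin
      have hexp : ∀ t, ‖Y t x₀ - m‖ ^ 2 = (Y t x₀ ^ 2 - (2 * m) * Y t x₀) + m ^ 2 := by
        intro t; rw [Real.norm_eq_abs, sq_abs]; ring
      refine (integral_norm_sum_le μ (h := fun t => Y t x₀ - m) (by fun_prop) ?_ ?_ N hv ?_).2
      · simp_rw [hexp]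
        exact idif.add (integrable_const _)
      · rw [integral_sub (hY x₀) (integrable_const _)]; simp [hm]
      · simp_rw [hexp]
        rw [integral_add idif (integrable_const _), integral_sub isq ilin, integral_const_mul]
        simp only [integral_const, probReal_univ, one_smul]
        rw [← hm]
        nlinarith [sq_nonneg m]
    have e2 : ∫ θ, T.sup' hT (Z θ) ∂π ≤ Real.sqrt N * (2 * c * R * s) :=
      integral_sup'_sum_centred_le_sqrt μ hT hR hTR hYm hY hW hWsq hsymm hs hs2 hc hYW N
    have e3 : ∫ θ, T.sup' hT (fun x => -Z θ x) ∂π ≤ Real.sqrt N * (2 * c * R * s) := by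
      have := integral_sup'_sum_centred_le_sqrt μ hT hR hTR (Y := fun t x => -Y t x)
        (fun x => (hYm x).neg) (fun x => (hY x).neg) hW hWsq hsymm hs hs2 hc
        (fun t x y => by
          rw [neg_sub_neg, abs_sub_comm]; exact hYW t x y) N
      refine le_trans (le_of_eq ?_) this
      congr 1; ext θ; congr 1; ext x
      simp only [Z, integral_neg]
      rw [← Finset.sum_neg_distrib]
      refine Finset.sum_congr rfl fun i _ => by ring
    -- The two one-sided suprema add up only to the oscillation of `Z θ`; the value at the base
    -- point restores its level. Two suprema of mean at most √N · 2cRs account for `4 * c * R * s`.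
    have hle : ∀ θ, F θ ≤ (|Z θ x₀| + T.sup' hT (Z θ)) + T.sup' hT (fun x => -Z θ x) := by
      intro θ
      refine Finset.sup'_le _ _ fun x hx => ?_
      have h1 := T.le_sup' (Z θ) hx
      have h2 := T.le_sup' (Z θ) hx₀
      have h3 := T.le_sup' (fun x => -Z θ x) hx
      have h4 := T.le_sup' (fun x => -Z θ x) hx₀
      have h5 := abs_nonneg (Z θ x₀)
      rcases abs_cases (Z θ x) with ⟨h6, -⟩ | ⟨h6, -⟩ <;>
        rcases abs_cases (Z θ x₀) with ⟨h7, -⟩ | ⟨h7, -⟩ <;> linarith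
    calc ∫ θ, F θ ∂π ≤ ∫ θ, ((|Z θ x₀| + T.sup' hT (Z θ)) + T.sup' hT (fun x => -Z θ x)) ∂π :=
          integral_mono iF ((i1.add i2).add i3) hle
      _ = ∫ θ, |Z θ x₀| ∂π + ∫ θ, T.sup' hT (Z θ) ∂π + ∫ θ, T.sup' hT (fun x => -Z θ x) ∂π := by
          rw [integral_add (f := fun θ => |Z θ x₀| + T.sup' hT (Z θ)) (i1.add i2) i3,
            integral_add i1 i2]
      _ ≤ Real.sqrt N * v + Real.sqrt N * (2 * c * R * s) + Real.sqrt N * (2 * c * R * s) := by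
          gcongr
      _ = _ := by ring
  refine (one_sub_le_measure_boundedDifferences μ hF hFB (by positivity) hN hFc hδ hδ1).trans
    (measure_mono fun θ hθ x hx => ?_)
  have h1 : |Z θ x| ≤ F θ := T.le_sup' (fun x => |Z θ x|) hx
  have h2 : F θ ≤ _ := hθ
  refine (h1.trans h2).trans ?_
  -- Replacing one variable moves the supremum by at most 2K, so McDiarmid gives 2√2 K; it is
  -- rounded up to 3K.
  rw [Real.sqrt_mul (by norm_num)]
  have h3 : Real.sqrt 2 ≤ 3 / 2 := by
    rw [Real.sqrt_le_left (by norm_num)]; norm_num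
  have h4 : 2 * K * (Real.sqrt 2 * Real.sqrt N) * Real.sqrt (Real.log δ⁻¹) ≤
      2 * K * (3 / 2 * Real.sqrt N) * Real.sqrt (Real.log δ⁻¹) := by gcongr
  nlinarith

/-- Uniform deviation of a continuous empirical process. -/
lemma one_sub_le_measure_forall_mem {X : Set V} {x₀ : V} (hx₀ : x₀ ∈ X) {R : ℝ}
    (hTR : ∀ x ∈ X, ‖x‖ ≤ R) {Y : Θ → V → ℝ} (hYm : ∀ x, Measurable fun t => Y t x)
    (hYc : ∀ t, Continuous (Y t)) (hmc : Continuous fun x => ∫ s, Y s x ∂μ)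
    {K : ℝ} (hK : 0 < K) (hYK : ∀ t x, |Y t x| ≤ K) {W : Θ → V} (hW : Measurable W)
    (hWsq : Integrable (fun t => ‖W t‖ ^ 2) μ) (hsymm : μ.map W = μ.map fun t => -W t)
    {s : ℝ} (hs : 0 ≤ s) (hs2 : ∫ t, ‖W t‖ ^ 2 ∂μ ≤ s ^ 2) {c : ℝ} (hc : 0 ≤ c)
    (hYW : ∀ t x y, |Y t x - Y t y| ≤ c * |inner ℝ (W t) (x - y)|)
    {v : ℝ} (hv : 0 ≤ v) (hv2 : ∫ t, Y t x₀ ^ 2 ∂μ ≤ v ^ 2) {N : ℕ} (hN : 1 ≤ N)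
    {δ : ℝ} (hδ : 0 < δ) (hδ1 : δ < 1) :
    ∃ G : Set (Fin N → Θ), MeasurableSet G ∧
      ENNReal.ofReal (1 - δ) ≤ (Measure.pi fun _ : Fin N => μ) G ∧
      ∀ θ ∈ G, ∀ x ∈ X, |∑ i, (Y (θ i) x - ∫ s, Y s x ∂μ)| ≤
        Real.sqrt N * (v + 4 * c * R * s + 3 * K * Real.sqrt (Real.log δ⁻¹)) := by
  classical
  set b := Real.sqrt N * (v + 4 * c * R * s + 3 * K * Real.sqrt (Real.log δ⁻¹))
  set π := Measure.pi fun _ : Fin N => μ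
  have : Nonempty X := ⟨⟨x₀, hx₀⟩⟩
  let q : ℕ → X := TopologicalSpace.denseSeq X
  -- Increasing finite sets that exhaust a dense sequence, each containing the base point where the
  -- second moment is controlled. The good events decrease, so their intersection keeps probability
  -- at least 1 - δ, and continuity in `x` extends the bound to all of `X`.
  let T : ℕ → Finset V := fun k => insert x₀ ((Finset.range k).image fun j => (q j : V))
  let S : ℕ → Set (Fin N → Θ) := fun k =>
    {θ | ∀ x ∈ T k, |∑ i, (Y (θ i) x - ∫ s, Y s x ∂μ)| ≤ b}
  have hS : ∀ k, ENNReal.ofReal (1 - δ) ≤ π (S k) := fun k =>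
    one_sub_le_measure_forall_mem_finset μ (T := T k) (by simp [T])
      (fun x hx => by
        simp only [T, Finset.mem_insert, Finset.mem_image] at hx
        rcases hx with rfl | ⟨j, -, rfl⟩
        · exact hTR _ hx₀
        · exact hTR _ (q j).2) hYm hK hYK hW hWsq hsymm hs hs2 hc hYW hv hv2 hN hδ hδ1
  have hSm : ∀ k, MeasurableSet (S k) := by
    intro k
    have : S k = ⋂ x ∈ T k, {θ | |∑ i, (Y (θ i) x - ∫ s, Y s x ∂μ)| ≤ b} := by
      ext θ; simp [S]
    rw [this]
    refine Finset.measurableSet_biInter _ fun x _ => measurableSet_le ?_ measurable_const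
    have := hYm x
    fun_prop
  have hanti : Antitone S := by
    intro k l hkl θ hθ x hx
    refine hθ x ?_
    simp only [T, Finset.mem_insert, Finset.mem_image, Finset.mem_range] at hx ⊢
    rcases hx with rfl | ⟨j, hj, rfl⟩
    · exact Or.inl rfl
    · exact Or.inr ⟨j, hj.trans_le hkl, rfl⟩
  have hlim := tendsto_measure_iInter_atTop (μ := π) (fun k => (hSm k).nullMeasurableSet) hanti
    ⟨0, measure_ne_top _ _⟩
  refine ⟨⋂ k, S k, MeasurableSet.iInter hSm, ge_of_tendsto' hlim hS, fun θ hθ => ?_⟩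
  have hθ' : ∀ j, |∑ i, (Y (θ i) (q j) - ∫ s, Y s (q j) ∂μ)| ≤ b := by
    intro j
    have := Set.mem_iInter.1 hθ (j + 1)
    refine this _ ?_
    simp only [T, Finset.mem_insert, Finset.mem_image, Finset.mem_range]
    exact Or.inr ⟨j, by simp, rfl⟩
  have hcont : Continuous fun x : X => |∑ i, (Y (θ i) x - ∫ s, Y s (x : V) ∂μ)| := by
    refine Continuous.abs (continuous_finsetSum _ fun i _ => ?_)
    exact ((hYc _).comp continuous_subtype_val).sub (hmc.comp continuous_subtype_val)
  intro x hx
  exact (TopologicalSpace.denseRange_denseSeq X).induction_on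
    (p := fun x : X => |∑ i, (Y (θ i) x - ∫ s, Y s (x : V) ∂μ)| ≤ b) ⟨x, hx⟩
    (isClosed_le hcont continuous_const) hθ'

end ExpectedSupremum

end Ridgelet

namespace Ridgelet

/-! ### The product left endpoint rule and Lipschitz bounds on χ f -/

section Cubature

variable {d : ℕ}

lemma norm_le_sum_abs (x : E d) : ‖x‖ ≤ ∑ i, |x i| := by
  rw [EuclideanSpace.norm_eq]
  refine Real.sqrt_le_iff.2 ⟨by positivity, ?_⟩
  exact Finset.sum_sq_le_sq_sum_of_nonneg fun _ _ => abs_nonneg _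

lemma norm_le_of_mem_cube {S : ℝ} {x : E d} (hx : x ∈ cube d S) : ‖x‖ ≤ d * S := by
  refine (norm_le_sum_abs x).trans ?_
  calc ∑ i, |x i| ≤ ∑ _i : Fin d, S := Finset.sum_le_sum fun i _ => abs_le.2 (hx i)
    _ = d * S := by simp

lemma isClosed_cube (S : ℝ) : IsClosed (cube d S) := by
  have : cube d S = ⋂ i, {x : E d | x i ∈ Set.Icc (-S) S} := by ext x; simp [cube]
  rw [this]
  exact isClosed_iInter fun i => isClosed_Icc.preimage (by fun_prop)

lemma isCompact_cube (S : ℝ) : IsCompact (cube d S) :=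
  Metric.isCompact_of_isClosed_isBounded (isClosed_cube S)
    ((Metric.isBounded_closedBall (x := (0 : E d)) (r := d * S)).subset fun x hx => by
      simpa using norm_le_of_mem_cube hx)

/-- A half-open cell of the grid of mesh `2 * S / n`. -/
def gridCell {n : ℕ} (S : ℝ) (j : Fin d → Fin n) : Set (E d) :=
  {x | ∀ i, x i ∈ Set.Ico (gridNode S j i) (gridNode S j i + 2 * S / n)}

lemma gridCell_eq_preimage {n : ℕ} (S : ℝ) (j : Fin d → Fin n) :
    gridCell S j = (WithLp.ofLp : E d → Fin d → ℝ) ⁻¹' Set.univ.pi fun i =>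
      Set.Ico (gridNode S j i) (gridNode S j i + 2 * S / n) := by
  ext x; simp [gridCell]

lemma measurableSet_gridCell {n : ℕ} (S : ℝ) (j : Fin d → Fin n) :
    MeasurableSet (gridCell S j) := by
  rw [gridCell_eq_preimage]
  exact (PiLp.volume_preserving_ofLp (Fin d)).measurable
    (MeasurableSet.univ_pi fun i => measurableSet_Ico)

lemma volume_real_gridCell {n : ℕ} {S : ℝ} (hS : 0 < S) (j : Fin d → Fin n) :
    volume.real (gridCell S j) = (2 * S) ^ d * ((n : ℝ) ^ d)⁻¹ := by
  rw [Measure.real, gridCell_eq_preimage,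
    (PiLp.volume_preserving_ofLp (Fin d)).measure_preimage
      (MeasurableSet.univ_pi fun i => measurableSet_Ico).nullMeasurableSet, volume_pi_pi]
  have h : 0 ≤ 2 * S / n := by positivity
  simp only [Real.volume_Ico, add_sub_cancel_left, Finset.prod_const, Finset.card_univ,
    Fintype.card_fin, ENNReal.toReal_pow, ENNReal.toReal_ofReal h]
  rw [div_pow, div_eq_mul_inv]

lemma pairwise_disjoint_gridCell {n : ℕ} {S : ℝ} (hS : 0 < S) :
    Pairwise (Function.onFun Disjoint (gridCell S : (Fin d → Fin n) → Set (E d))) := by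
  intro j k hjk
  rw [Function.onFun, Set.disjoint_left]
  intro x hxj hxk
  refine hjk (funext fun i => Fin.ext ?_)
  have hn : (0 : ℝ) < n := by exact_mod_cast (j i).pos
  have key : ∀ j k : Fin d → Fin n, x ∈ gridCell S j → x ∈ gridCell S k →
      (j i : ℕ) ≤ (k i : ℕ) := by
    intro j k hj hk
    have h1 := (hj i).1.trans_lt (hk i).2
    simp only [gridNode] at h1
    have h2 : 2 * S / n * ((j i : ℕ) : ℝ) < 2 * S / n * (((k i : ℕ) : ℝ) + 1) := by
      have e1 : 2 * S / n * ((j i : ℕ) : ℝ) = 2 * S * ((j i : ℕ) : ℝ) / n := by ring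
      have e2 : 2 * S / n * (((k i : ℕ) : ℝ) + 1) = 2 * S * ((k i : ℕ) : ℝ) / n + 2 * S / n := by
        ring
      rw [e1, e2]; linarith
    have h3 := lt_of_mul_lt_mul_left h2 (by positivity)
    have h4 : (j i : ℕ) < (k i : ℕ) + 1 := by exact_mod_cast h3
    omega
  exact le_antisymm (key j k hxj hxk) (key k j hxk hxj)

lemma exists_mem_gridCell {n : ℕ} (hn : 1 ≤ n) {S : ℝ} (hS : 0 < S) {x : E d}
    (hx : ∀ i, x i ∈ Set.Ico (-S) S) : ∃ j : Fin d → Fin n, x ∈ gridCell S j := by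
  have hn' : (0 : ℝ) < n := by exact_mod_cast hn
  have hnn : ∀ i, 0 ≤ (x i + S) / (2 * S / n) := fun i => by
    have := (hx i).1
    have : 0 ≤ x i + S := by linarith
    positivity
  have hlt : ∀ i, ⌊(x i + S) / (2 * S / n)⌋₊ < n := fun i => by
    rw [Nat.floor_lt (hnn i), div_lt_iff₀ (by positivity)]
    have := (hx i).2
    have e : (n : ℝ) * (2 * S / n) = 2 * S := by field_simp
    rw [e]; linarith
  refine ⟨fun i => ⟨_, hlt i⟩, fun i => ?_⟩
  have h1 := Nat.floor_le (hnn i)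
  have h2 := Nat.lt_floor_add_one ((x i + S) / (2 * S / n))
  rw [le_div_iff₀ (by positivity)] at h1
  rw [div_lt_iff₀ (by positivity)] at h2
  simp only [gridNode, Set.mem_Ico]
  set k : ℝ := ((⌊(x i + S) / (2 * S / n)⌋₊ : ℕ) : ℝ)
  have e1 : 2 * S * k / n = k * (2 * S / n) := by ring
  have e2 : (k + 1) * (2 * S / n) = k * (2 * S / n) + 2 * S / n := by ring
  rw [e1]; rw [e2] at h2
  constructor <;> linarith

lemma dist_gridNode_le {n : ℕ} {S : ℝ} {j : Fin d → Fin n} {x : E d}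
    (hx : x ∈ gridCell S j) : ‖x - gridNode S j‖ ≤ d * (2 * S / n) := by
  refine (norm_le_sum_abs _).trans ?_
  calc ∑ i, |(x - gridNode S j) i| ≤ ∑ _i : Fin d, 2 * S / n := by
        refine Finset.sum_le_sum fun i _ => ?_
        have h1 := hx i
        rw [Set.mem_Ico] at h1
        rw [PiLp.sub_apply, abs_of_nonneg (by linarith [h1.1])]
        linarith [h1.2]
    _ = d * (2 * S / n) := by simp

/-- A Lipschitz function which vanishes off `[-S, S]^d` vanishes off `[-S, S)^d`. -/
lemma eq_zero_of_not_mem_Ico {S L : ℝ} {G : E d → ℝ} (hL : ∀ x y, |G x - G y| ≤ L * ‖x - y‖)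
    (h0 : ∀ x, x ∉ cube d S → G x = 0) {x : E d} (hx : ¬ ∀ i, x i ∈ Set.Ico (-S) S) : G x = 0 := by
  by_cases hc : x ∈ cube d S
  · push Not at hx
    obtain ⟨i, hi⟩ := hx
    have hiS : S ≤ x i := by
      by_contra! h
      exact hi ⟨(hc i).1, h⟩
    have hcont : Continuous G := by
      refine LipschitzWith.continuous (K := Real.toNNReal L) (LipschitzWith.of_dist_le_mul ?_)
      intro x y
      rw [Real.dist_eq, dist_eq_norm]
      exact (hL x y).trans (by gcongr; exact Real.le_coe_toNNReal L)
    -- A point on an upper face leaves the cube at once when moved outwards along the i-th axis, so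
    -- continuity forces `G` to vanish there.
    have hlim : Tendsto (fun t : ℝ => G (x + t • EuclideanSpace.single i 1)) (𝓝[>] 0)
        (𝓝 (G (x + (0 : ℝ) • EuclideanSpace.single i 1))) :=
      Tendsto.mono_left (Continuous.tendsto (by fun_prop) 0) nhdsWithin_le_nhds
    have hev : ∀ᶠ t : ℝ in 𝓝[>] 0, G (x + t • EuclideanSpace.single i 1) = 0 := by
      filter_upwards [self_mem_nhdsWithin] with t ht
      refine h0 _ fun hmem => ?_
      have := (hmem i).2
      simp at this
      have : 0 < t := ht
      linarith
    have h1 := tendsto_nhds_unique (hlim.congr' hev) tendsto_const_nhds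
    simpa using h1
  · exact h0 x hc

/-- The error of the product left endpoint rule for a Lipschitz function. -/
lemma abs_integral_sub_sum_gridNode_le {n : ℕ} (hn : 1 ≤ n) {S L : ℝ} (hS : 0 < S) (hL0 : 0 ≤ L)
    {G : E d → ℝ} (hL : ∀ x y, |G x - G y| ≤ L * ‖x - y‖) (h0 : ∀ x, x ∉ cube d S → G x = 0)
    (hG : Integrable G) :
    |(∫ x, G x) - ∑ j : Fin d → Fin n, (2 * S) ^ d * ((n : ℝ) ^ d)⁻¹ * G (gridNode S j)| ≤
      (2 * S) ^ d * (2 * S * d) * L / n := by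
  have hn' : (0 : ℝ) < n := by exact_mod_cast hn
  have hsplit : ∫ x, G x = ∑ j : Fin d → Fin n, ∫ x in gridCell S j, G x := by
    rw [← integral_iUnion_fintype (fun j => measurableSet_gridCell S j)
      (pairwise_disjoint_gridCell hS) (fun j => hG.integrableOn)]
    refine (setIntegral_eq_integral_of_forall_compl_eq_zero fun x hx => ?_).symm
    refine eq_zero_of_not_mem_Ico hL h0 fun hmem => hx ?_
    obtain ⟨j, hj⟩ := exists_mem_gridCell hn hS hmem
    exact Set.mem_iUnion.2 ⟨j, hj⟩
  have hcell : ∀ j : Fin d → Fin n,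
      |(∫ x in gridCell S j, G x) - (2 * S) ^ d * ((n : ℝ) ^ d)⁻¹ * G (gridNode S j)| ≤
        (L * (d * (2 * S / n))) * ((2 * S) ^ d * ((n : ℝ) ^ d)⁻¹) := by
    intro j
    -- The real-valued volume of a set of infinite measure is 0 by convention, so its positive value
    -- already rules out ⊤.
    have hfin : volume (gridCell S j) < ⊤ := by
      by_contra! htop
      have h1 := volume_real_gridCell hS j
      rw [Measure.real, top_le_iff.1 htop, ENNReal.toReal_top] at h1
      have : 0 < (2 * S) ^ d * ((n : ℝ) ^ d)⁻¹ := by positivity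
      linarith
    have h1 : (∫ x in gridCell S j, G x) - (2 * S) ^ d * ((n : ℝ) ^ d)⁻¹ * G (gridNode S j) =
        ∫ x in gridCell S j, (G x - G (gridNode S j)) := by
      rw [integral_sub hG.integrableOn (integrableOn_const hfin.ne), setIntegral_const,
        volume_real_gridCell hS, smul_eq_mul]
    rw [h1, ← volume_real_gridCell hS j]
    exact norm_setIntegral_le_of_norm_le_const (f := fun x => G x - G (gridNode S j))
      (C := L * (d * (2 * S / n))) hfin fun x hx =>
      (hL _ _).trans (mul_le_mul_of_nonneg_left (dist_gridNode_le hx) hL0)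
  rw [hsplit, ← Finset.sum_sub_distrib]
  refine (Finset.abs_sum_le_sum_abs _ _).trans ((Finset.sum_le_sum fun j _ => hcell j).trans ?_)
  rw [Finset.sum_const, Finset.card_univ, Fintype.card_fun, Fintype.card_fin, Fintype.card_fin,
    nsmul_eq_mul]
  refine le_of_eq ?_
  push_cast
  field_simp

lemma abs_le_M1star {S : ℝ} {f : E d → ℝ} (hM : M1star S f < ⊤) {x : E d} (hx : x ∈ cube d S) :
    |f x| ≤ (M1star S f).toReal := by
  have h : ‖f x‖ₑ ≤ M1star S f := by
    rw [M1star]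
    exact le_sup_of_le_left (le_iSup₂ (f := fun x (_ : x ∈ cube d S) => ‖f x‖ₑ) x hx)
  have := ENNReal.toReal_mono hM.ne h
  simpa using this

lemma abs_fderiv_single_le_M1star {S : ℝ} {f : E d → ℝ} (hM : M1star S f < ⊤) {x : E d}
    (hx : x ∈ cube d S) (i : Fin d) :
    |fderiv ℝ f x (EuclideanSpace.single i 1)| ≤ (M1star S f).toReal := by
  have h : ‖fderiv ℝ f x (EuclideanSpace.single i 1)‖ₑ ≤ M1star S f := by
    rw [M1star]
    exact le_sup_of_le_right (le_iSup_of_le i (le_iSup₂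
      (f := fun x (_ : x ∈ cube d S) => ‖fderiv ℝ f x (EuclideanSpace.single i 1)‖ₑ) x hx))
  have := ENNReal.toReal_mono hM.ne h
  simpa using this

lemma norm_fderiv_le_M1star {S : ℝ} {f : E d → ℝ} (hM : M1star S f < ⊤) {x : E d}
    (hx : x ∈ cube d S) : ‖fderiv ℝ f x‖ ≤ d * (M1star S f).toReal := by
  refine ContinuousLinearMap.opNorm_le_bound _ (by positivity) fun v => ?_
  have hv : v = ∑ i, v i • EuclideanSpace.single i (1 : ℝ) := by
    ext k; simp [Finset.sum_apply, Pi.single_apply]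
  conv_lhs => rw [hv]
  rw [map_sum]
  refine (norm_sum_le _ _).trans ?_
  calc ∑ i, ‖fderiv ℝ f x (v i • EuclideanSpace.single i (1 : ℝ))‖
      ≤ ∑ _i : Fin d, (M1star S f).toReal * ‖v‖ := by
        refine Finset.sum_le_sum fun i _ => ?_
        rw [map_smul, norm_smul, mul_comm]
        gcongr
        · exact abs_fderiv_single_le_M1star hM hx i
        · exact PiLp.norm_apply_le v i
    _ = d * (M1star S f).toReal * ‖v‖ := by simp [mul_assoc]

lemma abs_mollifier_mul_le {S : ℝ} {X : Set (E d)} {χ : E d → ℝ} (hχ : IsMollifier S X χ)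
    {f : E d → ℝ} (hM : M1star S f < ⊤) (x : E d) : |χ x * f x| ≤ (M1star S f).toReal := by
  by_cases hx : x ∈ cube d S
  · rw [abs_mul, abs_of_nonneg (hχ.mem_Icc x).1]
    exact (mul_le_of_le_one_left (abs_nonneg _) (hχ.mem_Icc x).2).trans (abs_le_M1star hM hx)
  · simp [hχ.eq_zero x hx]

/-- On the cube the product rule bounds the gradient of χ f, and near any point off the closed cube
χ f vanishes. Only values of `f` on the cube matter, so M₁*(f) suffices. In the constant `d + |B| +
1`, the `d` passes from partial derivatives to the operator norm and `|B|` bounds the gradient of χ.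
-/
lemma exists_lipschitz_mollifier_mul {S : ℝ} {X : Set (E d)} {χ : E d → ℝ}
    (hχ : IsMollifier S X χ) : ∃ L : ℝ, 0 < L ∧ ∀ f : E d → ℝ, ContDiff ℝ 1 f → M1star S f < ⊤ →
      ∀ x y, |χ x * f x - χ y * f y| ≤ L * (M1star S f).toReal * ‖x - y‖ := by
  have hχ1 : ContDiff ℝ 1 χ := hχ.smooth.of_le (by norm_cast)
  obtain ⟨B, hB⟩ := (isCompact_cube (d := d) S).exists_bound_of_continuousOn
    (hχ1.continuous_fderiv one_ne_zero).continuousOn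
  refine ⟨d + |B| + 1, by positivity, fun f hf hM x y => ?_⟩
  have hχd : Differentiable ℝ χ := hχ1.differentiable one_ne_zero
  have hfd : Differentiable ℝ f := hf.differentiable one_ne_zero
  set M := (M1star S f).toReal
  have hM0 : 0 ≤ M := ENNReal.toReal_nonneg
  have hbound : ∀ z, ‖fderiv ℝ (fun z => χ z * f z) z‖ ≤ (d + |B| + 1) * M := by
    intro z
    by_cases hz : z ∈ cube d S
    · rw [fderiv_fun_mul (hχd z) (hfd z)]
      refine (norm_add_le _ _).trans ?_
      rw [norm_smul, norm_smul, Real.norm_eq_abs, Real.norm_eq_abs,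
        abs_of_nonneg (hχ.mem_Icc z).1]
      have h1 : χ z * ‖fderiv ℝ f z‖ ≤ 1 * (d * M) :=
        mul_le_mul (hχ.mem_Icc z).2 (norm_fderiv_le_M1star hM hz) (norm_nonneg _) zero_le_one
      have h2 : |f z| * ‖fderiv ℝ χ z‖ ≤ M * |B| :=
        mul_le_mul (abs_le_M1star hM hz) ((hB z hz).trans (le_abs_self B)) (norm_nonneg _) hM0
      nlinarith
    · have hev : (fun z => χ z * f z) =ᶠ[𝓝 z] fun _ => (0 : ℝ) := by
        filter_upwards [(isClosed_cube S).isOpen_compl.mem_nhds hz] with y hy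
        simp [hχ.eq_zero y hy]
      rw [hev.fderiv_eq]
      simp only [fderiv_fun_const, Pi.zero_apply, norm_zero]
      positivity
  have := convex_univ.norm_image_sub_le_of_norm_fderiv_le (𝕜 := ℝ) (f := fun z => χ z * f z)
    (fun z _ => (hχd z).mul (hfd z)) (fun z _ => hbound z) (Set.mem_univ y) (Set.mem_univ x)
  simpa using this

end Cubature

end Ridgelet

namespace Ridgelet

/-! ### Fourier inversion and the ridgelet correlation -/

section Fourier

open scoped FourierTransform

lemma real_inner_eq_mul (a b : ℝ) : inner ℝ a b = a * b := by
  simp [mul_comm]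

lemma fourierU_eq_fourier {V : Type*} [NormedAddCommGroup V] [InnerProductSpace ℝ V]
    [MeasurableSpace V] [BorelSpace V] [FiniteDimensional ℝ V] (f : V → ℂ) (ξ : V) :
    fourierU f ξ = (((2 * Real.pi) ^ (-((Module.finrank ℝ V : ℝ) / 2)) : ℝ) : ℂ) *
      𝓕 f ((2 * Real.pi)⁻¹ • ξ) := by
  rw [fourierU, Real.fourier_eq']
  congr 2
  ext x
  have h : (-2 * Real.pi * inner ℝ x ((2 * Real.pi)⁻¹ • ξ) : ℝ) = -inner ℝ ξ x := by
    rw [inner_smul_right, real_inner_comm]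
    field_simp
  rw [h, smul_eq_mul, mul_comm]
  congr 2
  push_cast; ring

lemma two_pi_rpow_mul_self (r : ℝ) :
    (2 * Real.pi) ^ (-(r / 2)) * (2 * Real.pi) ^ (-(r / 2)) * (2 * Real.pi) ^ r = 1 := by
  have hpi : 0 < 2 * Real.pi := by positivity
  rw [← Real.rpow_add hpi, ← Real.rpow_add hpi]
  ring_nf
  simp

lemma sqrt_two_pi_eq : Real.sqrt (2 * Real.pi) = (2 * Real.pi) ^ (-((1 : ℝ) / 2)) * (2 * Real.pi) := by
  have hpi : 0 < 2 * Real.pi := by positivity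
  rw [Real.sqrt_eq_rpow]
  nth_rewrite 3 [← Real.rpow_one (2 * Real.pi)]
  rw [← Real.rpow_add hpi]
  norm_num

/-- Fourier inversion at the origin. -/
lemma integral_fourierReal_eq {p : ℝ → ℝ} (hc : Continuous p) (hp : Integrable p)
    (hF : Integrable (fourierReal p)) :
    ∫ ξ, fourierReal p ξ = ((Real.sqrt (2 * Real.pi) * p 0 : ℝ) : ℂ) := by
  have hpi : 0 < 2 * Real.pi := by positivity
  set c : ℝ := (2 * Real.pi) ^ (-((1 : ℝ) / 2)) with hcdef
  have hc0 : 0 < c := by positivity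
  have h1 : ∀ ξ, fourierReal p ξ = (c : ℂ) * 𝓕 (fun x => ((p x : ℝ) : ℂ)) ((2 * Real.pi)⁻¹ * ξ) := by
    intro ξ
    rw [fourierReal, fourierU_eq_fourier]
    simp [hcdef]
  have hpC : Integrable fun x => ((p x : ℝ) : ℂ) := hp.ofReal
  have hFC : Integrable (𝓕 fun x => ((p x : ℝ) : ℂ)) := by
    have h2 := (hF.const_mul ((c : ℂ)⁻¹)).comp_mul_left' hpi.ne'
    refine h2.congr (ae_of_all _ fun ξ => ?_)
    simp only [h1]
    rw [inv_mul_cancel_left₀ (by exact_mod_cast hc0.ne'), inv_mul_cancel_left₀ hpi.ne']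
  have h3 := hpC.fourierInv_fourier_eq hFC (v := 0) (by fun_prop)
  rw [Real.fourierInv_eq'] at h3
  simp only [inner_zero_right, mul_zero, Complex.ofReal_zero, zero_mul, Complex.exp_zero,
    one_smul] at h3
  simp_rw [h1]
  rw [integral_const_mul, Measure.integral_comp_mul_left (𝓕 fun x => ((p x : ℝ) : ℂ)), h3,
    inv_inv, abs_of_pos hpi, sqrt_two_pi_eq, Complex.real_smul]
  push_cast
  ring

lemma RegularDensity.fourierReal_eq_norm {V : Type*} [NormedAddCommGroup V]
    [InnerProductSpace ℝ V] [MeasurableSpace V] [BorelSpace V] [FiniteDimensional ℝ V] {p : V → ℝ}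
    (hp : RegularDensity p) (ξ : V) : fourierReal p ξ = (‖fourierReal p ξ‖ : ℂ) := by
  have h := hp.fourier_pos ξ
  have e : fourierReal p ξ = ((fourierReal p ξ).re : ℂ) := by
    apply Complex.ext <;> simp [h.2]
  rw [e, Complex.norm_real, Real.norm_eq_abs, abs_of_pos h.1]

lemma RegularDensity.norm_fourierReal {V : Type*} [NormedAddCommGroup V]
    [InnerProductSpace ℝ V] [MeasurableSpace V] [BorelSpace V] [FiniteDimensional ℝ V] {p : V → ℝ}
    (hp : RegularDensity p) (ξ : V) : ‖fourierReal p ξ‖ = (fourierReal p ξ).re := by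
  have := congrArg Complex.re (hp.fourierReal_eq_norm ξ)
  simpa using this.symm

lemma RegularDensity.integral_norm_fourierReal_pos {V : Type*} [NormedAddCommGroup V]
    [InnerProductSpace ℝ V] [MeasurableSpace V] [BorelSpace V] [FiniteDimensional ℝ V] {p : V → ℝ}
    (hp : RegularDensity p) : 0 < ∫ ξ, ‖fourierReal p ξ‖ := by
  rw [integral_pos_iff_support_of_nonneg (fun _ => norm_nonneg _) hp.fourier_integrable.norm]
  have : (Function.support fun ξ => ‖fourierReal p ξ‖) = Set.univ := by
    ext ξ
    simp only [Function.mem_support, Set.mem_univ, iff_true]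
    rw [hp.norm_fourierReal]
    exact (hp.fourier_pos ξ).1.ne'
  rw [this]
  exact Measure.measure_univ_pos.2 (NeZero.ne _)

/-- Positivity turns the L¹ norm into the plain integral of the transform, which inversion evaluates
at the origin. This is how the normalising constant `totalMass` sees p_b(0). -/
lemma RegularDensity.integral_norm_fourierReal_eq {p : ℝ → ℝ} (hp : RegularDensity p)
    (hc : Continuous p) : ∫ ξ, ‖fourierReal p ξ‖ = Real.sqrt (2 * Real.pi) * p 0 := by
  have h1 := integral_fourierReal_eq hc hp.integrable hp.fourier_integrable
  have h2 : ∫ ξ, fourierReal p ξ = ((∫ ξ, ‖fourierReal p ξ‖ : ℝ) : ℂ) := by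
    rw [← integral_complex_ofReal]
    exact integral_congr_ae (ae_of_all _ hp.fourierReal_eq_norm)
  rw [h2] at h1
  exact_mod_cast h1

/-- The test function `ξ ↦ e^{isξ} conj (ψ̂ ξ)`, whose Fourier transform is `ψ(· - s)`. -/
lemma exists_schwartz_fourierU_eq (ψ : 𝓢(ℝ, ℝ)) (s : ℝ) : ∃ h : 𝓢(ℝ, ℂ),
    (∀ ξ, h ξ = Complex.exp (Complex.I * ((s * ξ : ℝ) : ℂ)) * starRingEnd ℂ (fourierReal ψ ξ)) ∧
    ∀ u, fourierU h u = ((ψ (u - s) : ℝ) : ℂ) := by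
  have hpi : 0 < 2 * Real.pi := by positivity
  set c : ℝ := (2 * Real.pi) ^ (-((1 : ℝ) / 2)) with hcdef
  have hcc : c * c * (2 * Real.pi) = 1 := by
    have := two_pi_rpow_mul_self 1
    rwa [Real.rpow_one] at this
  -- The test function is the inverse transform of the translate of ψ, rescaled by 2π to the unitary
  -- convention. The translation gives the phase, and ψ being real gives the conjugate of ψ̂.
  let τ : 𝓢(ℝ, ℂ) := (ψ.postcompCLM Complex.ofRealCLM).compSubConstCLM ℂ s
  have hτ : ∀ v, τ v = ((ψ (v - s) : ℝ) : ℂ) := fun v => rfl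
  let e : ℝ ≃L[ℝ] ℝ := ContinuousLinearEquiv.smulLeft (Units.mk0 (2 * Real.pi)⁻¹ (by positivity))
  have he : ∀ ξ, e ξ = (2 * Real.pi)⁻¹ * ξ := fun ξ => rfl
  let h : 𝓢(ℝ, ℂ) := (c : ℂ) • SchwartzMap.compCLMOfContinuousLinearEquiv ℂ e (𝓕⁻ τ)
  have hh : ∀ ξ, h ξ = (c : ℂ) * (𝓕⁻ τ : 𝓢(ℝ, ℂ)) ((2 * Real.pi)⁻¹ * ξ) := fun ξ => rfl
  refine ⟨h, fun ξ => ?_, fun u => ?_⟩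
  · rw [hh, SchwartzMap.fourierInv_coe, Real.fourierInv_eq']
    have h1 : ∀ v : ℝ, Complex.exp (((2 * Real.pi * inner ℝ v ((2 * Real.pi)⁻¹ * ξ) : ℝ) : ℂ) *
        Complex.I) • τ v = (fun w : ℝ => Complex.exp (Complex.I * ((s * ξ : ℝ) : ℂ)) *
          starRingEnd ℂ (((ψ w : ℝ) : ℂ) * Complex.exp (-Complex.I * ((inner ℝ ξ w : ℝ) : ℂ))))
          (v - s) := by
      intro v
      have h2 : (2 * Real.pi * inner ℝ v ((2 * Real.pi)⁻¹ * ξ) : ℝ) = v * ξ := by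
        simp only [real_inner_eq_mul]
        field_simp
      rw [h2, hτ, smul_eq_mul]
      simp only [map_mul, Complex.conj_ofReal, ← Complex.exp_conj, map_neg, Complex.conj_I, neg_neg]
      rw [mul_left_comm, ← Complex.exp_add, mul_comm]
      congr 2
      simp only [real_inner_eq_mul]
      push_cast; ring
    simp_rw [h1]
    rw [integral_sub_right_eq_self (fun w : ℝ => Complex.exp (Complex.I * ((s * ξ : ℝ) : ℂ)) *
          starRingEnd ℂ (((ψ w : ℝ) : ℂ) * Complex.exp (-Complex.I * ((inner ℝ ξ w : ℝ) : ℂ)))) s,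
      integral_const_mul, integral_conj, fourierReal, fourierU]
    simp only [map_mul, Complex.conj_ofReal, Module.finrank_self, Nat.cast_one]
    ring
  · have h1 : fourierU h u = (c : ℂ) * ∫ x, (fun y : ℝ => (c : ℂ) * ((𝓕⁻ τ : 𝓢(ℝ, ℂ)) y *
        Complex.exp (-Complex.I * ((inner ℝ u ((2 * Real.pi) * y) : ℝ) : ℂ))))
          ((2 * Real.pi)⁻¹ * x) := by
      rw [fourierU]
      simp only [Module.finrank_self, Nat.cast_one, hh, mul_inv_cancel_left₀ hpi.ne', mul_assoc]
      rfl
    have h2 : ∫ y : ℝ, (𝓕⁻ τ : 𝓢(ℝ, ℂ)) y *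
        Complex.exp (-Complex.I * ((inner ℝ u ((2 * Real.pi) * y) : ℝ) : ℂ)) = τ u := by
      have h3 : 𝓕 ((𝓕⁻ τ : 𝓢(ℝ, ℂ)) : ℝ → ℂ) u = τ u := by
        rw [← SchwartzMap.fourier_coe, FourierTransform.fourier_fourierInv_eq]
      rw [← h3, Real.fourier_eq']
      congr 1; ext y
      rw [smul_eq_mul, mul_comm]
      congr 2
      simp only [real_inner_eq_mul]
      push_cast; ring
    rw [h1, Measure.integral_comp_mul_left (fun y : ℝ => (c : ℂ) * ((𝓕⁻ τ : 𝓢(ℝ, ℂ)) y *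
        Complex.exp (-Complex.I * ((inner ℝ u ((2 * Real.pi) * y) : ℝ) : ℂ)))), integral_const_mul, h2, hτ, inv_inv, abs_of_pos hpi,
      Complex.real_smul]
    have h4 : (c : ℂ) * c * ((2 * Real.pi : ℝ) : ℂ) = 1 := by exact_mod_cast hcc
    linear_combination ((ψ (u - s) : ℝ) : ℂ) * h4

/-- The correlation of `ψ` and `φ` is the Fourier integral of `conj ψ̂ · φ̂`. -/
lemma correlation_eq_integral {m : ℕ} {φ : ℝ → ℝ} {φhat : ℝ → ℂ} {ψ : 𝓢(ℝ, ℝ)}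
    (hφ : IsGenFourier m φ φhat) (hψ : VanishesToOrder m (fourierReal ψ)) :
    Integrable (fun ξ => starRingEnd ℂ (fourierReal ψ ξ) * φhat ξ) ∧
    ∀ s : ℝ, ((∫ b, ψ b * φ (b + s) : ℝ) : ℂ) =
      ∫ ξ, Complex.exp (Complex.I * ((s * ξ : ℝ) : ℂ)) *
        (starRingEnd ℂ (fourierReal ψ ξ) * φhat ξ) := by
  -- The phase has modulus one, so every translate vanishes at the origin to the same order as ψ̂
  -- and stays an admissible test function.
  have hvan : ∀ (s : ℝ) (h : 𝓢(ℝ, ℂ)), (∀ ξ, h ξ = Complex.exp (Complex.I * ((s * ξ : ℝ) : ℂ)) *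
      starRingEnd ℂ (fourierReal ψ ξ)) → VanishesToOrder m h := by
    intro s h hh
    refine IsBigO.trans (IsBigO.of_bound 1 (Eventually.of_forall fun ξ => ?_)) hψ
    rw [hh, norm_mul, mul_comm Complex.I, Complex.norm_exp_ofReal_mul_I]
    simp
  constructor
  · obtain ⟨h, hh, -⟩ := exists_schwartz_fourierU_eq ψ 0
    refine (hφ.integrable h (hvan 0 h hh)).congr (ae_of_all _ fun ξ => ?_)
    simp [hh, mul_comm]
  · intro s
    obtain ⟨h, hh, hu⟩ := exists_schwartz_fourierU_eq ψ s
    have h1 := hφ.integral_eq h (hvan s h hh)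
    have h2 : ∫ x, (φ x : ℂ) * fourierU h x = ((∫ b, ψ b * φ (b + s) : ℝ) : ℂ) := by
      rw [← integral_complex_ofReal, ← integral_sub_right_eq_self
        (fun b => ((ψ b * φ (b + s) : ℝ) : ℂ)) s]
      congr 1; ext x
      rw [hu]
      push_cast
      rw [sub_add_cancel, mul_comm]
    rw [← h2, ← h1]
    congr 1; ext ξ
    rw [hh]; ring

end Fourier

end Ridgelet

namespace Ridgelet

/-! ### Reconstruction with weights of finite bandwidth -/

section Reconstruction

/-- For ξ ≠ 0 one has |ξ|^{-m} ≤ 1 + |ξ|^{-k}, by comparing |ξ| with 1. At ξ = 0 the convention 0⁻¹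
= 0 keeps the pointwise bound true. -/
lemma integrable_inv_pow_mul_norm_of_le {κ : ℝ → ℂ} (hκ : Integrable κ) {m k : ℕ} (hmk : m ≤ k)
    (hk : Integrable fun ξ : ℝ => (|ξ| ^ k)⁻¹ * ‖κ ξ‖) :
    Integrable fun ξ : ℝ => (|ξ| ^ m)⁻¹ * ‖κ ξ‖ := by
  refine (hκ.norm.add hk).mono' ?_ (ae_of_all _ fun ξ => ?_)
  · exact AEStronglyMeasurable.mul
      (Measurable.aestronglyMeasurable (by fun_prop)) hκ.norm.aestronglyMeasurable
  · simp only [Pi.add_apply]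
    rw [Real.norm_of_nonneg (by positivity)]
    have h0 : 0 ≤ (|ξ| ^ k)⁻¹ * ‖κ ξ‖ := by positivity
    rcases eq_or_ne ξ 0 with rfl | hξ
    · rcases Nat.eq_zero_or_pos m with rfl | hm
      · simp only [pow_zero, inv_one, one_mul]; linarith
      · simp only [abs_zero, zero_pow hm.ne', inv_zero, zero_mul]; positivity
    have hpos : 0 < |ξ| := abs_pos.2 hξ
    rcases le_total |ξ| 1 with h1 | h1
    · have : (|ξ| ^ m)⁻¹ * ‖κ ξ‖ ≤ (|ξ| ^ k)⁻¹ * ‖κ ξ‖ := by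
        have := pow_le_pow_of_le_one hpos.le h1 hmk
        gcongr
      linarith [norm_nonneg (κ ξ)]
    · have : (|ξ| ^ m)⁻¹ * ‖κ ξ‖ ≤ 1 * ‖κ ξ‖ := by
        gcongr
        exact inv_le_one_of_one_le₀ (one_le_pow₀ h1)
      linarith

variable {d : ℕ}

lemma integral_density_mul_exp {p : E d → ℝ} (v : E d) :
    ∫ w, ((p w : ℝ) : ℂ) * Complex.exp (Complex.I * ((inner ℝ w v : ℝ) : ℂ)) =
      (((2 * Real.pi) ^ ((d : ℝ) / 2) : ℝ) : ℂ) * fourierReal p (-v) := by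
  have hpi : 0 < 2 * Real.pi := by positivity
  rw [fourierReal, fourierU, ← mul_assoc, ← Complex.ofReal_mul, finrank_euclideanSpace_fin,
    ← Real.rpow_add hpi]
  simp only [add_neg_cancel, Real.rpow_zero, Complex.ofReal_one, one_mul]
  congr 1; ext w
  rw [inner_neg_left, real_inner_comm]
  congr 2
  push_cast; ring

/-- The substitution z = r (y - x). With r = σξ its Jacobian is the source of the weight |ξ|^{-d} in
the admissibility condition. -/
lemma integral_mul_comp_scaled {g : E d → ℝ} {P : E d → ℂ} (x : E d) {r : ℝ} (hr : r ≠ 0) :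
    ∫ y, ((g y : ℝ) : ℂ) * P (r • (y - x)) =
      (((|r| ^ d)⁻¹ : ℝ) : ℂ) * ∫ z, ((g (x + r⁻¹ • z) : ℝ) : ℂ) * P z := by
  rw [← integral_add_left_eq_self _ x]
  have h := Measure.integral_comp_smul (volume : Measure (E d))
    (fun z => ((g (x + r⁻¹ • z) : ℝ) : ℂ) * P z) r
  simp only [inv_smul_smul₀ hr, finrank_euclideanSpace_fin] at h
  simp only [add_sub_cancel_left]
  rw [h, abs_inv, abs_pow, Complex.real_smul]

/-- Approximate reconstruction from the ridgelet kernel with the weights smoothed at scale `σ`. -/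
lemma abs_reconstruction_sub_le {p : E d → ℝ} (hp : RegularDensity p)
    (hp2 : Integrable fun ξ => ‖ξ‖ ^ 2 * (fourierReal p ξ).re) {κ : ℝ → ℂ} (hκ : Integrable κ)
    (hκ1 : (((2 * Real.pi) ^ ((d : ℝ) / 2) : ℝ) : ℂ) *
      ∫ ξ : ℝ, (((|ξ| ^ d)⁻¹ : ℝ) : ℂ) * κ ξ = 1)
    (hκ2 : Integrable fun ξ : ℝ => (|ξ| ^ (d + 2))⁻¹ * ‖κ ξ‖) {k : ℝ → ℝ}
    (hk : ∀ s, (k s : ℂ) = ∫ ξ, Complex.exp (Complex.I * ((s * ξ : ℝ) : ℂ)) * κ ξ)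
    {g : E d → ℝ} (hg : Integrable g) {B L : ℝ} (hgB : ∀ x, |g x| ≤ B)
    (hL : ∀ x y, |g x - g y| ≤ L * ‖x - y‖) {σ : ℝ} (hσ : 0 < σ) (x : E d) :
    |σ ^ d / (∫ ξ, ‖fourierReal p ξ‖) * (∫ w, p w * ∫ y, g y * k (inner ℝ (σ • w) (x - y))) - g x| ≤
      ((2 * Real.pi) ^ ((d : ℝ) / 2) / (∫ ξ, ‖fourierReal p ξ‖) *
        (∫ ξ : ℝ, (|ξ| ^ (d + 1))⁻¹ * ‖κ ξ‖) * ∫ z, ‖z‖ * ‖fourierReal p z‖) * L / σ := by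
  set P := fourierReal p
  set A := ∫ ξ, ‖P ξ‖
  set q : ℝ := (2 * Real.pi) ^ ((d : ℝ) / 2)
  set m := ∫ z, ‖z‖ * ‖P z‖
  have hA : 0 < A := hp.integral_norm_fourierReal_pos
  have hq : 0 < q := by positivity
  have hPi : Integrable P := hp.fourier_integrable
  have hPA : ∫ z, P z = (A : ℂ) := by
    rw [← integral_complex_ofReal]
    exact integral_congr_ae (ae_of_all _ hp.fourierReal_eq_norm)
  have hPm : Integrable fun z => ‖z‖ * ‖P z‖ := by
    refine (hPi.norm.add hp2).mono' ?_ (ae_of_all _ fun z => ?_)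
    · exact AEStronglyMeasurable.mul (by fun_prop) hPi.norm.aestronglyMeasurable
    · simp only [Pi.add_apply]
      rw [← hp.norm_fourierReal, Real.norm_of_nonneg (by positivity)]
      have h1 : ‖z‖ ≤ 1 + ‖z‖ ^ 2 := by nlinarith [sq_nonneg (‖z‖ - 1), norm_nonneg z]
      nlinarith [norm_nonneg (P z)]
  have hgm : Continuous g := by
    refine LipschitzWith.continuous (K := Real.toNNReal L) (LipschitzWith.of_dist_le_mul ?_)
    intro x y
    rw [Real.dist_eq, dist_eq_norm]
    exact (hL x y).trans (by gcongr; exact Real.le_coe_toNNReal L)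
  -- The integrand in (w, y, ξ) jointly. It is a unimodular phase times a product of integrable
  -- functions, so Fubini allows the w-integral to be done first.
  let J : E d × E d × ℝ → ℂ := fun t =>
    Complex.exp (Complex.I * ((inner ℝ (σ • t.1) (x - t.2.1) * t.2.2 : ℝ) : ℂ)) *
      (((p t.1 : ℝ) : ℂ) * (((g t.2.1 : ℝ) : ℂ) * κ t.2.2))
  have hJ : Integrable J := by
    have h1 : Integrable (fun t : E d × E d × ℝ =>
        ((p t.1 : ℝ) : ℂ) * (((g t.2.1 : ℝ) : ℂ) * κ t.2.2)) :=
      (hp.integrable.ofReal (𝕜 := ℂ)).mul_prod ((hg.ofReal (𝕜 := ℂ)).mul_prod hκ)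
    refine h1.bdd_mul (c := 1) (Continuous.aestronglyMeasurable (by fun_prop))
      (ae_of_all _ fun t => ?_)
    rw [mul_comm Complex.I, Complex.norm_exp_ofReal_mul_I]
  have hJeq : ((∫ w, p w * ∫ y, g y * k (inner ℝ (σ • w) (x - y)) : ℝ) : ℂ) =
      ∫ ξ, ∫ y, ∫ w, J (w, y, ξ) := by
    have hJ2 : Integrable fun t : E d × ℝ => ∫ w, J (w, t) := hJ.integral_prod_right
    have e1 : ∫ ξ, ∫ y, ∫ w, J (w, y, ξ) = ∫ t : E d × ℝ, ∫ w, J (w, t) :=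
      (integral_prod_symm _ hJ2).symm
    have e2 : ∫ t : E d × ℝ, ∫ w, J (w, t) = ∫ w, ∫ t : E d × ℝ, J (w, t) :=
      (integral_integral_swap hJ).symm
    rw [e1, e2, ← integral_complex_ofReal]
    refine integral_congr_ae ?_
    filter_upwards [hJ.prod_right_ae] with w hw
    rw [Measure.volume_eq_prod, integral_prod _ hw]
    rw [Complex.ofReal_mul, ← integral_complex_ofReal, ← integral_const_mul]
    congr 1; ext y
    rw [Complex.ofReal_mul, hk, ← integral_const_mul, ← integral_const_mul]
    congr 1; ext ξ
    simp only [J]; ring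
  let H : ℝ → ℂ := fun ξ => ∫ y, ∫ w, J (w, y, ξ)
  have hH : Integrable H := by
    have hJ2 : Integrable fun t : E d × ℝ => ∫ w, J (w, t) := hJ.integral_prod_right
    exact hJ2.integral_prod_right
  have hHeq : ∀ ξ : ℝ, ξ ≠ 0 → ((σ ^ d : ℝ) : ℂ) * H ξ =
      q * (κ ξ * (((|ξ| ^ d)⁻¹ : ℝ) : ℂ)) * ∫ z, ((g (x + (σ * ξ)⁻¹ • z) : ℝ) : ℂ) * P z := by
    intro ξ hξ
    have h1 : ∀ y, ∫ w, J (w, y, ξ) = q * κ ξ * (((g y : ℝ) : ℂ) * P ((σ * ξ) • (y - x))) := by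
      intro y
      have h2 := integral_density_mul_exp (p := p) ((σ * ξ) • (x - y))
      rw [← smul_neg, neg_sub] at h2
      have h3 : ∀ w, J (w, y, ξ) = (((g y : ℝ) : ℂ) * κ ξ) * (((p w : ℝ) : ℂ) *
          Complex.exp (Complex.I * ((inner ℝ w ((σ * ξ) • (x - y)) : ℝ) : ℂ))) := by
        intro w
        simp only [J]
        have : inner ℝ (σ • w) (x - y) * ξ = inner ℝ w ((σ * ξ) • (x - y)) := by
          rw [real_inner_smul_left, real_inner_smul_right]; ring
        rw [this]; ring
      simp_rw [h3]
      rw [integral_const_mul, h2]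
      ring
    simp only [H]
    simp_rw [h1]
    rw [integral_const_mul, integral_mul_comp_scaled x (mul_ne_zero hσ.ne' hξ), abs_mul,
      abs_of_pos hσ, mul_pow, mul_inv]
    have hσd : ((σ ^ d : ℝ) : ℂ) ≠ 0 := by
      exact_mod_cast (pow_pos hσ d).ne'
    rw [Complex.ofReal_mul, Complex.ofReal_inv (σ ^ d)]
    field_simp
  have hκd := integrable_inv_pow_mul_norm_of_le hκ (show d ≤ d + 2 by omega) hκ2
  have hκd1 := integrable_inv_pow_mul_norm_of_le hκ (show d + 1 ≤ d + 2 by omega) hκ2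
  have hκdC : Integrable fun ξ : ℝ => (((|ξ| ^ d)⁻¹ : ℝ) : ℂ) * κ ξ := by
    refine hκd.mono' ?_ (ae_of_all _ fun ξ => ?_)
    · exact AEStronglyMeasurable.mul
        (Measurable.aestronglyMeasurable (by fun_prop)) hκ.aestronglyMeasurable
    · rw [norm_mul, Complex.norm_real, Real.norm_of_nonneg (by positivity)]
  have hgP : ∀ r : ℝ, Integrable fun z => ((g (x + r • z) : ℝ) : ℂ) * P z := fun r =>
    hPi.bdd_mul (c := B) (Continuous.aestronglyMeasurable (by fun_prop)) (ae_of_all _ fun z => by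
      rw [Complex.norm_real]; exact hgB _)
  -- Admissibility writes g(x) itself as a ξ-integral, so that the difference can be estimated
  -- frequency by frequency.
  have hcomplex : ((σ ^ d / A * (∫ w, p w * ∫ y, g y * k (inner ℝ (σ • w) (x - y))) - g x : ℝ) : ℂ) =
      ∫ ξ, (((A⁻¹ : ℝ) : ℂ) * (((σ ^ d : ℝ) : ℂ) * H ξ) -
        (q * (g x : ℂ)) * ((((|ξ| ^ d)⁻¹ : ℝ) : ℂ) * κ ξ)) := by
    rw [integral_sub ((hH.const_mul _).const_mul _) (hκdC.const_mul _), integral_const_mul,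
      integral_const_mul, integral_const_mul, Complex.ofReal_sub, Complex.ofReal_mul, hJeq]
    have : (q : ℂ) * (g x : ℂ) * ∫ ξ : ℝ, (((|ξ| ^ d)⁻¹ : ℝ) : ℂ) * κ ξ = g x := by
      linear_combination (g x : ℂ) * hκ1
    rw [this]
    push_cast
    ring
  have hnorm : |σ ^ d / A * (∫ w, p w * ∫ y, g y * k (inner ℝ (σ • w) (x - y))) - g x| =
      ‖((σ ^ d / A * (∫ w, p w * ∫ y, g y * k (inner ℝ (σ • w) (x - y))) - g x : ℝ) : ℂ)‖ := by
    rw [Complex.norm_real, Real.norm_eq_abs]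
  rw [hnorm, hcomplex]
  have hpt : ∀ ξ : ℝ, ξ ≠ 0 → ‖((A⁻¹ : ℝ) : ℂ) * (((σ ^ d : ℝ) : ℂ) * H ξ) -
      (q * (g x : ℂ)) * ((((|ξ| ^ d)⁻¹ : ℝ) : ℂ) * κ ξ)‖ ≤
        (q / A * m * L / σ) * ((|ξ| ^ (d + 1))⁻¹ * ‖κ ξ‖) := by
    intro ξ hξ
    have hξ0 : 0 < |ξ| := abs_pos.2 hξ
    have hAc : (A : ℂ) ≠ 0 := by exact_mod_cast hA.ne'
    have e1 : ((A⁻¹ : ℝ) : ℂ) * (((σ ^ d : ℝ) : ℂ) * H ξ) -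
        (q * (g x : ℂ)) * ((((|ξ| ^ d)⁻¹ : ℝ) : ℂ) * κ ξ) =
        ((q / A : ℝ) : ℂ) * (κ ξ * (((|ξ| ^ d)⁻¹ : ℝ) : ℂ)) *
          ∫ z, (((g (x + (σ * ξ)⁻¹ • z) - g x : ℝ) : ℂ) * P z) := by
      have e2 : ∫ z, (((g (x + (σ * ξ)⁻¹ • z) - g x : ℝ) : ℂ) * P z) =
          (∫ z, ((g (x + (σ * ξ)⁻¹ • z) : ℝ) : ℂ) * P z) - (g x : ℂ) * A := by
        rw [← hPA, ← integral_const_mul, ← integral_sub (hgP _) (hPi.const_mul _)]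
        congr 1; ext z; push_cast; ring
      rw [hHeq ξ hξ, e2]
      push_cast
      field_simp
    -- The displacement is ‖z‖ / (σ|ξ|): it gives the rate 1/σ and raises the weight from |ξ|^{-d}
    -- to |ξ|^{-d-1}.
    have e3 : ‖∫ z, (((g (x + (σ * ξ)⁻¹ • z) - g x : ℝ) : ℂ) * P z)‖ ≤ (L * (σ * |ξ|)⁻¹) * m := by
      rw [← integral_const_mul]
      refine norm_integral_le_of_norm_le (hPm.const_mul _) (ae_of_all _ fun z => ?_)
      rw [norm_mul, Complex.norm_real, ← mul_assoc]
      gcongr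
      refine (hL _ _).trans (le_of_eq ?_)
      rw [add_sub_cancel_left, norm_smul, norm_inv, norm_mul, Real.norm_eq_abs, Real.norm_eq_abs,
        abs_of_pos hσ, mul_assoc]
    rw [e1, norm_mul, norm_mul, norm_mul, Complex.norm_real, Complex.norm_real,
      Real.norm_of_nonneg (by positivity), Real.norm_of_nonneg (by positivity)]
    calc q / A * (‖κ ξ‖ * (|ξ| ^ d)⁻¹) *
          ‖∫ z, (((g (x + (σ * ξ)⁻¹ • z) - g x : ℝ) : ℂ) * P z)‖
        ≤ q / A * (‖κ ξ‖ * (|ξ| ^ d)⁻¹) * ((L * (σ * |ξ|)⁻¹) * m) := by gcongr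
      _ = _ := by rw [pow_succ]; field_simp
  refine (norm_integral_le_of_norm_le (hκd1.const_mul (q / A * m * L / σ)) ?_).trans (le_of_eq ?_)
  · have : ∀ᵐ ξ : ℝ, ξ ≠ 0 := Measure.ae_ne volume 0
    filter_upwards [this] with ξ hξ using hpt ξ hξ
  · rw [integral_const_mul]; ring

end Reconstruction

end Ridgelet

noncomputable section

namespace Ridgelet

/-! ### Laws and moments of the rescaled weights and biases -/

section ScaledLaw

variable {V : Type*} [NormedAddCommGroup V] [InnerProductSpace ℝ V] [MeasurableSpace V]
  [BorelSpace V] [FiniteDimensional ℝ V]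

/-- The law of `σ w` for `w` with density `p`. -/
def scaledLaw (p : V → ℝ) (σ : ℝ) : Measure V :=
  volume.withDensity fun w => ENNReal.ofReal ((σ ^ Module.finrank ℝ V)⁻¹ * p (σ⁻¹ • w))

lemma nodeLaw_eq_prod {d : ℕ} (pw : E d → ℝ) (pb : ℝ → ℝ) (σw σb : ℝ) :
    nodeLaw pw pb σw σb = (scaledLaw pw σw).prod (scaledLaw pb σb) := by
  simp [nodeLaw, scaledLaw]

variable {p : V → ℝ} {σ : ℝ}

lemma integral_scaledLaw_eq_density (hp : RegularDensity p) (hσ : 0 < σ)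
    (F : V → ℝ) : ∫ w, F w ∂(scaledLaw p σ) =
    ∫ w, ((σ ^ Module.finrank ℝ V)⁻¹ * p (σ⁻¹ • w)) * F w := by
  have hm := hp.measurable
  rw [scaledLaw, integral_withDensity_eq_integral_toReal_smul (by fun_prop)
    (ae_of_all _ fun _ => ENNReal.ofReal_lt_top)]
  congr 1; ext w
  rw [ENNReal.toReal_ofReal (mul_nonneg (by positivity) (hp.nonneg _)), smul_eq_mul]

lemma integral_scaledLaw (hp : RegularDensity p) (hσ : 0 < σ) (F : V → ℝ) : ∫ w, F w ∂(scaledLaw p σ) = ∫ w, p w * F (σ • w) := by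
  rw [integral_scaledLaw_eq_density hp hσ]
  have h := Measure.integral_comp_smul (volume : Measure V)
    (fun w => ((σ ^ Module.finrank ℝ V)⁻¹ * p w) * F (σ • w)) σ⁻¹
  simp only [smul_inv_smul₀ hσ.ne'] at h
  rw [h, inv_pow, inv_inv, abs_of_pos (by positivity), smul_eq_mul, ← integral_const_mul]
  congr 1; ext w
  field_simp

lemma integrable_scaledLaw_iff (hp : RegularDensity p) (hσ : 0 < σ)
    (F : V → ℝ) :
    Integrable F (scaledLaw p σ) ↔ Integrable fun w => p w * F (σ • w) := by
  have hm := hp.measurable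
  rw [scaledLaw, integrable_withDensity_iff_integrable_smul' (by fun_prop)
    (ae_of_all _ fun _ => ENNReal.ofReal_lt_top)]
  rw [← integrable_comp_smul_iff volume (fun w => p w * F (σ • w)) (inv_ne_zero hσ.ne')]
  simp only [smul_inv_smul₀ hσ.ne']
  have hc : (σ ^ Module.finrank ℝ V)⁻¹ ≠ 0 := by positivity
  rw [← integrable_const_mul_iff (IsUnit.mk0 _ hc) (fun w => p (σ⁻¹ • w) * F w)]
  refine integrable_congr (ae_of_all _ fun w => ?_)
  simp only
  rw [ENNReal.toReal_ofReal (mul_nonneg (by positivity) (hp.nonneg _)), smul_eq_mul, mul_assoc]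

lemma isProbabilityMeasure_scaledLaw (hp : RegularDensity p) (hσ : 0 < σ) :
    IsProbabilityMeasure (scaledLaw p σ) := by
  have h := integral_scaledLaw hp hσ fun _ => 1
  simp only [integral_const, smul_eq_mul, mul_one, hp.integral_eq_one] at h
  rw [Measure.real, ENNReal.toReal_eq_one_iff] at h
  exact ⟨h⟩

lemma map_neg_scaledLaw (hp : RegularDensity p) :
    (scaledLaw p σ).map (fun w => -w) = scaledLaw p σ := by
  have hm := hp.measurable
  ext s hs
  rw [Measure.map_apply measurable_neg hs, scaledLaw, withDensity_apply _ hs,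
    withDensity_apply _ (measurable_neg hs)]
  have h := (Measure.measurePreserving_neg (volume : Measure V)).setLIntegral_comp_preimage hs
    (f := fun w => ENNReal.ofReal ((σ ^ Module.finrank ℝ V)⁻¹ * p (σ⁻¹ • w))) (by fun_prop)
  rw [← h]
  simp only [smul_neg, ← hp.symm]

lemma integrable_norm_sq_scaledLaw (hp : RegularDensity p) (hσ : 0 < σ) :
    Integrable (fun w => ‖w‖ ^ 2) (scaledLaw p σ) := by
  rw [integrable_scaledLaw_iff hp hσ]
  refine (hp.second_moment.const_mul (σ ^ 2)).congr (ae_of_all _ fun w => ?_)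
  simp only
  rw [norm_smul, mul_pow, Real.norm_of_nonneg hσ.le]; ring

lemma integral_norm_sq_scaledLaw (hp : RegularDensity p) (hσ : 0 < σ) :
    ∫ w, ‖w‖ ^ 2 ∂(scaledLaw p σ) = σ ^ 2 * ∫ w, ‖w‖ ^ 2 * p w := by
  rw [integral_scaledLaw hp hσ, ← integral_const_mul]
  congr 1; ext w
  rw [norm_smul, mul_pow, Real.norm_of_nonneg hσ.le]; ring

lemma RegularDensity.integrable_norm_mul (hp : RegularDensity p) : Integrable fun w => ‖w‖ * p w := by
  refine (hp.integrable.add hp.second_moment).mono' ?_ (ae_of_all _ fun w => ?_)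
  · exact AEStronglyMeasurable.mul (by fun_prop) hp.integrable.aestronglyMeasurable
  · simp only [Pi.add_apply]
    rw [Real.norm_of_nonneg (mul_nonneg (norm_nonneg _) (hp.nonneg _))]
    have h1 : ‖w‖ ≤ 1 + ‖w‖ ^ 2 := by nlinarith [sq_nonneg (‖w‖ - 1), norm_nonneg w]
    nlinarith [hp.nonneg w]

lemma integrable_norm_scaledLaw (hp : RegularDensity p) (hσ : 0 < σ) :
    Integrable (fun w => ‖w‖) (scaledLaw p σ) := by
  rw [integrable_scaledLaw_iff hp hσ]
  refine (hp.integrable_norm_mul.const_mul σ).congr (ae_of_all _ fun w => ?_)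
  simp only
  rw [norm_smul, Real.norm_of_nonneg hσ.le]; ring

lemma integral_norm_scaledLaw (hp : RegularDensity p) (hσ : 0 < σ) :
    ∫ w, ‖w‖ ∂(scaledLaw p σ) = σ * ∫ w, ‖w‖ * p w := by
  rw [integral_scaledLaw hp hσ, ← integral_const_mul]
  congr 1; ext w
  rw [norm_smul, Real.norm_of_nonneg hσ.le]; ring

end ScaledLaw

/-! ### Integrals of the ridge profile against functions of the bias -/

section Shear

lemma integrable_abs_mul_schwartz (ψ : 𝓢(ℝ, ℝ)) : Integrable fun t : ℝ => |t| * |ψ t| := by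
  simpa using ψ.integrable_pow_mul volume 1

/-- The decay of ψ concentrates b around -c, and |b| ≤ |c + b| + |c|; linear growth of `r` therefore
costs only the first moment of |ψ| and a multiple of |c|. -/
lemma integral_abs_schwartz_translate_mul_le (ψ : 𝓢(ℝ, ℝ)) (c : ℝ) {r : ℝ → ℝ}
    (hr : Continuous r) {α β : ℝ} (hrb : ∀ b, |r b| ≤ α + β * |b|)
    (hβ : 0 ≤ β) :
    Integrable (fun b => ψ (c + b) * r b) ∧
    ∫ b, |ψ (c + b) * r b| ≤ α * (∫ t, |ψ t|) + β * ((∫ t, |t| * |ψ t|) + |c| * ∫ t, |ψ t|) := by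
  have i0 : Integrable fun t => |ψ t| := ψ.integrable.abs
  have i1 := integrable_abs_mul_schwartz ψ
  let D : ℝ → ℝ := fun t => (α + β * |c|) * |ψ t| + β * (|t| * |ψ t|)
  have iD : Integrable D := (i0.const_mul _).add (i1.const_mul _)
  have hle : ∀ b, |ψ (c + b) * r b| ≤ D (c + b) := by
    intro b
    rw [abs_mul]
    have h1 : |b| ≤ |c + b| + |c| := by
      have := abs_sub (c + b) c
      simpa using this
    have h2 : |r b| ≤ α + β * (|c + b| + |c|) := (hrb b).trans (by gcongr)
    calc |ψ (c + b)| * |r b| ≤ |ψ (c + b)| * (α + β * (|c + b| + |c|)) := by gcongr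
      _ = D (c + b) := by simp only [D]; ring
  have iDc : Integrable fun b => D (c + b) := iD.comp_add_left c
  have hInt : Integrable (fun b => ψ (c + b) * r b) :=
    iDc.mono' (Continuous.aestronglyMeasurable (by fun_prop)) (ae_of_all _ hle)
  refine ⟨hInt, (integral_mono hInt.abs iDc hle).trans (le_of_eq ?_)⟩
  rw [integral_add_left_eq_self D c, integral_add (i0.const_mul _) (i1.const_mul _),
    integral_const_mul, integral_const_mul]
  ring

variable {d : ℕ} {g : E d → ℝ} {S : ℝ}

/-- On the cube |⟨u, y⟩| ≤ ‖u‖ d S, which makes the one-dimensional bound uniform in y; elsewhere g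
vanishes. The case β = 0 serves bounded φ, and α = 0 serves φ times an increment of the bias
density. -/
lemma integrable_shear (hgc : Continuous g) (hg : Integrable g)
    (hg0 : ∀ x, x ∉ cube d S → g x = 0) (ψ : 𝓢(ℝ, ℝ)) (u : E d) {r : ℝ → ℝ} (hr : Continuous r) {α β : ℝ}
    (hβ : 0 ≤ β) (hrb : ∀ b, |r b| ≤ α + β * |b|) :
    Integrable (fun t : E d × ℝ => g t.1 * (ψ (inner ℝ u t.1 + t.2) * r t.2)) ∧
    ∫ t : E d × ℝ, |g t.1 * (ψ (inner ℝ u t.1 + t.2) * r t.2)| ≤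
      (∫ y, |g y|) * (α * (∫ t, |ψ t|) +
        β * ((∫ t, |t| * |ψ t|) + ‖u‖ * (d * S) * ∫ t, |ψ t|)) := by
  set C := α * (∫ t, |ψ t|) + β * ((∫ t, |t| * |ψ t|) + ‖u‖ * (d * S) * ∫ t, |ψ t|)
  have h0 : 0 ≤ ∫ t, |ψ t| := integral_nonneg fun _ => abs_nonneg _
  have hinner : ∀ y, ∫ b, |g y * (ψ (inner ℝ u y + b) * r b)| ≤ |g y| * C := by
    intro y
    simp_rw [abs_mul (g y)]
    rw [integral_const_mul]
    by_cases hy : y ∈ cube d S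
    · gcongr
      refine (integral_abs_schwartz_translate_mul_le ψ (inner ℝ u y) hr hrb hβ).2.trans ?_
      have : |inner ℝ u y| ≤ ‖u‖ * (d * S) :=
        (abs_real_inner_le_norm u y).trans (by gcongr; exact norm_le_of_mem_cube hy)
      simp only [C]
      gcongr
    · simp [hg0 y hy]
  have hInt : Integrable (fun t : E d × ℝ => g t.1 * (ψ (inner ℝ u t.1 + t.2) * r t.2)) := by
    rw [Measure.volume_eq_prod, integrable_prod_iff (Continuous.aestronglyMeasurable (by fun_prop))]
    refine ⟨ae_of_all _ fun y =>
      (integral_abs_schwartz_translate_mul_le ψ (inner ℝ u y) hr hrb hβ).1.const_mul (g y), ?_⟩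
    refine (hg.abs.mul_const C).mono' ?_ (ae_of_all _ fun y => ?_)
    · refine StronglyMeasurable.aestronglyMeasurable ?_
      refine StronglyMeasurable.integral_prod_right (f := fun (y : E d) (b : ℝ) =>
        ‖g y * (ψ (inner ℝ u y + b) * r b)‖) ?_
      exact Continuous.stronglyMeasurable (by fun_prop)
    · rw [Real.norm_of_nonneg (integral_nonneg fun _ => norm_nonneg _)]
      exact hinner y
  refine ⟨hInt, ?_⟩
  have hInt' := hInt.abs
  rw [Measure.volume_eq_prod] at hInt' ⊢
  rw [integral_prod _ hInt', ← integral_mul_const]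
  exact integral_mono hInt'.integral_prod_left (hg.abs.mul_const C) hinner

end Shear

end Ridgelet

end

noncomputable section

namespace Ridgelet

/-! ### Finite spread of the biases, cubature error and size of the coefficients -/

section Bias

lemma exists_bound_schwartz (ψ : 𝓢(ℝ, ℝ)) : ∃ B : ℝ, 0 < B ∧ (∀ t, |ψ t| ≤ B) ∧
    ∀ s t, |ψ s - ψ t| ≤ B * |s - t| := by
  obtain ⟨B₀, hB₀⟩ : ∃ B, ∀ t, |ψ t| ≤ B := ⟨_, fun t => ψ.norm_le_seminorm ℝ t⟩
  obtain ⟨B₁, hB₁⟩ : ∃ B, ∀ t, |deriv ψ t| ≤ B :=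
    ⟨_, fun t => (SchwartzMap.derivCLM ℝ ℝ ψ).norm_le_seminorm ℝ t⟩
  refine ⟨|B₀| + |B₁| + 1, by positivity, fun t => ?_, fun s t => ?_⟩
  · linarith [hB₀ t, le_abs_self B₀, abs_nonneg B₁]
  · have := convex_univ.norm_image_sub_le_of_norm_deriv_le (𝕜 := ℝ) (f := ψ)
      (fun x _ => ψ.differentiable x) (fun x _ => hB₁ x) (Set.mem_univ t) (Set.mem_univ s)
    refine this.trans ?_
    rw [Real.norm_eq_abs]
    gcongr
    linarith [le_abs_self B₁, abs_nonneg B₀]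

variable {d : ℕ}

/-- The coefficient `∫ g(y) ψ(w·y + b) dy` at the node `θ = (w, b)`. -/
def amplitude (g : E d → ℝ) (ψ : ℝ → ℝ) (θ : E d × ℝ) : ℝ :=
  ∫ y, g y * ψ (inner ℝ θ.1 y + θ.2)

/-- The product left endpoint rule for `amplitude`. -/
def gridAmplitude (n : ℕ) (S : ℝ) (g : E d → ℝ) (ψ : ℝ → ℝ) (θ : E d × ℝ) : ℝ :=
  ∑ j : Fin d → Fin n, (2 * S) ^ d * ((n : ℝ) ^ d)⁻¹ *
    (g (gridNode S j) * ψ (inner ℝ θ.1 (gridNode S j) + θ.2))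

variable {g : E d → ℝ} {S : ℝ}

lemma measurable_amplitude (hgc : Continuous g) {ψ : ℝ → ℝ} (hψ : Continuous ψ) :
    Measurable (amplitude g ψ) := by
  refine StronglyMeasurable.measurable ?_
  refine StronglyMeasurable.integral_prod_right (f := fun (θ : E d × ℝ) (y : E d) =>
    g y * ψ (inner ℝ θ.1 y + θ.2)) ?_
  exact Continuous.stronglyMeasurable (by fun_prop)

lemma abs_amplitude_le (hg : Integrable g) {ψ : ℝ → ℝ} {B : ℝ} (hB : ∀ t, |ψ t| ≤ B)
    (θ : E d × ℝ) : |amplitude g ψ θ| ≤ (∫ y, |g y|) * B := by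
  rw [amplitude, ← integral_mul_const, ← Real.norm_eq_abs]
  refine norm_integral_le_of_norm_le (hg.abs.mul_const B) (ae_of_all _ fun y => ?_)
  rw [norm_mul, Real.norm_eq_abs, Real.norm_eq_abs]
  gcongr
  exact hB _

/-- Integrating the coefficient against a function of the bias. -/
lemma integral_amplitude_mul (hgc : Continuous g) (hg : Integrable g)
    (hg0 : ∀ x, x ∉ cube d S → g x = 0) (ψ : 𝓢(ℝ, ℝ)) (u : E d) {r : ℝ → ℝ} (hr : Continuous r)
    {α β : ℝ} (hβ : 0 ≤ β) (hrb : ∀ b, |r b| ≤ α + β * |b|) :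
    Integrable (fun b => amplitude g ψ (u, b) * r b) ∧
    ∫ b, amplitude g ψ (u, b) * r b = ∫ y, g y * ∫ b, ψ (inner ℝ u y + b) * r b ∧
    |∫ b, amplitude g ψ (u, b) * r b| ≤ (∫ y, |g y|) * (α * (∫ t, |ψ t|) +
        β * ((∫ t, |t| * |ψ t|) + ‖u‖ * (d * S) * ∫ t, |ψ t|)) := by
  obtain ⟨hi, hle⟩ := integrable_shear hgc hg hg0 ψ u hr hβ hrb
  rw [Measure.volume_eq_prod] at hi hle
  have e : ∀ b, amplitude g ψ (u, b) * r b = ∫ y, g y * (ψ (inner ℝ u y + b) * r b) := by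
    intro b
    rw [amplitude, ← integral_mul_const]
    congr 1; ext y; ring
  simp_rw [e]
  refine ⟨hi.integral_prod_right, ?_, ?_⟩
  · have := integral_integral_swap
      (f := fun (y : E d) (b : ℝ) => g y * (ψ (inner ℝ u y + b) * r b)) hi
    rw [← this]
    simp_rw [integral_const_mul]
  · rw [← integral_prod_symm _ hi, ← Real.norm_eq_abs]
    exact (norm_integral_le_integral_norm _).trans hle

lemma integral_correlation_translate (φ : ℝ → ℝ) (ψ : ℝ → ℝ) (c c' : ℝ) :
    ∫ b, ψ (c + b) * φ (c' + b) = ∫ b, ψ b * φ (b + (c' - c)) := by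
  rw [← integral_add_left_eq_self (fun b => ψ b * φ (b + (c' - c))) c]
  congr 1; ext b; congr 2; ring

lemma abs_density_sub_le {pb : ℝ → ℝ} (hd : Differentiable ℝ pb) {Q : ℝ}
    (hQ : ∀ b, |deriv pb b| ≤ Q) (b : ℝ) : |pb b - pb 0| ≤ Q * |b| := by
  have := convex_univ.norm_image_sub_le_of_norm_deriv_le (𝕜 := ℝ) (f := pb)
    (fun x _ => hd x) (fun x _ => hQ x) (Set.mem_univ 0) (Set.mem_univ b)
  simpa using this

lemma integrable_nodeLaw_of_bound {pw : E d → ℝ} {pb : ℝ → ℝ} (hp : FiniteBandwidth pw pb)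
    {σw σb : ℝ} (hσw : 0 < σw) (hσb : 0 < σb) {F : E d × ℝ → ℝ} (hF : Measurable F) {B : ℝ}
    (hB : ∀ θ, |F θ| ≤ B) : Integrable F ((scaledLaw pw σw).prod (scaledLaw pb σb)) := by
  have := isProbabilityMeasure_scaledLaw hp.regular_w hσw
  have := isProbabilityMeasure_scaledLaw hp.regular_b hσb
  exact Integrable.of_bound hF.aestronglyMeasurable B (ae_of_all _ hB)

/-- The error of replacing the bias density by its value at the origin. -/
lemma abs_mean_sub_reconstruction_le {pw : E d → ℝ} {pb : ℝ → ℝ} (hp : FiniteBandwidth pw pb)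
    {Q : ℝ} (hQ : ∀ b, |deriv pb b| ≤ Q) {φ : ℝ → ℝ} (hφ : Continuous φ) {Bφ : ℝ}
    (hBφ : ∀ t, |φ t| ≤ Bφ) (ψ : 𝓢(ℝ, ℝ)) (hgc : Continuous g) (hg : Integrable g)
    (hg0 : ∀ x, x ∉ cube d S → g x = 0) {σw σb : ℝ} (hσw : 0 < σw) (hσb : 0 < σb) (x : E d) :
    |totalMass pw pb σw σb * (∫ θ, amplitude g ψ θ * φ (inner ℝ θ.1 x + θ.2)
          ∂(nodeLaw pw pb σw σb)) -
        σw ^ d / (∫ ξ, ‖fourierReal pw ξ‖) *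
          ∫ w, pw w * ∫ y, g y * ∫ b, ψ b * φ (b + inner ℝ (σw • w) (x - y))| ≤
      Real.sqrt (2 * Real.pi) / ((∫ ξ, ‖fourierReal pw ξ‖) * ∫ ξ, ‖fourierReal pb ξ‖) *
        (Bφ * Q) * (∫ y, |g y|) * ((∫ t, |t| * |ψ t|) +
          (d * S) * (∫ t, |ψ t|) * (∫ w, ‖w‖ * pw w) * σw) * (σw ^ d / σb) := by
  set A := ∫ ξ, ‖fourierReal pw ξ‖
  set B := ∫ ξ, ‖fourierReal pb ξ‖
  set m₀ := ∫ t, |ψ t|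
  set m₁ := ∫ t, |t| * |ψ t|
  set G := ∫ y, |g y|
  have hA : 0 < A := hp.regular_w.integral_norm_fourierReal_pos
  have hB : 0 < B := hp.regular_b.integral_norm_fourierReal_pos
  have hpbc : Continuous pb := hp.differentiable_b.continuous
  have hBp : B = Real.sqrt (2 * Real.pi) * pb 0 := hp.regular_b.integral_norm_fourierReal_eq hpbc
  have hQ0 : 0 ≤ Q := (abs_nonneg _).trans (hQ 0)
  have hBφ0 : 0 ≤ Bφ := (abs_nonneg _).trans (hBφ 0)
  obtain ⟨Bψ, -, hBψ, -⟩ := exists_bound_schwartz ψ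
  let F : E d × ℝ → ℝ := fun θ => amplitude g ψ θ * φ (inner ℝ θ.1 x + θ.2)
  have hFm : Measurable F := by
    refine (measurable_amplitude hgc ψ.continuous).mul (Continuous.measurable (by fun_prop))
  have hFB : ∀ θ, |F θ| ≤ G * Bψ * Bφ := fun θ => by
    simp only [F, abs_mul]
    exact mul_le_mul (abs_amplitude_le hg hBψ θ) (hBφ _) (abs_nonneg _)
      ((abs_nonneg _).trans (abs_amplitude_le hg hBψ θ))
  have hFi := integrable_nodeLaw_of_bound hp hσw hσb hFm hFB
  have := isProbabilityMeasure_scaledLaw hp.regular_w hσw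
  have := isProbabilityMeasure_scaledLaw hp.regular_b hσb
  -- `I` integrates the bias against its law, `K` against Lebesgue measure. Freezing the density at
  -- the origin predicts I ≈ σb⁻¹ p_b(0) K.
  let I : E d → ℝ := fun u => ∫ b, F (u, b) ∂(scaledLaw pb σb)
  let K : E d → ℝ := fun u => ∫ y, g y * ∫ b, ψ b * φ (b + inner ℝ u (x - y))
  have hrφ : ∀ u : E d, Continuous fun b => φ (inner ℝ u x + b) := fun u => by fun_prop
  have hK : ∀ u, K u = ∫ b, F (u, b) := by
    intro u
    have h1 := (integral_amplitude_mul hgc hg hg0 ψ u (hrφ u) (α := Bφ) (β := 0) le_rfl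
      (fun b => by simpa using hBφ _)).2.1
    simp only [F, K]
    rw [h1]
    congr 1; ext y
    rw [integral_correlation_translate, inner_sub_right]
  have hKm : Measurable K := by
    rw [show K = fun u => ∫ b, F (u, b) from funext hK]
    exact (hFm.stronglyMeasurable.integral_prod_right').measurable
  have hKB : ∀ u, |K u| ≤ G * (Bφ * m₀) := by
    intro u
    have h1 := (integral_amplitude_mul hgc hg hg0 ψ u (hrφ u) (α := Bφ) (β := 0) le_rfl
      (fun b => by simpa using hBφ _)).2.2
    rw [hK u]
    simpa using h1
  -- One factor σb⁻¹ normalises the density and the other comes from |p_b(b/σb) - p_b(0)| ≤ Q|b|/σb.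
  -- The mass Z later takes back one of them.
  have hIK : ∀ u, |I u - σb⁻¹ * pb 0 * K u| ≤
      Bφ * Q * G * (m₁ + ‖u‖ * (d * S) * m₀) / σb ^ 2 := by
    intro u
    have hgrow : ∀ b, |pb (σb⁻¹ * b) - pb 0| ≤ Q * σb⁻¹ * |b| := fun b => by
      have := abs_density_sub_le hp.differentiable_b hQ (σb⁻¹ * b)
      rwa [abs_mul, abs_of_pos (inv_pos.2 hσb), ← mul_assoc] at this
    have h1 := integral_amplitude_mul hgc hg hg0 ψ u
      (r := fun b => φ (inner ℝ u x + b) * (pb (σb⁻¹ * b) - pb 0)) (by fun_prop) (α := 0)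
      (β := Bφ * (Q * σb⁻¹)) (by positivity) (fun b => by
        rw [abs_mul, zero_add, mul_assoc]
        exact mul_le_mul (hBφ _) (hgrow b) (abs_nonneg _) hBφ0)
    have h2 := integral_amplitude_mul hgc hg hg0 ψ u (hrφ u) (α := Bφ) (β := 0) le_rfl
      (fun b => by simpa using hBφ _)
    have h3 : I u = σb⁻¹ * ((∫ b, amplitude g ψ (u, b) *
        (φ (inner ℝ u x + b) * (pb (σb⁻¹ * b) - pb 0))) + pb 0 * K u) := by
      simp only [I]
      rw [integral_scaledLaw_eq_density hp.regular_b hσb, hK u, ← integral_const_mul (pb 0),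
        ← integral_add h1.1 (h2.1.const_mul _), ← integral_const_mul]
      congr 1; ext b
      simp only [F, Module.finrank_self, pow_one, smul_eq_mul]
      ring
    have h4 : I u - σb⁻¹ * pb 0 * K u = σb⁻¹ * ∫ b, amplitude g ψ (u, b) *
        (φ (inner ℝ u x + b) * (pb (σb⁻¹ * b) - pb 0)) := by rw [h3]; ring
    rw [h4, abs_mul, abs_of_pos (inv_pos.2 hσb)]
    calc σb⁻¹ * |∫ b, amplitude g ψ (u, b) * (φ (inner ℝ u x + b) * (pb (σb⁻¹ * b) - pb 0))|
        ≤ σb⁻¹ * (G * (0 * m₀ + Bφ * (Q * σb⁻¹) * (m₁ + ‖u‖ * (d * S) * m₀))) := by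
          gcongr; exact h1.2.2
      _ = _ := by field_simp; ring
  have hIi : Integrable (fun w => pw w * I (σw • w)) :=
    (integrable_scaledLaw_iff hp.regular_w hσw I).1 hFi.integral_prod_left
  have hKi : Integrable (fun w => pw w * K (σw • w)) := by
    rw [← integrable_scaledLaw_iff hp.regular_w hσw]
    exact Integrable.of_bound hKm.aestronglyMeasurable _ (ae_of_all _ hKB)
  set Z := totalMass pw pb σw σb
  have hZ : Z = Real.sqrt (2 * Real.pi) / (A * B) * σw ^ d * σb := by
    simp only [Z, totalMass]; ring
  -- By inversion ‖p̂_b‖₁ = √(2π) p_b(0), so Z exactly compensates the frozen density and leaves the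
  -- reconstruction normalisation.
  have hZp : Z * (σb⁻¹ * pb 0) = σw ^ d / A := by
    have hpb0 : pb 0 ≠ 0 := by
      intro h; rw [h, mul_zero] at hBp; exact hB.ne' hBp
    have hs : Real.sqrt (2 * Real.pi) ≠ 0 := by positivity
    rw [hZ, hBp]
    field_simp
  have hmain : Z * (∫ θ, F θ ∂(nodeLaw pw pb σw σb)) - σw ^ d / A * ∫ w, pw w * K (σw • w) =
      ∫ w, Z * (pw w * (I (σw • w) - σb⁻¹ * pb 0 * K (σw • w))) := by
    rw [nodeLaw_eq_prod, integral_prod _ hFi]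
    have e1 : ∫ u, ∫ b, F (u, b) ∂(scaledLaw pb σb) ∂(scaledLaw pw σw) =
        ∫ w, pw w * I (σw • w) := integral_scaledLaw hp.regular_w hσw I
    rw [e1, ← hZp, integral_const_mul]
    rw [mul_assoc Z, ← mul_sub, ← integral_const_mul, ← integral_sub hIi (hKi.const_mul _)]
    congr 2; ext w; ring
  change |Z * (∫ θ, F θ ∂(nodeLaw pw pb σw σb)) - σw ^ d / A * ∫ w, pw w * K (σw • w)| ≤ _
  rw [hmain]
  have hZ0 : 0 ≤ Z := by rw [hZ]; positivity
  have hG0 : 0 ≤ G := integral_nonneg fun _ => abs_nonneg _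
  let D : E d → ℝ := fun w => (Z * (Bφ * Q) * G / σb ^ 2) *
    (m₁ * pw w + (d * S * m₀ * σw) * (‖w‖ * pw w))
  have iD1 : Integrable fun w => m₁ * pw w := hp.regular_w.integrable.const_mul _
  have iD2 : Integrable fun w => (d * S * m₀ * σw) * (‖w‖ * pw w) :=
    hp.regular_w.integrable_norm_mul.const_mul _
  have hD : Integrable D := (iD1.add iD2).const_mul _
  rw [← Real.norm_eq_abs]
  refine (norm_integral_le_of_norm_le hD (ae_of_all _ fun w => ?_)).trans (le_of_eq ?_)
  · rw [Real.norm_eq_abs, abs_mul, abs_mul, abs_of_nonneg hZ0,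
      abs_of_nonneg (hp.regular_w.nonneg w)]
    have h1 := hIK (σw • w)
    rw [norm_smul, Real.norm_of_nonneg hσw.le] at h1
    have hpw := hp.regular_w.nonneg w
    calc Z * (pw w * |I (σw • w) - σb⁻¹ * pb 0 * K (σw • w)|)
        ≤ Z * (pw w * (Bφ * Q * G * (m₁ + σw * ‖w‖ * (d * S) * m₀) / σb ^ 2)) := by gcongr
      _ = D w := by simp only [D]; ring
  · simp only [D]
    rw [integral_const_mul, integral_add iD1 iD2, integral_const_mul, integral_const_mul,
      hp.regular_w.integral_eq_one, hZ]
    field_simp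

/-- The integrand y ↦ g(y) ψ(w·y + b) has Lipschitz constant B (Lg + Bg ‖w‖). The term in ‖w‖
becomes a factor σ_w after averaging. -/
lemma abs_gridAmplitude_sub_amplitude_le {n : ℕ} (hn : 1 ≤ n) (hS : 0 < S) {Bg Lg : ℝ}
    (hBg : ∀ x, |g x| ≤ Bg) (hLg0 : 0 ≤ Lg) (hLg : ∀ x y, |g x - g y| ≤ Lg * ‖x - y‖)
    (hg : Integrable g) (hgc : Continuous g)
    (hg0 : ∀ x, x ∉ cube d S → g x = 0) {ψ : ℝ → ℝ} (hψc : Continuous ψ) {B : ℝ} (hB0 : 0 ≤ B)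
    (hB : ∀ t, |ψ t| ≤ B) (hBL : ∀ s t, |ψ s - ψ t| ≤ B * |s - t|) (θ : E d × ℝ) :
    |gridAmplitude n S g ψ θ - amplitude g ψ θ| ≤
      (2 * S) ^ d * (2 * S * d) * (B * (Lg + Bg * ‖θ.1‖)) / n := by
  have hBg0 : 0 ≤ Bg := (abs_nonneg _).trans (hBg 0)
  rw [abs_sub_comm]
  refine abs_integral_sub_sum_gridNode_le (G := fun y => g y * ψ (inner ℝ θ.1 y + θ.2)) hn hS
    (by positivity) (fun x y => ?_) (fun x hx => by simp [hg0 x hx]) ?_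
  · have e : g x * ψ (inner ℝ θ.1 x + θ.2) - g y * ψ (inner ℝ θ.1 y + θ.2) =
        (g x - g y) * ψ (inner ℝ θ.1 x + θ.2) +
          g y * (ψ (inner ℝ θ.1 x + θ.2) - ψ (inner ℝ θ.1 y + θ.2)) := by ring
    rw [e]
    refine (abs_add_le _ _).trans ?_
    rw [abs_mul, abs_mul]
    have h1 : |ψ (inner ℝ θ.1 x + θ.2) - ψ (inner ℝ θ.1 y + θ.2)| ≤ B * (‖θ.1‖ * ‖x - y‖) := by
      refine (hBL _ _).trans ?_
      rw [add_sub_add_right_eq_sub, ← inner_sub_right]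
      gcongr
      exact abs_real_inner_le_norm _ _
    calc |g x - g y| * |ψ (inner ℝ θ.1 x + θ.2)| +
          |g y| * |ψ (inner ℝ θ.1 x + θ.2) - ψ (inner ℝ θ.1 y + θ.2)|
        ≤ (Lg * ‖x - y‖) * B + Bg * (B * (‖θ.1‖ * ‖x - y‖)) := by
          gcongr
          · exact hLg x y
          · exact hB _
          · exact hBg y
      _ = _ := by ring
  · refine (hg.abs.mul_const B).mono' (Continuous.aestronglyMeasurable (by fun_prop))
      (ae_of_all _ fun y => ?_)
    rw [norm_mul, Real.norm_eq_abs, Real.norm_eq_abs]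
    gcongr
    exact hB _

lemma abs_gridAmplitude_le {n : ℕ} (hn : 1 ≤ n) (hS : 0 < S) {Bg : ℝ} (hBg : ∀ x, |g x| ≤ Bg)
    {ψ : ℝ → ℝ} {B : ℝ} (hB : ∀ t, |ψ t| ≤ B) (θ : E d × ℝ) :
    |gridAmplitude n S g ψ θ| ≤ (2 * S) ^ d * (Bg * B) := by
  have hn' : (0 : ℝ) < n := by exact_mod_cast hn
  refine (Finset.abs_sum_le_sum_abs _ _).trans ?_
  calc ∑ j : Fin d → Fin n, |(2 * S) ^ d * ((n : ℝ) ^ d)⁻¹ *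
        (g (gridNode S j) * ψ (inner ℝ θ.1 (gridNode S j) + θ.2))|
      ≤ ∑ _j : Fin d → Fin n, (2 * S) ^ d * ((n : ℝ) ^ d)⁻¹ * (Bg * B) := by
        refine Finset.sum_le_sum fun j _ => ?_
        rw [abs_mul, abs_of_nonneg (a := (2 * S) ^ d * ((n : ℝ) ^ d)⁻¹) (by positivity), abs_mul]
        gcongr
        · exact (abs_nonneg _).trans (hBg 0)
        · exact hBg _
        · exact hB _
    _ = (2 * S) ^ d * (Bg * B) := by
        rw [Finset.sum_const, Finset.card_univ, Fintype.card_fun, Fintype.card_fin,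
          Fintype.card_fin, nsmul_eq_mul]
        push_cast
        field_simp

lemma measurable_gridAmplitude (n : ℕ) (S : ℝ) (g : E d → ℝ) {ψ : ℝ → ℝ} (hψ : Continuous ψ) :
    Measurable (gridAmplitude n S g ψ) := by
  refine Continuous.measurable ?_
  unfold gridAmplitude
  fun_prop

/-- The mean of the coefficient is small when the biases are spread out. -/
lemma integral_abs_gridAmplitude_le {pw : E d → ℝ} {pb : ℝ → ℝ} (hp : FiniteBandwidth pw pb)
    {Bp : ℝ} (hBp : ∀ b, pb b ≤ Bp) (ψ : 𝓢(ℝ, ℝ)) {n : ℕ} (hn : 1 ≤ n) (hS : 0 < S) {Bg : ℝ}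
    (hBg : ∀ x, |g x| ≤ Bg) {σw σb : ℝ} (hσw : 0 < σw) (hσb : 0 < σb) :
    ∫ θ, |gridAmplitude n S g ψ θ| ∂((scaledLaw pw σw).prod (scaledLaw pb σb)) ≤
      (2 * S) ^ d * Bg * (Bp * (∫ t, |ψ t|) / σb) := by
  have hn' : (0 : ℝ) < n := by exact_mod_cast hn
  have hBg0 : 0 ≤ Bg := (abs_nonneg _).trans (hBg 0)
  have := isProbabilityMeasure_scaledLaw hp.regular_w hσw
  have := isProbabilityMeasure_scaledLaw hp.regular_b hσb
  obtain ⟨Bψ, -, hBψ, -⟩ := exists_bound_schwartz ψ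
  set ν := (scaledLaw pw σw).prod (scaledLaw pb σb)
  set m₀ := ∫ t, |ψ t|
  have hψi : ∀ y : E d, Integrable (fun θ : E d × ℝ => |ψ (inner ℝ θ.1 y + θ.2)|) ν := fun y =>
    integrable_nodeLaw_of_bound hp hσw hσb (Continuous.measurable (by fun_prop)) (B := Bψ)
      (fun θ => by rw [abs_abs]; exact hBψ _)
  have hψle : ∀ y : E d, ∫ θ : E d × ℝ, |ψ (inner ℝ θ.1 y + θ.2)| ∂ν ≤ Bp * m₀ / σb := by
    intro y
    rw [integral_prod _ (hψi y)]
    -- The bias density is at most Bp/σb, and the Lebesgue integral of |ψ| does not see the shift,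
    -- so the bound is uniform in the weight and the node.
    have hin : ∀ u : E d, ∫ b, |ψ (inner ℝ u y + b)| ∂(scaledLaw pb σb) ≤ Bp * m₀ / σb := by
      intro u
      rw [integral_scaledLaw_eq_density hp.regular_b hσb]
      have hi : Integrable fun b => |ψ (inner ℝ u y + b)| := ψ.integrable.abs.comp_add_left _
      have hnn : ∀ b, 0 ≤ (σb ^ Module.finrank ℝ ℝ)⁻¹ * pb (σb⁻¹ • b) := fun b =>
        mul_nonneg (by positivity) (hp.regular_b.nonneg _)
      calc ∫ b, ((σb ^ Module.finrank ℝ ℝ)⁻¹ * pb (σb⁻¹ • b)) * |ψ (inner ℝ u y + b)|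
          ≤ ∫ b, (σb⁻¹ * Bp) * |ψ (inner ℝ u y + b)| := by
            refine integral_mono_of_nonneg (ae_of_all _ fun b => ?_) (hi.const_mul _)
              (ae_of_all _ fun b => ?_)
            · exact mul_nonneg (hnn b) (abs_nonneg _)
            · simp only [Module.finrank_self, pow_one]
              gcongr
              exact hBp _
        _ = Bp * m₀ / σb := by
            rw [integral_const_mul, integral_add_left_eq_self (fun b => |ψ b|)]
            ring
    calc ∫ u, ∫ b, |ψ (inner ℝ u y + b)| ∂(scaledLaw pb σb) ∂(scaledLaw pw σw)
        ≤ ∫ _u, Bp * m₀ / σb ∂(scaledLaw pw σw) :=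
          integral_mono (hψi y).integral_prod_left (integrable_const _) hin
      _ = Bp * m₀ / σb := by simp
  let D : E d × ℝ → ℝ := fun θ => ∑ j : Fin d → Fin n, (2 * S) ^ d * ((n : ℝ) ^ d)⁻¹ * Bg *
    |ψ (inner ℝ θ.1 (gridNode S j) + θ.2)|
  have hDi : Integrable D ν := integrable_finsetSum _ fun j _ => (hψi _).const_mul _
  have hle : ∀ θ, |gridAmplitude n S g ψ θ| ≤ D θ := by
    intro θ
    refine (Finset.abs_sum_le_sum_abs _ _).trans (Finset.sum_le_sum fun j _ => ?_)
    rw [abs_mul, abs_of_nonneg (a := (2 * S) ^ d * ((n : ℝ) ^ d)⁻¹) (by positivity), abs_mul,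
      ← mul_assoc]
    gcongr
    exact hBg _
  calc ∫ θ, |gridAmplitude n S g ψ θ| ∂ν ≤ ∫ θ, D θ ∂ν :=
        integral_mono_of_nonneg (ae_of_all _ fun _ => abs_nonneg _) hDi (ae_of_all _ hle)
    _ = ∑ j : Fin d → Fin n, (2 * S) ^ d * ((n : ℝ) ^ d)⁻¹ * Bg *
          ∫ θ : E d × ℝ, |ψ (inner ℝ θ.1 (gridNode S j) + θ.2)| ∂ν := by
        simp only [D]
        rw [integral_finsetSum _ fun j _ => (hψi _).const_mul _]
        simp_rw [integral_const_mul]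
    _ ≤ ∑ _j : Fin d → Fin n, (2 * S) ^ d * ((n : ℝ) ^ d)⁻¹ * Bg * (Bp * m₀ / σb) := by
        refine Finset.sum_le_sum fun j _ => ?_
        gcongr
        exact hψle _
    _ = (2 * S) ^ d * Bg * (Bp * m₀ / σb) := by
        rw [Finset.sum_const, Finset.card_univ, Fintype.card_fun, Fintype.card_fin,
          Fintype.card_fin, nsmul_eq_mul]
        push_cast
        field_simp

/-- An essential bound on a continuous function holds everywhere, since the set where it fails is
open and null. -/
lemma RegularDensity.exists_forall_le {p : ℝ → ℝ} (hp : RegularDensity p) (hc : Continuous p) :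
    ∃ B : ℝ, 0 < B ∧ ∀ b, p b ≤ B := by
  obtain ⟨B, hB⟩ : ∃ B : ℝ, ∀ᵐ x, p x ≤ B := by
    refine ⟨(eLpNorm p ⊤ volume).toReal, ?_⟩
    rw [eLpNorm_exponent_top]
    have hlt := hp.bounded
    rw [eLpNorm_exponent_top] at hlt
    filter_upwards [ae_le_eLpNormEssSup (f := p) (μ := volume)] with x hx
    have := ENNReal.toReal_mono hlt.ne hx
    exact (le_abs_self _).trans (by simpa using this)
  have hopen : IsOpen {x | B < p x} := isOpen_lt continuous_const hc
  have hnull : volume {x | B < p x} = 0 := by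
    rw [ae_iff] at hB
    simpa using hB
  have hempty := (hopen.measure_eq_zero_iff volume).1 hnull
  refine ⟨|B| + 1, by positivity, fun b => ?_⟩
  have : b ∉ {x | B < p x} := by rw [hempty]; simp
  have : p b ≤ B := not_lt.1 this
  linarith [le_abs_self B]

end Bias

end Ridgelet

end

noncomputable section

namespace Ridgelet

/-! ### Monte Carlo error -/

section MonteCarlo

variable {d : ℕ} {g : E d → ℝ} {S : ℝ}

lemma map_fst_prod_scaledLaw_symm {pw : E d → ℝ} {pb : ℝ → ℝ} (hp : FiniteBandwidth pw pb)
    {σw σb : ℝ} (hσb : 0 < σb) :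
    ((scaledLaw pw σw).prod (scaledLaw pb σb)).map Prod.fst =
      ((scaledLaw pw σw).prod (scaledLaw pb σb)).map fun θ => -θ.1 := by
  have := isProbabilityMeasure_scaledLaw hp.regular_b hσb
  have h1 : ((scaledLaw pw σw).prod (scaledLaw pb σb)).map Prod.fst = scaledLaw pw σw := by
    simp
  have h2 : (fun θ : E d × ℝ => -θ.1) = (fun w : E d => -w) ∘ Prod.fst := rfl
  rw [h2, ← Measure.map_map measurable_neg measurable_fst, h1, map_neg_scaledLaw hp.regular_w]

/-- Uniform deviation of the Monte Carlo average from its mean. -/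
lemma exists_measurableSet_abs_sum_sub_mean_le {pw : E d → ℝ} {pb : ℝ → ℝ}
    (hp : FiniteBandwidth pw pb) {φ : ℝ → ℝ} {L : ℝ≥0} (hL : LipschitzWith L φ) {Bφ : ℝ}
    (hBφ0 : 0 < Bφ) (hBφ : ∀ t, |φ t| ≤ Bφ) {a : E d × ℝ → ℝ} (ha : Measurable a) {K : ℝ}
    (hK0 : 0 < K) (hK : ∀ θ, |a θ| ≤ K) {σw σb : ℝ} (hσw : 0 < σw) (hσb : 0 < σb)
    {X : Set (E d)} (hX : X.Nonempty) {R : ℝ} (hXR : ∀ x ∈ X, ‖x‖ ≤ R) {v : ℝ} (hv : 0 ≤ v)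
    (hv2 : ∫ θ, a θ ^ 2 ∂((scaledLaw pw σw).prod (scaledLaw pb σb)) ≤ v ^ 2)
    {N : ℕ} (hN : 1 ≤ N) {δ : ℝ} (hδ : 0 < δ) (hδ1 : δ < 1) :
    ∃ G : Set (Fin N → E d × ℝ), MeasurableSet G ∧ ENNReal.ofReal (1 - δ) ≤
        (Measure.pi fun _ : Fin N => (scaledLaw pw σw).prod (scaledLaw pb σb)) G ∧
      ∀ θ ∈ G, ∀ x ∈ X, |∑ i, (a (θ i) * φ (inner ℝ (θ i).1 x + (θ i).2) -
          ∫ t, a t * φ (inner ℝ t.1 x + t.2) ∂((scaledLaw pw σw).prod (scaledLaw pb σb)))| ≤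
        Real.sqrt N * (Bφ * v + 4 * (K * L) * R * (σw * Real.sqrt (∫ w, ‖w‖ ^ 2 * pw w)) +
          3 * (K * Bφ) * Real.sqrt (Real.log δ⁻¹)) := by
  have := isProbabilityMeasure_scaledLaw hp.regular_w hσw
  have := isProbabilityMeasure_scaledLaw hp.regular_b hσb
  set ν := (scaledLaw pw σw).prod (scaledLaw pb σb)
  obtain ⟨x₀, hx₀⟩ := hX
  have hφc : Continuous φ := hL.continuous
  let Y : E d × ℝ → E d → ℝ := fun θ x => a θ * φ (inner ℝ θ.1 x + θ.2)
  have hYm : ∀ x, Measurable fun θ => Y θ x := fun x =>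
    ha.mul (Continuous.measurable (by fun_prop))
  have hYK : ∀ θ x, |Y θ x| ≤ K * Bφ := fun θ x => by
    simp only [Y, abs_mul]
    exact mul_le_mul (hK θ) (hBφ _) (abs_nonneg _) hK0.le
  have hYc : ∀ θ, Continuous (Y θ) := fun θ => by simp only [Y]; fun_prop
  have hmc : Continuous fun x => ∫ θ, Y θ x ∂ν :=
    continuous_of_dominated (fun x => (hYm x).aestronglyMeasurable)
      (fun x => ae_of_all _ fun θ => hYK θ x) (integrable_const _) (ae_of_all _ hYc)
  have hm2 : 0 ≤ ∫ w, ‖w‖ ^ 2 * pw w :=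
    integral_nonneg fun w => mul_nonneg (by positivity) (hp.regular_w.nonneg w)
  -- The bias cancels in differences of φ(w·x + b), so the increments are dominated by K L |⟨w, x -
  -- y⟩| and the symmetric vector is the weight alone.
  refine one_sub_le_measure_forall_mem ν hx₀ hXR hYm hYc hmc (by positivity) hYK
    (W := Prod.fst) measurable_fst
    ((integrable_norm_sq_scaledLaw hp.regular_w hσw).comp_fst _)
    (map_fst_prod_scaledLaw_symm hp hσb) (by positivity) ?_ (by positivity) ?_ (by positivity) ?_
    hN hδ hδ1
  · rw [mul_pow, Real.sq_sqrt hm2, ← integral_norm_sq_scaledLaw hp.regular_w hσw]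
    exact le_of_eq (integral_fun_fst (fun w : E d => ‖w‖ ^ 2) |>.trans (by simp))
  · intro θ x y
    simp only [Y]
    rw [← mul_sub, abs_mul, mul_assoc]
    gcongr
    · exact hK θ
    · have := hL.dist_le_mul (inner ℝ θ.1 x + θ.2) (inner ℝ θ.1 y + θ.2)
      rw [Real.dist_eq, Real.dist_eq, add_sub_add_right_eq_sub, ← inner_sub_right] at this
      exact this
  · have hai : Integrable (fun θ => a θ ^ 2) ν := by
      refine Integrable.of_bound (ha.pow_const 2).aestronglyMeasurable (K ^ 2)
        (ae_of_all _ fun θ => ?_)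
      rw [norm_pow, Real.norm_eq_abs]
      gcongr
      exact hK θ
    calc ∫ θ, Y θ x₀ ^ 2 ∂ν ≤ ∫ θ, Bφ ^ 2 * a θ ^ 2 ∂ν := by
          refine integral_mono_of_nonneg (ae_of_all _ fun _ => sq_nonneg _) (hai.const_mul _)
            (ae_of_all _ fun θ => ?_)
          simp only [Y]
          rw [mul_pow, mul_comm]
          refine mul_le_mul_of_nonneg_right (sq_le_sq.2 ?_) (sq_nonneg _)
          rw [abs_of_pos hBφ0]
          exact hBφ _
      _ = Bφ ^ 2 * ∫ θ, a θ ^ 2 ∂ν := integral_const_mul _ _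
      _ ≤ Bφ ^ 2 * v ^ 2 := by gcongr
      _ = (Bφ * v) ^ 2 := by ring

/-- The standard deviation of the Monte Carlo average, when not of order `σw`, is dominated by
the bias. -/
lemma exists_std_bound {σw σb K κ r : ℝ} (hσw : 0 < σw) (hσb : 0 < σb) (hK : 0 ≤ K) (hκ : 0 ≤ κ)
    (hr : 1 ≤ r) (d : ℕ) : ∃ v : ℝ, 0 ≤ v ∧ min (K ^ 2) (κ ^ 2 / σb) ≤ v ^ 2 ∧
      σw ^ d * σb * v / r ≤ (K + κ) * (1 / σw + σw ^ d * σb * σw / r) := by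
  have hr0 : 0 < r := by linarith
  have hσd : 0 < σw ^ d := by positivity
  -- For σw ≥ 1 the crude bound `K` suffices, since K ≤ K σw. For σw ≤ 1 the choice κ/√σb leaves
  -- σw^d √σb / r: this is at most σw^d σb σw / r when σw √σb ≥ 1, and at most √σb ≤ 1/σw otherwise.
  rcases le_total 1 σw with h1 | h1
  · refine ⟨K, hK, min_le_left _ _, ?_⟩
    have e1 : σw ^ d * σb * K / r ≤ σw ^ d * σb * (K * σw) / r := by
      gcongr
      exact le_mul_of_one_le_right hK h1
    have e2 : σw ^ d * σb * (K * σw) / r = K * (σw ^ d * σb * σw / r) := by ring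
    have e3 : 0 ≤ σw ^ d * σb * σw / r := by positivity
    have e4 : 0 ≤ 1 / σw := by positivity
    rw [e2] at e1
    nlinarith [mul_nonneg hκ e3, mul_nonneg hκ e4, mul_nonneg hK e4]
  · set t := Real.sqrt σb
    have ht : 0 < t := Real.sqrt_pos.2 hσb
    have htt : t ^ 2 = σb := Real.sq_sqrt hσb.le
    refine ⟨κ / t, by positivity, (min_le_right _ _).trans (by rw [div_pow, htt]), ?_⟩
    have e0 : σw ^ d * σb * (κ / t) / r = κ * (σw ^ d * t / r) := by
      rw [← htt]; field_simp
    have key : σw ^ d * t / r ≤ 1 / σw + σw ^ d * σb * σw / r := by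
      rcases le_total 1 (σw * t) with h2 | h2
      · have : σw ^ d * t / r ≤ σw ^ d * σb * σw / r := by
          rw [← htt, mul_assoc]
          gcongr
          nlinarith
        have : 0 ≤ 1 / σw := by positivity
        linarith
      · have h3 : t ≤ 1 / σw := by rw [le_div_iff₀ hσw]; linarith
        have h4 : σw ^ d * t / r ≤ t := by
          rw [div_le_iff₀ hr0]
          have : σw ^ d ≤ 1 := pow_le_one₀ hσw.le h1
          nlinarith
        have : 0 ≤ σw ^ d * σb * σw / r := by positivity
        linarith
    rw [e0]
    have e3 : 0 ≤ σw ^ d * σb * σw / r := by positivity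
    have e4 : 0 ≤ 1 / σw := by positivity
    nlinarith [mul_le_mul_of_nonneg_left key hκ, mul_nonneg hK e3, mul_nonneg hK e4]

lemma ridgeletOp_eq (φ ψ : ℝ → ℝ) (pw : E d → ℝ) (pb : ℝ → ℝ) (S : ℝ) (χ f : E d → ℝ)
    (σw σb : ℝ) (n N : ℕ) (θ : Fin N → E d × ℝ) (x : E d) :
    ridgeletOp φ ψ pw pb S χ σw σb n N θ f x = totalMass pw pb σw σb * (N : ℝ)⁻¹ *
      ∑ i, gridAmplitude n S (fun y => χ y * f y) ψ (θ i) *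
        φ (inner ℝ (θ i).1 x + (θ i).2) := by
  simp only [ridgeletOp, discreteOp, gridAmplitude]
  rw [Finset.mul_sum]
  refine Finset.sum_congr rfl fun i _ => ?_
  rw [mul_assoc, mul_assoc, mul_assoc]
  congr 3
  refine Finset.sum_congr rfl fun j _ => ?_
  ring

end MonteCarlo

end Ridgelet

end

noncomputable section

namespace Ridgelet

/-! ### Assembly of bias and deviation -/

section Main

variable {d : ℕ}

/-- The deterministic part of the error: smoothing in the weights, finite spread of the biases and
cubature. -/
lemma exists_bias_bound {φ : ℝ → ℝ} {φhat : ℝ → ℂ} {ψ : 𝓢(ℝ, ℝ)} (hφψ : ActivationPair d φ φhat ψ)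
    {Bφ : ℝ} (hBφ : ∀ t, |φ t| ≤ Bφ) {pw : E d → ℝ} {pb : ℝ → ℝ} (hp : FiniteBandwidth pw pb)
    {S : ℝ} (hS : 0 < S) {X : Set (E d)} {χ : E d → ℝ} (hχ : IsMollifier S X χ) :
    ∃ C : ℝ, 0 ≤ C ∧ ∀ f : E d → ℝ, ContDiff ℝ 1 f → M1star S f < ⊤ →
      ∀ σw σb : ℝ, 0 < σw → 0 < σb → ∀ n : ℕ, 1 ≤ n → ∀ x ∈ X,
        |f x - totalMass pw pb σw σb * ∫ θ, gridAmplitude n S (fun y => χ y * f y) ψ θ *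
            φ (inner ℝ θ.1 x + θ.2) ∂((scaledLaw pw σw).prod (scaledLaw pb σb))| ≤
          C * (M1star S f).toReal * (1 / σw + σw ^ d * (σw + 1) / σb +
            σb * σw ^ d * (σw + 1) / n) := by
  obtain ⟨m, hgen, hvan⟩ := hφψ.genFourier
  obtain ⟨hκ, hk⟩ := correlation_eq_integral hgen hvan
  obtain ⟨Lχ, hLχ0, hLχ⟩ := exists_lipschitz_mollifier_mul hχ
  obtain ⟨Bψ, hBψ0, hBψ, hBψL⟩ := exists_bound_schwartz ψ
  obtain ⟨Q, hQ⟩ := hp.deriv_bounded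
  have hφc : Continuous φ := hφψ.growth.1
  have hBφ0 : 0 ≤ Bφ := (abs_nonneg _).trans (hBφ 0)
  have hQ0 : 0 ≤ Q := (abs_nonneg _).trans (hQ 0)
  set A := ∫ ξ, ‖fourierReal pw ξ‖
  set B := ∫ ξ, ‖fourierReal pb ξ‖
  have hA : 0 < A := hp.regular_w.integral_norm_fourierReal_pos
  have hB : 0 < B := hp.regular_b.integral_norm_fourierReal_pos
  set κ : ℝ → ℂ := fun ξ => starRingEnd ℂ (fourierReal ψ ξ) * φhat ξ
  set c₀ := Real.sqrt (2 * Real.pi) / (A * B)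
  have hc₀ : 0 ≤ c₀ := by positivity
  set V := volume.real (cube d S)
  set m₀ := ∫ t, |ψ t|
  set m₁ := ∫ t, |t| * |ψ t|
  set mw := ∫ w, ‖w‖ * pw w
  have hm₀ : 0 ≤ m₀ := integral_nonneg fun _ => abs_nonneg _
  have hm₁ : 0 ≤ m₁ := integral_nonneg fun _ => by positivity
  have hmw : 0 ≤ mw := integral_nonneg fun w =>
    mul_nonneg (norm_nonneg _) (hp.regular_w.nonneg w)
  set C₁ := ((2 * Real.pi) ^ ((d : ℝ) / 2) / A * (∫ ξ : ℝ, (|ξ| ^ (d + 1))⁻¹ * ‖κ ξ‖) *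
    ∫ z, ‖z‖ * ‖fourierReal pw z‖) * Lχ
  have hC₁ : 0 ≤ C₁ := by
    have h1 : 0 ≤ ∫ ξ : ℝ, (|ξ| ^ (d + 1))⁻¹ * ‖κ ξ‖ := integral_nonneg fun _ => by positivity
    have h2 : 0 ≤ ∫ z, ‖z‖ * ‖fourierReal pw z‖ := integral_nonneg fun _ => by positivity
    positivity
  set C₂ := c₀ * (Bφ * Q) * V * (m₁ + (d * S) * m₀ * mw)
  have hC₂ : 0 ≤ C₂ := by positivity
  set C₃ := c₀ * Bφ * ((2 * S) ^ d * (2 * S * d)) * Bψ * (Lχ + mw)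
  have hC₃ : 0 ≤ C₃ := by positivity
  refine ⟨C₁ + C₂ + C₃, by positivity, fun f hf hM σw σb hσw hσb n hn x hx => ?_⟩
  have := isProbabilityMeasure_scaledLaw hp.regular_w hσw
  have := isProbabilityMeasure_scaledLaw hp.regular_b hσb
  have hn' : (0 : ℝ) < n := by exact_mod_cast hn
  set M := (M1star S f).toReal
  have hM0 : 0 ≤ M := ENNReal.toReal_nonneg
  set g : E d → ℝ := fun y => χ y * f y
  have hgL : ∀ x y, |g x - g y| ≤ Lχ * M * ‖x - y‖ := hLχ f hf hM
  have hgM : ∀ x, |g x| ≤ M := abs_mollifier_mul_le hχ hM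
  have hgc : Continuous g := hχ.smooth.continuous.mul hf.continuous
  have hg0 : ∀ x, x ∉ cube d S → g x = 0 := fun y hy => by simp [g, hχ.eq_zero y hy]
  have hcubefin : volume (cube d S) < ⊤ := (isCompact_cube S).measure_lt_top
  have hg : Integrable g :=
    hgc.integrable_of_hasCompactSupport (HasCompactSupport.intro (isCompact_cube S) hg0)
  have hG : ∫ y, |g y| ≤ M * V := by
    have h1 : ∫ y, |g y| = ∫ y in cube d S, |g y| :=
      (setIntegral_eq_integral_of_forall_compl_eq_zero fun y hy => by simp [hg0 y hy]).symm
    rw [h1]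
    have h2 := norm_setIntegral_le_of_norm_le_const (f := fun y => |g y|) (C := M) hcubefin
      (fun y _ => by rw [Real.norm_eq_abs, abs_abs]; exact hgM y)
    exact (le_abs_self _).trans h2
  have hfx : f x = g x := by simp [g, hχ.eq_one x hx]
  set Z := totalMass pw pb σw σb
  have hZ : Z = c₀ * σw ^ d * σb := by
    simp only [Z, totalMass, c₀, A, B]; ring
  have hZ0 : 0 ≤ Z := by rw [hZ]; positivity
  set ν := (scaledLaw pw σw).prod (scaledLaw pb σb) with hν
  -- The chain g(x), `T`, `Z * Rx`, `Z * Dx` changes one thing at a time: smoothing of the weights,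
  -- the law of the bias, the grid. Its three gaps are the three bias terms.
  set T := σw ^ d / A * ∫ w, pw w * ∫ y, g y * ∫ b, ψ b * φ (b + inner ℝ (σw • w) (x - y))
  set Rx := ∫ θ, amplitude g ψ θ * φ (inner ℝ θ.1 x + θ.2) ∂ν
  set Dx := ∫ θ, gridAmplitude n S g ψ θ * φ (inner ℝ θ.1 x + θ.2) ∂ν
  have e₁ : |T - g x| ≤ C₁ * M * (1 / σw) := by
    have h := abs_reconstruction_sub_le (d := d) hp.regular_w hp.fourier_second_moment hκ
      hφψ.admissible hφψ.integrable (k := fun s => ∫ b, ψ b * φ (b + s)) hk hg hgM hgL hσw x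
    refine h.trans (le_of_eq ?_)
    simp only [C₁]; ring
  have e₂ : |Z * Rx - T| ≤ C₂ * M * (σw ^ d * (σw + 1) / σb) := by
    have h := abs_mean_sub_reconstruction_le hp hQ hφc hBφ ψ hgc hg hg0 hσw hσb x
    rw [nodeLaw_eq_prod] at h
    refine h.trans ?_
    have h1 : m₁ + (d * S) * m₀ * mw * σw ≤ (m₁ + (d * S) * m₀ * mw) * (σw + 1) := by
      have : 0 ≤ (d * S) * m₀ * mw := by positivity
      nlinarith [mul_nonneg hm₁ hσw.le]
    calc c₀ * (Bφ * Q) * (∫ y, |g y|) * (m₁ + (d * S) * m₀ * mw * σw) * (σw ^ d / σb)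
        ≤ c₀ * (Bφ * Q) * (M * V) * ((m₁ + (d * S) * m₀ * mw) * (σw + 1)) * (σw ^ d / σb) := by
          gcongr
      _ = _ := by simp only [C₂]; ring
  have e₃ : |Z * Dx - Z * Rx| ≤ C₃ * M * (σb * σw ^ d * (σw + 1) / n) := by
    have hψc := ψ.continuous
    have iD : Integrable (fun θ : E d × ℝ => gridAmplitude n S g ψ θ *
        φ (inner ℝ θ.1 x + θ.2)) ν := by
      refine integrable_nodeLaw_of_bound hp hσw hσb
        ((measurable_gridAmplitude n S g hψc).mul (Continuous.measurable (by fun_prop)))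
        (B := ((2 * S) ^ d * (M * Bψ)) * Bφ) fun θ => ?_
      rw [abs_mul]
      exact mul_le_mul (abs_gridAmplitude_le hn hS hgM hBψ θ) (hBφ _) (abs_nonneg _)
        (by positivity)
    have iR : Integrable (fun θ : E d × ℝ => amplitude g ψ θ * φ (inner ℝ θ.1 x + θ.2)) ν := by
      refine integrable_nodeLaw_of_bound hp hσw hσb
        ((measurable_amplitude hgc hψc).mul (Continuous.measurable (by fun_prop)))
        (B := ((∫ y, |g y|) * Bψ) * Bφ) fun θ => ?_
      rw [abs_mul]
      exact mul_le_mul (abs_amplitude_le hg hBψ θ) (hBφ _) (abs_nonneg _)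
        ((abs_nonneg _).trans (abs_amplitude_le hg hBψ θ))
    have iw : Integrable (fun θ : E d × ℝ => ‖θ.1‖) ν :=
      (integrable_norm_scaledLaw hp.regular_w hσw).comp_fst _
    have hw : ∫ θ : E d × ℝ, ‖θ.1‖ ∂ν = σw * mw := by
      rw [← integral_norm_scaledLaw hp.regular_w hσw, hν, integral_fun_fst (fun w : E d => ‖w‖)]
      simp
    set c₁ := (2 * S) ^ d * (2 * S * d) * Bψ * Bφ / n
    have hle : ∀ θ : E d × ℝ, ‖gridAmplitude n S g ψ θ * φ (inner ℝ θ.1 x + θ.2) -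
        amplitude g ψ θ * φ (inner ℝ θ.1 x + θ.2)‖ ≤ c₁ * (Lχ * M) + (c₁ * M) * ‖θ.1‖ := by
      intro θ
      rw [← sub_mul, norm_mul, Real.norm_eq_abs, Real.norm_eq_abs]
      have h1 := abs_gridAmplitude_sub_amplitude_le hn hS hgM (by positivity) hgL hg hgc hg0 hψc
        hBψ0.le hBψ hBψL θ
      refine (mul_le_mul h1 (hBφ _) (abs_nonneg _) (by positivity)).trans (le_of_eq ?_)
      simp only [c₁]; ring
    have hbnd : |Dx - Rx| ≤ c₁ * (Lχ * M) + (c₁ * M) * (σw * mw) := by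
      simp only [Dx, Rx]
      rw [← integral_sub iD iR, ← Real.norm_eq_abs]
      have iB : Integrable (fun θ : E d × ℝ => c₁ * (Lχ * M) + (c₁ * M) * ‖θ.1‖) ν :=
        (integrable_const _).add (iw.const_mul _)
      refine (norm_integral_le_of_norm_le iB (ae_of_all _ hle)).trans (le_of_eq ?_)
      have iw2 : Integrable (fun θ : E d × ℝ => (c₁ * M) * ‖θ.1‖) ν := iw.const_mul _
      rw [integral_add (integrable_const _) iw2, integral_const_mul (c₁ * M), hw]
      simp
    rw [← mul_sub, abs_mul, abs_of_nonneg hZ0]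
    have h2 : c₁ * (Lχ * M) + (c₁ * M) * (σw * mw) ≤ c₁ * M * ((Lχ + mw) * (σw + 1)) := by
      have hc₁ : 0 ≤ c₁ := by positivity
      have : Lχ + σw * mw ≤ (Lχ + mw) * (σw + 1) := by nlinarith [mul_nonneg hLχ0.le hσw.le]
      calc c₁ * (Lχ * M) + (c₁ * M) * (σw * mw) = c₁ * M * (Lχ + σw * mw) := by ring
        _ ≤ _ := by gcongr
    calc Z * |Dx - Rx| ≤ Z * (c₁ * M * ((Lχ + mw) * (σw + 1))) :=
          mul_le_mul_of_nonneg_left (hbnd.trans h2) hZ0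
      _ = _ := by simp only [hZ, c₁, C₃]; ring
  have htri : |f x - Z * Dx| ≤ |T - g x| + |Z * Rx - T| + |Z * Dx - Z * Rx| := by
    rw [hfx]
    have : g x - Z * Dx = -((T - g x) + (Z * Rx - T) + (Z * Dx - Z * Rx)) := by ring
    rw [this, abs_neg]
    exact abs_add_three _ _ _
  refine htri.trans ((add_le_add (add_le_add e₁ e₂) e₃).trans ?_)
  have t₁ : 0 ≤ 1 / σw := by positivity
  have t₂ : 0 ≤ σw ^ d * (σw + 1) / σb := by positivity
  have t₃ : 0 ≤ σb * σw ^ d * (σw + 1) / n := by positivity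
  calc C₁ * M * (1 / σw) + C₂ * M * (σw ^ d * (σw + 1) / σb) +
        C₃ * M * (σb * σw ^ d * (σw + 1) / n)
      ≤ (C₁ + C₂ + C₃) * M * (1 / σw) + (C₁ + C₂ + C₃) * M * (σw ^ d * (σw + 1) / σb) +
        (C₁ + C₂ + C₃) * M * (σb * σw ^ d * (σw + 1) / n) := by
        gcongr <;> linarith
    _ = _ := by ring

/-- The Monte Carlo error, up to a multiple of `1 / σw`. -/
lemma exists_deviation_bound {φ : ℝ → ℝ} {L : ℝ≥0} (hL : LipschitzWith L φ) (ψ : 𝓢(ℝ, ℝ))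
    {Bφ : ℝ} (hBφ0 : 0 < Bφ) (hBφ : ∀ t, |φ t| ≤ Bφ) {pw : E d → ℝ} {pb : ℝ → ℝ}
    (hp : FiniteBandwidth pw pb) {S : ℝ} (hS : 0 < S) {X : Set (E d)} (hX : X.Nonempty)
    (hXS : X ⊆ cube d S) :
    ∃ C : ℝ, 0 ≤ C ∧ ∀ g : E d → ℝ, ∀ M : ℝ, 0 < M → (∀ x, |g x| ≤ M) →
      ∀ σw σb δ : ℝ, 0 < σw → 0 < σb → 0 < δ → δ < 1 → ∀ n N : ℕ, 1 ≤ n → 1 ≤ N →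
      ∃ G : Set (Fin N → E d × ℝ), MeasurableSet G ∧ ENNReal.ofReal (1 - δ) ≤
          (Measure.pi fun _ : Fin N => (scaledLaw pw σw).prod (scaledLaw pb σb)) G ∧
        ∀ θ ∈ G, ∀ x ∈ X, totalMass pw pb σw σb * (N : ℝ)⁻¹ *
          |∑ i, (gridAmplitude n S g ψ (θ i) * φ (inner ℝ (θ i).1 x + (θ i).2) -
            ∫ t, gridAmplitude n S g ψ t * φ (inner ℝ t.1 x + t.2)
              ∂((scaledLaw pw σw).prod (scaledLaw pb σb)))| ≤
          C * M * (1 / σw + σb * σw ^ d * (σw + Real.sqrt (Real.log δ⁻¹)) / Real.sqrt N) := by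
  obtain ⟨Bψ, hBψ0, hBψ, -⟩ := exists_bound_schwartz ψ
  obtain ⟨Bp, hBp0, hBp⟩ := hp.regular_b.exists_forall_le hp.differentiable_b.continuous
  set A := ∫ ξ, ‖fourierReal pw ξ‖
  set B := ∫ ξ, ‖fourierReal pb ξ‖
  have hA : 0 < A := hp.regular_w.integral_norm_fourierReal_pos
  have hB : 0 < B := hp.regular_b.integral_norm_fourierReal_pos
  set c₀ := Real.sqrt (2 * Real.pi) / (A * B)
  have hc₀ : 0 ≤ c₀ := by positivity
  set m₀ := ∫ t, |ψ t|
  have hm₀ : 0 ≤ m₀ := integral_nonneg fun _ => abs_nonneg _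
  set K₁ := (2 * S) ^ d * Bψ
  have hK₁ : 0 < K₁ := by positivity
  -- From E a² ≤ sup|a| · E|a|: the first factor is at most K₁ M, the second carries the gain 1/σb.
  set K₂ := Real.sqrt (K₁ * ((2 * S) ^ d * (Bp * m₀)))
  have hK₂ : 0 ≤ K₂ := Real.sqrt_nonneg _
  set s₂ := Real.sqrt (∫ w, ‖w‖ ^ 2 * pw w)
  have hs₂ : 0 ≤ s₂ := Real.sqrt_nonneg _
  set C₁ := c₀ * Bφ * (K₁ + K₂)
  set C₂ := c₀ * (4 * (K₁ * L) * (d * S) * s₂)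
  set C₃ := c₀ * (3 * (K₁ * Bφ))
  have hC₁ : 0 ≤ C₁ := by positivity
  have hC₂ : 0 ≤ C₂ := by positivity
  have hC₃ : 0 ≤ C₃ := by positivity
  refine ⟨C₁ + C₂ + C₃, by positivity, fun g M hM hgM σw σb δ hσw hσb hδ hδ1 n N hn hN => ?_⟩
  have := isProbabilityMeasure_scaledLaw hp.regular_w hσw
  have := isProbabilityMeasure_scaledLaw hp.regular_b hσb
  set ν := (scaledLaw pw σw).prod (scaledLaw pb σb)
  have hN' : (1 : ℝ) ≤ N := by exact_mod_cast hN
  set r := Real.sqrt N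
  have hr : 1 ≤ r := Real.one_le_sqrt.2 hN'
  have hrr : r * r = N := Real.mul_self_sqrt (by positivity)
  have ham := measurable_gridAmplitude n S g ψ.continuous
  have haK : ∀ θ, |gridAmplitude n S g ψ θ| ≤ K₁ * M := fun θ =>
    (abs_gridAmplitude_le hn hS hgM hBψ θ).trans (le_of_eq (by simp only [K₁]; ring))
  obtain ⟨v, hv, hv2, hvle⟩ := exists_std_bound (K := K₁ * M) (κ := K₂ * M) hσw hσb
    (by positivity) (by positivity) hr d
  have hsecond : ∫ θ, gridAmplitude n S g ψ θ ^ 2 ∂ν ≤ v ^ 2 := by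
    refine le_trans (le_min ?_ ?_) hv2
    · have h := norm_integral_le_of_norm_le_const (μ := ν)
        (f := fun θ => gridAmplitude n S g ψ θ ^ 2) (C := (K₁ * M) ^ 2) (ae_of_all _ fun θ => by
          rw [norm_pow, Real.norm_eq_abs]
          gcongr
          exact haK θ)
      simp only [probReal_univ, mul_one] at h
      exact (le_abs_self _).trans h
    · have hai : Integrable (fun θ => |gridAmplitude n S g ψ θ|) ν :=
        integrable_nodeLaw_of_bound hp hσw hσb ham.abs fun θ => by rw [abs_abs]; exact haK θ
      calc ∫ θ, gridAmplitude n S g ψ θ ^ 2 ∂ν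
          ≤ ∫ θ, (K₁ * M) * |gridAmplitude n S g ψ θ| ∂ν := by
            refine integral_mono_of_nonneg (ae_of_all _ fun _ => sq_nonneg _) (hai.const_mul _)
              (ae_of_all _ fun θ => ?_)
            simp only
            rw [← sq_abs, sq]
            gcongr
            exact haK θ
        _ = (K₁ * M) * ∫ θ, |gridAmplitude n S g ψ θ| ∂ν := integral_const_mul _ _
        _ ≤ (K₁ * M) * ((2 * S) ^ d * M * (Bp * m₀ / σb)) := by
            gcongr
            exact integral_abs_gridAmplitude_le hp hBp ψ hn hS hgM hσw hσb
        _ = (K₂ * M) ^ 2 / σb := by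
            have hK₂sq : K₂ ^ 2 = K₁ * ((2 * S) ^ d * (Bp * m₀)) :=
              Real.sq_sqrt (by positivity)
            rw [mul_pow K₂ M, hK₂sq]; ring
  obtain ⟨G, hGm, hGδ, hG⟩ := exists_measurableSet_abs_sum_sub_mean_le hp hL hBφ0 hBφ ham
    (by positivity) haK hσw hσb hX (fun x hx => norm_le_of_mem_cube (hXS hx)) hv hsecond hN hδ hδ1
  refine ⟨G, hGm, hGδ, fun θ hθ x hx => ?_⟩
  set ℓ := Real.sqrt (Real.log δ⁻¹)
  have hℓ : 0 ≤ ℓ := Real.sqrt_nonneg _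
  set Z := totalMass pw pb σw σb
  have hZ : Z = c₀ * σw ^ d * σb := by
    simp only [Z, totalMass, c₀, A, B]; ring
  have hr0 : 0 < r := by linarith
  have hdev := hG θ hθ x hx
  have hZ0 : 0 ≤ Z * (N : ℝ)⁻¹ := by rw [hZ]; positivity
  set w₁ := σw ^ d * σb * σw / r
  set w₂ := σw ^ d * σb * ℓ / r
  have hw₁ : 0 ≤ w₁ := by positivity
  have hw₂ : 0 ≤ w₂ := by positivity
  have hw₀ : 0 ≤ 1 / σw := by positivity
  calc _ ≤ Z * (N : ℝ)⁻¹ * (r * (Bφ * v + 4 * (K₁ * M * L) * (d * S) * (σw * s₂) +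
          3 * (K₁ * M * Bφ) * ℓ)) := mul_le_mul_of_nonneg_left hdev hZ0
    _ = c₀ * Bφ * (σw ^ d * σb * v / r) + C₂ * M * w₁ + C₃ * M * w₂ := by
        rw [hZ, ← hrr]
        simp only [C₂, C₃, w₁, w₂]
        field_simp
    -- The one-point standard deviation is traded here for the Monte Carlo rate plus a multiple of
    -- 1/σw, the only place where the fluctuation borrows from the bias.
    _ ≤ c₀ * Bφ * ((K₁ * M + K₂ * M) * (1 / σw + w₁)) + C₂ * M * w₁ + C₃ * M * w₂ := by
        gcongr
    _ = C₁ * M * (1 / σw) + (C₁ + C₂) * M * w₁ + C₃ * M * w₂ := by simp only [C₁]; ring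
    _ ≤ (C₁ + C₂ + C₃) * M * (1 / σw) + (C₁ + C₂ + C₃) * M * w₁ + (C₁ + C₂ + C₃) * M * w₂ := by
        refine add_le_add (add_le_add ?_ ?_) ?_
        · exact mul_le_mul_of_nonneg_right (mul_le_mul_of_nonneg_right (by linarith) hM.le) hw₀
        · exact mul_le_mul_of_nonneg_right (mul_le_mul_of_nonneg_right (by linarith) hM.le) hw₁
        · exact mul_le_mul_of_nonneg_right (mul_le_mul_of_nonneg_right (by linarith) hM.le) hw₂
    _ = _ := by simp only [w₁, w₂]; ring

end Main

end Ridgelet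

end

theorem mainTheorem3 {d : ℕ} (hd : 1 ≤ d)
    (φ : ℝ → ℝ) (φhat : ℝ → ℂ) (ψ : 𝓢(ℝ, ℝ)) (hφψ : Ridgelet.ActivationPair d φ φhat ψ)
    (L : ℝ≥0) (hL : LipschitzWith L φ)
    (pw : Ridgelet.E d → ℝ) (pb : ℝ → ℝ) (hp : Ridgelet.FiniteBandwidth pw pb)
    (S : ℝ) (hS : 0 < S) (X : Set (Ridgelet.E d)) (hX : IsCompact X)
    (hXS : X ⊆ interior (Ridgelet.cube d S))
    (χ : Ridgelet.E d → ℝ) (hχ : Ridgelet.IsMollifier S X χ) :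
    ∃ C : ℝ, 0 < C ∧
      ∀ f : Ridgelet.E d → ℝ, ContDiff ℝ 1 f → Ridgelet.M1star S f < ⊤ →
      ∀ σw σb δ : ℝ, 0 < σw → 0 < σb → 0 < δ → δ < 1 →
      ∀ n D N : ℕ, 1 ≤ n → D = n ^ d → 1 ≤ N →
      ∀ (Ω : Type*) [MeasurableSpace Ω] (P : Measure Ω) [IsProbabilityMeasure P]
        (θ : Fin N → Ω → Ridgelet.E d × ℝ),
        (∀ i, Measurable (θ i)) →
        (∀ i, P.map (θ i) = Ridgelet.nodeLaw pw pb σw σb) →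
        iIndepFun θ P →
        ENNReal.ofReal (1 - δ) ≤ P {ω | ∀ x ∈ X,
          |f x - Ridgelet.ridgeletOp φ ψ pw pb S χ σw σb n N (fun i => θ i ω) f x| ≤
            C * (Ridgelet.M1star S f).toReal *
              (1 / σw + σw ^ d * (σw + 1) / σb
                + σb * σw ^ d * (σw + 1) / (D : ℝ) ^ ((1 : ℝ) / d)
                + σb * σw ^ d * (σw + Real.sqrt (Real.log δ⁻¹)) / Real.sqrt N)} := by
  open Ridgelet in
  have hXc : X ⊆ cube d S := hXS.trans interior_subset
  obtain ⟨Bφ, hBφ0, hBφ⟩ : ∃ B : ℝ, 0 < B ∧ ∀ t, |φ t| ≤ B := by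
    obtain ⟨B, hB⟩ := hφψ.growth.2
    refine ⟨|B| * 2 + 1, by positivity, fun t => (hB t).trans ?_⟩
    simp only [pow_zero]
    linarith [le_abs_self B]
  -- The deviation bound needs a base point in X.
  rcases X.eq_empty_or_nonempty with rfl | hXne
  · refine ⟨1, one_pos, ?_⟩
    intro f _ _ σw σb δ _ _ hδ _ n D N _ _ _ Ω _ P _ θ _ _ _
    simp only [Set.mem_empty_iff_false, false_imp_iff, implies_true, Set.ofPred_true, measure_univ]
    exact ENNReal.ofReal_le_one.2 (by linarith)
  obtain ⟨C₁, hC₁, hbias⟩ := exists_bias_bound hφψ hBφ hp hS hχ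
  obtain ⟨C₂, hC₂, hdev⟩ := exists_deviation_bound hL ψ hBφ0 hBφ hp hS hXne hXc
  refine ⟨C₁ + C₂ + 1, by positivity, ?_⟩
  intro f hf hM σw σb δ hσw hσb hδ hδ1 n D N hn hD hN Ω _ P _ θ hθm hθlaw hθind
  have hDn : (D : ℝ) ^ ((1 : ℝ) / d) = n := by
    rw [hD, Nat.cast_pow, one_div, Real.pow_rpow_inv_natCast (by positivity) (by omega)]
  rw [hDn]
  have hn' : (0 : ℝ) < n := by exact_mod_cast hn
  have hN' : (0 : ℝ) < N := by exact_mod_cast hN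
  set M := (M1star S f).toReal
  have hM0 : 0 ≤ M := ENNReal.toReal_nonneg
  set ν := (scaledLaw pw σw).prod (scaledLaw pb σb)
  have hgM : ∀ x, |χ x * f x| ≤ M := abs_mollifier_mul_le hχ hM
  -- Concentration is stated for a strictly positive bound on the coefficients. If M₁*(f) = 0 then χ
  -- f vanishes identically, and both f on X and the operator are zero.
  rcases hM0.eq_or_lt with hM0' | hMpos
  · have hall : ∀ ω, ∀ x ∈ X,
        |f x - ridgeletOp φ ψ pw pb S χ σw σb n N (fun i => θ i ω) f x| ≤
          (C₁ + C₂ + 1) * M * (1 / σw + σw ^ d * (σw + 1) / σb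
                + σb * σw ^ d * (σw + 1) / n
                + σb * σw ^ d * (σw + Real.sqrt (Real.log δ⁻¹)) / Real.sqrt N) := by
      intro ω x hx
      have hg0 : ∀ y, χ y * f y = 0 := fun y => by
        have := hgM y
        rw [← hM0'] at this
        exact abs_nonpos_iff.1 this
      have hfx : f x = 0 := by
        have := hg0 x
        rwa [hχ.eq_one x hx, one_mul] at this
      rw [ridgeletOp_eq, hfx, ← hM0']
      simp [gridAmplitude, hg0]
    refine (ENNReal.ofReal_le_one.2 (by linarith)).trans ?_
    rw [← measure_univ (μ := P)]
    exact measure_mono fun ω _ => hall ω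
  obtain ⟨G, hGm, hGδ, hG⟩ := hdev (fun y => χ y * f y) M hMpos hgM σw σb δ hσw hσb hδ hδ1 n N hn hN
  -- Independence and the common law identify the joint law with the product measure, so the good
  -- event pulls back to Ω with the same probability.
  have hmap : P.map (fun ω i => θ i ω) = Measure.pi fun _ : Fin N => ν := by
    rw [(iIndepFun_iff_map_fun_eq_pi_map fun i => (hθm i).aemeasurable).1 hθind]
    congr 1
    funext i
    rw [hθlaw i, nodeLaw_eq_prod]
  rw [← hmap, Measure.map_apply (measurable_pi_lambda _ hθm) hGm] at hGδ
  refine hGδ.trans (measure_mono fun ω hω x hx => ?_)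
  have h₁ := hbias f hf hM σw σb hσw hσb n hn x hx
  have h₂ := hG _ hω x hx
  rw [ridgeletOp_eq]
  set Z := totalMass pw pb σw σb
  have hZ0 : 0 ≤ Z := by
    have h1 := hp.regular_w.integral_norm_fourierReal_pos
    have h2 := hp.regular_b.integral_norm_fourierReal_pos
    simp only [Z, totalMass]
    positivity
  set m := ∫ t, gridAmplitude n S (fun y => χ y * f y) ψ t * φ (inner ℝ t.1 x + t.2) ∂ν
  have hsum : Z * (N : ℝ)⁻¹ * ∑ i, gridAmplitude n S (fun y => χ y * f y) ψ (θ i ω) *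
        φ (inner ℝ (θ i ω).1 x + (θ i ω).2) = Z * m + Z * (N : ℝ)⁻¹ *
      ∑ i, (gridAmplitude n S (fun y => χ y * f y) ψ (θ i ω) *
        φ (inner ℝ (θ i ω).1 x + (θ i ω).2) - m) := by
    rw [Finset.sum_sub_distrib, Finset.sum_const, Finset.card_univ, Fintype.card_fin,
      nsmul_eq_mul]
    field_simp
    ring
  rw [hsum, ← sub_sub]
  refine (abs_sub _ _).trans ?_
  rw [abs_mul (Z * (N : ℝ)⁻¹), abs_of_nonneg (a := Z * (N : ℝ)⁻¹) (by positivity)]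
  refine (add_le_add h₁ h₂).trans ?_
  set t₁ := 1 / σw
  set t₂ := σw ^ d * (σw + 1) / σb
  set t₃ := σb * σw ^ d * (σw + 1) / n
  set t₄ := σb * σw ^ d * (σw + Real.sqrt (Real.log δ⁻¹)) / Real.sqrt N
  have ht₁ : 0 ≤ t₁ := by positivity
  have ht₂ : 0 ≤ t₂ := by positivity
  have ht₃ : 0 ≤ t₃ := by positivity
  have ht₄ : 0 ≤ t₄ := by positivity
  calc C₁ * M * (t₁ + t₂ + t₃) + C₂ * M * (t₁ + t₄)
      ≤ C₁ * M * (t₁ + t₂ + t₃ + t₄) + C₂ * M * (t₁ + t₂ + t₃ + t₄) := by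
        exact add_le_add (mul_le_mul_of_nonneg_left (by linarith) (by positivity))
          (mul_le_mul_of_nonneg_left (by linarith) (by positivity))
    _ = (C₁ + C₂) * M * (t₁ + t₂ + t₃ + t₄) := by ring
    _ ≤ (C₁ + C₂ + 1) * M * (t₁ + t₂ + t₃ + t₄) :=
        mul_le_mul_of_nonneg_right (mul_le_mul_of_nonneg_right (by linarith) hM0) (by positivity)
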